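/- **Calculus.** Terms are variables, names, and constructor applications $f(M_1,\dots,M_n)$. Each destructor $g$ has a finite set $\mathrm{def}(g)$ of rewrite rules $g(M_1,\dots,M_n)\to M$, where $M_1,\dots,M_n,M$ contain no names and the variables of $M$ occur in $M_1,\dots,M_n$; $g(M'_1,\dots,M'_n)\to M'$ means that this is an instance of a rule. Constructors and destructors are public or private. Some public constructors $f$ may be declared *data constructors*; such an $f$ of arity $n$ comes with public destructors $g_i$ ($i\le n$) defined by the single rule $g_i(f(x_1,\dots,x_n))\to x_i$. Processes, taken up to renaming of bound names and variables, are $$P,Q ::= \overline{M}\langle N\rangle.P \mid M(x).P \mid 0 \mid P|Q \mid\, !P \mid (\nu a)P \mid \mathtt{let}\ x=g(M_1,\dots,M_n)\ \mathtt{in}\ P\ \mathtt{else}\ Q \mid \mathtt{if}\ M=N\ \mathtt{then}\ P\ \mathtt{else}\ Q \mid \mathtt{event}(M).P .$$ A configuration is a pair $E,\mathcal P$ of a finite set of names and a finite multiset of closed processes. Reductions replace, in $\mathcal P$: $0$ by nothing; $!P$ by $P,\,!P$; $P|Q$ by $P,Q$; $(\nu a)P$ by $P\{a'/a\}$ with $a'\notin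 E$, which is added to $E$; $\overline N\langle M\rangle.Q,\ N(x).P$ by $Q,\ P\{M/x\}$; a destructor application by $P\{M'/x\}$ for some $M'$ with $g(M_1,\dots,M_n)\to M'$, or by $Q$ if there is no such $M'$; a conditional by $P$ if $M$ and $N$ are equal terms, and by $Q$ otherwise; and $\mathtt{event}(M).P$ by $P$ (this *executes* $\mathtt{event}(M)$). Let $\mathrm{Init}$ be a finite set of names. An *$\mathrm{Init}$-adversary* is a closed process $Q$ with $\mathrm{fn}(Q)\subseteq\mathrm{Init}$ that contains no events and no private constructor or destructor. For constructors $e,e'$ of the same arity $n$ and pairwise distinct variables $x_1,\dots,x_n$, the closed process $P_0$ satisfies the correspondence $\mathrm{event}(e(x_1,\dots,x_n))\rightsquigarrow\mathrm{event}(e'(x_1,\dots,x_n))$ against $\mathrm{Init}$-adversaries if for every $\mathrm{Init}$-adversary $Q$, every finite $E_0\supseteq \mathrm{fn}(P_0)\cup\mathrm{Init}$, every trace $E_0,\{P_0,Q\}\to^*E',\mathcal P'$ and every substitution $\sigma$: if the trace executes $\mathtt{event}(\sigma e(x_1,\dots,x_n))$, then there is $\sigma'$ with $\sigma'e(x_1,\dots,x_n)=\sigma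 e(x_1,\dots,x_n)$ such that the trace executes $\mathtt{event}(\sigma' e'(x_1,\dots,x_n))$. **Clauses.** Patterns are variables, constructor applications, and $a[p_1,\dots,p_m,i_1,\dots,i_k]$ for name function symbols $a$ ($p_j$ patterns, $i_j$ session identifiers, that is, variables or constants). Facts are $\mathrm{attacker}(p)$, $\mathrm{message}(p,p')$, $\mathrm{m\text{-}event}(p)$, $\mathrm{event}(p)$; clauses $H\Rightarrow C$ have a finite multiset $H$ of facts as hypothesis and a fact $C$ as conclusion. The instrumented process $P_0'=\mathrm{instr}(P_0)$ labels each replication of $P_0$ with a distinct session identifier variable $i$, and each restriction $(\nu a)$ with $a[t,s]$, where the symbols $a$ of different restrictions are distinct and distinct from all free names, $s$ lists the session identifiers of the replications above it and $t$ the variables bound above it by inputs and by applications of non-deterministic destructors (those that may return several results for the same arguments). Let $[\![P]\!]\rho H$ be given, for an environment $\rho$ (from variables, names and session identifiers to patterns), by: $[\![0]\!]\rho H=\emptyset$; $[\![P|Q]\!]\rho H=[\![P]\!]\rho H\cup[\![Q]\!]\rho H$; $[\![!^iP]\!]\rho H=[\![P]\!](\rho[i\mapsto i])H$; $[\![(\nu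 a:\ell)P]\!]\rho H=[\![P]\!](\rho[a\mapsto\rho(\ell)])H$; $[\![M(x).P]\!]\rho H=[\![P]\!](\rho[x\mapsto x])(H\wedge\mathrm{message}(\rho(M),x))$; $[\![\overline M\langle N\rangle.P]\!]\rho H=[\![P]\!]\rho H\cup\{H\Rightarrow\mathrm{message}(\rho(M),\rho(N))\}$; for a destructor application, the union of $[\![Q]\!]\rho H$ and of all $[\![P]\!]((\sigma\rho)[x\mapsto\sigma'p'])(\sigma H)$ for $g(p'_1,\dots,p'_n)\to p'$ in $\mathrm{def}(g)$ and $(\sigma,\sigma')$ a most general pair of substitutions with $\sigma\rho(M_j)=\sigma'p'_j$ for all $j$; for a conditional, $[\![P]\!](\sigma\rho)(\sigma H)\cup[\![Q]\!]\rho H$ with $\sigma$ the most general unifier of $\rho(M)$ and $\rho(N)$ (only $[\![Q]\!]\rho H$ if there is none); $[\![\mathtt{event}(M).P]\!]\rho H=[\![P]\!]\rho(H\wedge\mathrm{m\text{-}event}(\rho(M)))\cup\{H\Rightarrow\mathrm{event}(\rho(M))\}$. Here the bound variables and session identifiers are distinct and fresh. The set $\mathcal R_{P'_0,\mathrm{Init}}$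 consists of $[\![P_0']\!]\{a\mapsto a[\,]\}\emptyset$ and the clauses $\mathrm{attacker}(a[\,])$ for $a\in\mathrm{Init}$; $\mathrm{attacker}(b_0[x])$ for a special name function symbol $b_0$; $\bigwedge_j\mathrm{attacker}(x_j)\Rightarrow\mathrm{attacker}(f(x_1,\dots,x_n))$ for public constructors $f$; $\bigwedge_j\mathrm{attacker}(M_j)\Rightarrow\mathrm{attacker}(M)$ for the rewrite rules $g(M_1,\dots,M_n)\to M$ of public destructors; $\mathrm{message}(x,y)\wedge\mathrm{attacker}(x)\Rightarrow\mathrm{attacker}(y)$; and $\mathrm{attacker}(x)\wedge\mathrm{attacker}(y)\Rightarrow\mathrm{message}(x,y)$. **Solving algorithm.** For $R=H\Rightarrow C$ and $R'=H'\Rightarrow C'$ (variables renamed apart) with $F_0\in H'$ and $\sigma$ the most general unifier of $C$ and $F_0$, let $R\circ_{F_0}R'=\sigma(H\cup(H'\setminus\{F_0\}))\Rightarrow\sigma C'$. $H_1\Rightarrow C_1$ *subsumes* $H_2\Rightarrow C_2$ if $\sigma C_1=C_2$ and $\sigma H_1\subseteq H_2$ (as multisets) for some $\sigma$; $\mathrm{elim}$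 removes subsumed clauses from a set. Facts $\mathrm{attacker}(x)$ ($x$ a variable) and $\mathrm{m\text{-}event}(p)$ are *unselectable*. Fix a selection function $\mathrm{sel}$ from clauses to sets of facts with $\mathrm{sel}(H\Rightarrow C)\subseteq H$, which never selects unselectable facts and satisfies $\mathrm{sel}(H\Rightarrow\mathrm{attacker}(x))\ne\emptyset$ whenever $H$ contains a selectable fact, and a set $\mathcal F_{\mathrm{not}}$ of facts. Let $\mathrm{simplify}$ perform successively: replace, recursively, facts $\mathrm{attacker}(f(p_1,\dots,p_n))$ for data constructors $f$ by the facts $\mathrm{attacker}(p_1),\dots,\mathrm{attacker}(p_n)$, in the hypothesis and in the conclusion (there yielding one clause for each of these facts), except that the clauses $\bigwedge_j\mathrm{attacker}(x_j)\Rightarrow\mathrm{attacker}(f(x_1,\dots,x_n))$ and $\mathrm{attacker}(f(x_1,\dots,x_n))\Rightarrow\mathrm{attacker}(x_i)$ stay unchanged; remove duplicate hypotheses; optionally, according to any user setting, replace $H\wedge H'\Rightarrow C$ by $H'\Rightarrow C$ if $\sigma H\subseteq H'$ for some $\sigma$ that does not change the variables of $H'$ and $C$; delete the clause if a hypothesis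 is an instance of a fact of $\mathcal F_{\mathrm{not}}$; delete it if its conclusion is one of its hypotheses; remove hypotheses $\mathrm{attacker}(x)$ such that the variable $x$ does not occur elsewhere in the clause. Let $\mathrm{simplify}'$ be the same without decomposing the conclusion and without deleting tautologies. $\mathrm{saturate}(\mathcal R_0)$ starts with $\mathcal R=\emptyset$, performs $\mathcal R\leftarrow\mathrm{elim}(\mathrm{simplify}(R)\cup\mathcal R)$ for each $R\in\mathcal R_0$, then $\mathcal R\leftarrow\mathrm{elim}(\mathrm{simplify}(R\circ_{F_0}R')\cup\mathcal R)$ for $R,R'\in\mathcal R$ with $\mathrm{sel}(R)=\emptyset$, $F_0\in\mathrm{sel}(R')$ until a fixpoint is reached, and returns $\{R\in\mathcal R\mid\mathrm{sel}(R)=\emptyset\}$. Let $\mathrm{deriv}(R,\mathcal R,\mathcal R_1)$ be $\emptyset$ if a clause of $\mathcal R$ subsumes $R$; otherwise $\{R\}$ if $\mathrm{sel}(R)=\emptyset$; otherwise the union of $\mathrm{deriv}(R'',\{R\}\cup\mathcal R,\mathcal R_1)$ over $R''\in\mathrm{simplify}'(R'\circ_{F_0}R)$, $R'\in\mathcal R_1$,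 $F_0\in\mathrm{sel}(R)$; and $\mathrm{derivable}(F,\mathcal R_1)=\mathrm{deriv}(F\Rightarrow F,\emptyset,\mathcal R_1)$. Finally, $\mathrm{solve}_{P'_0,\mathrm{Init}}(F)$ computes $\mathcal R_1=\mathrm{saturate}(\mathcal R_{P_0',\mathrm{Init}})$, terminates with error if $\mathrm{derivable}(F',\mathcal R_1)\ne\emptyset$ for some $F'\in\mathcal F_{\mathrm{not}}$, and otherwise returns $\mathrm{derivable}(F,\mathcal R_1)$. **Corollary (Non-injective agreement).** Let $P_0$ be a closed process, $P_0'=\mathrm{instr}(P_0)$, and let $e,e'$ be constructors of arity $n$. Assume that $\mathrm{solve}_{P_0',\mathrm{Init}}(\mathrm{event}(e(x_1,\dots,x_n)))$ returns a set of clauses (without error) such that every clause in it of the form $H\Rightarrow\mathrm{event}(e(p_1,\dots,p_n))$ satisfies $\mathrm{m\text{-}event}(e'(p_1,\dots,p_n))\in H$. Then $P_0$ satisfies the correspondence $\mathrm{event}(e(x_1,\dots,x_n))\rightsquigarrow\mathrm{event}(e'(x_1,\dots,x_n))$ against $\mathrm{Init}$-adversaries. -/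

import Mathlib

universe u v

namespace HornCorr

/-! ### Terms, rewrite rules, signatures -/

/-- Terms over constructors `C` with arities `ar`: variables, names, constructor applications.
In rewrite rules and correspondences `var x` is the variable numbered `x`; inside a process it is
a de Bruijn index. -/
inductive Term (C : Type u) (ar : C → ℕ) : Type u
  | var (x : ℕ)
  | name (a : ℕ)
  | app (f : C) (args : Fin (ar f) → Term C ar)

namespace Term

variable {C : Type u} {ar : C → ℕ}

def subst (σ : ℕ → Term C ar) : Term C ar → Term C ar
  | var x => σ x
  | name a => name a
  | app f args => app f (fun i => (args i).subst σ)

def vars : Term C ar → Set ℕ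
  | var x => {x}
  | name _ => ∅
  | app _ args => ⋃ i, (args i).vars

def names : Term C ar → Set ℕ
  | var _ => ∅
  | name a => {a}
  | app _ args => ⋃ i, (args i).names

/-- All constructors of the term satisfy `p`. -/
def AllCon (p : C → Prop) : Term C ar → Prop
  | var _ => True
  | name _ => True
  | app f args => p f ∧ ∀ i, (args i).AllCon p

end Term

/-- The rewrite rule `g(lhs 0, …, lhs (n-1)) → rhs` of a destructor `g` of arity `n`. -/
structure RewriteRule (C : Type u) (ar : C → ℕ) (n : ℕ) where
  lhs : Fin n → Term C ar
  rhs : Term C ar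

/-- Constructors and destructors (each public or private), the finite set of rewrite rules of
every destructor, and the constructors that are treated as data constructors. -/
structure Signature where
  Con : Type u
  arity : Con → ℕ
  pubCon : Set Con
  Des : Type v
  desArity : Des → ℕ
  pubDes : Set Des
  rules : (g : Des) → Set (RewriteRule Con arity (desArity g))
  rules_finite : ∀ g, (rules g).Finite
  rules_nameless : ∀ g, ∀ r ∈ rules g, (∀ i, (r.lhs i).names = ∅) ∧ r.rhs.names = ∅
  rules_vars : ∀ g, ∀ r ∈ rules g, r.rhs.vars ⊆ ⋃ i, (r.lhs i).vars
  data : Set Con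
  data_public : data ⊆ pubCon
  /-- a data constructor comes with one public projection for each of its arguments -/
  data_proj : ∀ f ∈ data, ∀ i : Fin (arity f), ∃ g ∈ pubDes, desArity g = 1 ∧
    rules g = {⟨fun _ => Term.app f (fun j => Term.var j), Term.var i⟩}

abbrev Signature.Tm (S : Signature.{u, v}) : Type u := Term S.Con S.arity

/-- `g(M₁, …, Mₙ) → M'`. -/
def Signature.Reduces (S : Signature.{u, v}) (g : S.Des) (M : Fin (S.desArity g) → S.Tm)
    (M' : S.Tm) : Prop :=
  ∃ r ∈ S.rules g, ∃ σ : ℕ → S.Tm, (∀ i, M i = (r.lhs i).subst σ) ∧ M' = r.rhs.subst σ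

/-- The destructor may return several different results for the same arguments. -/
def Signature.Nondet (S : Signature.{u, v}) (g : S.Des) : Prop :=
  ∃ M M₁ M₂, S.Reduces g M M₁ ∧ S.Reduces g M M₂ ∧ M₁ ≠ M₂

/-! ### The calculus -/

/-- Processes up to renaming of bound names and bound variables. Input, restriction and the first
branch of a destructor application bind the de Bruijn index `0` of their continuation; a
restriction binds a name, which reduction replaces by a fresh free name. -/
inductive Proc (S : Signature.{u, v}) : Type (max u v)
  | out (M N : S.Tm) (P : Proc S)
  | inp (M : S.Tm) (P : Proc S)
  | nil
  | par (P Q : Proc S)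
  | repl (P : Proc S)
  | res (P : Proc S)
  | letd (g : S.Des) (M : Fin (S.desArity g) → S.Tm) (P Q : Proc S)
  | cond (M N : S.Tm) (P Q : Proc S)
  | event (M : S.Tm) (P : Proc S)

namespace Proc

variable {S : Signature.{u, v}}

/-- All indices that are not bound in the process are below `k`. -/
def ClosedAt : ℕ → Proc S → Prop
  | k, out M N P => (∀ x ∈ M.vars, x < k) ∧ (∀ x ∈ N.vars, x < k) ∧ P.ClosedAt k
  | k, inp M P => (∀ x ∈ M.vars, x < k) ∧ P.ClosedAt (k + 1)
  | _, nil => True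
  | k, par P Q => P.ClosedAt k ∧ Q.ClosedAt k
  | k, repl P => P.ClosedAt k
  | k, res P => P.ClosedAt (k + 1)
  | k, letd _ M P Q => (∀ i, ∀ x ∈ (M i).vars, x < k) ∧ P.ClosedAt (k + 1) ∧ Q.ClosedAt k
  | k, cond M N P Q =>
      (∀ x ∈ M.vars, x < k) ∧ (∀ x ∈ N.vars, x < k) ∧ P.ClosedAt k ∧ Q.ClosedAt k
  | k, event M P => (∀ x ∈ M.vars, x < k) ∧ P.ClosedAt k

def Closed (P : Proc S) : Prop := P.ClosedAt 0

/-- The free names. -/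
def fn : Proc S → Set ℕ
  | out M N P => M.names ∪ N.names ∪ P.fn
  | inp M P => M.names ∪ P.fn
  | nil => ∅
  | par P Q => P.fn ∪ Q.fn
  | repl P => P.fn
  | res P => P.fn
  | letd _ M P Q => (⋃ i, (M i).names) ∪ P.fn ∪ Q.fn
  | cond M N P Q => M.names ∪ N.names ∪ P.fn ∪ Q.fn
  | event M P => M.names ∪ P.fn

def EventFree : Proc S → Prop
  | out _ _ P => P.EventFree
  | inp _ P => P.EventFree
  | nil => True
  | par P Q => P.EventFree ∧ Q.EventFree
  | repl P => P.EventFree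
  | res P => P.EventFree
  | letd _ _ P Q => P.EventFree ∧ Q.EventFree
  | cond _ _ P Q => P.EventFree ∧ Q.EventFree
  | event _ _ => False

/-- No private constructor and no private destructor occurs. -/
def PublicOnly : Proc S → Prop
  | out M N P => M.AllCon (· ∈ S.pubCon) ∧ N.AllCon (· ∈ S.pubCon) ∧ P.PublicOnly
  | inp M P => M.AllCon (· ∈ S.pubCon) ∧ P.PublicOnly
  | nil => True
  | par P Q => P.PublicOnly ∧ Q.PublicOnly
  | repl P => P.PublicOnly
  | res P => P.PublicOnly
  | letd g M P Q =>
      g ∈ S.pubDes ∧ (∀ i, (M i).AllCon (· ∈ S.pubCon)) ∧ P.PublicOnly ∧ Q.PublicOnly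
  | cond M N P Q =>
      M.AllCon (· ∈ S.pubCon) ∧ N.AllCon (· ∈ S.pubCon) ∧ P.PublicOnly ∧ Q.PublicOnly
  | event M P => M.AllCon (· ∈ S.pubCon) ∧ P.PublicOnly

/-- Replace the index `k` by the closed term `N`. -/
def instTerm (N : S.Tm) (k : ℕ) (M : S.Tm) : S.Tm :=
  M.subst (fun j => if j = k then N else Term.var j)

def inst (N : S.Tm) : ℕ → Proc S → Proc S
  | k, out M M' P => out (instTerm N k M) (instTerm N k M') (P.inst N k)
  | k, inp M P => inp (instTerm N k M) (P.inst N (k + 1))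
  | _, nil => nil
  | k, par P Q => par (P.inst N k) (Q.inst N k)
  | k, repl P => repl (P.inst N k)
  | k, res P => res (P.inst N (k + 1))
  | k, letd g M P Q => letd g (fun i => instTerm N k (M i)) (P.inst N (k + 1)) (Q.inst N k)
  | k, cond M M' P Q => cond (instTerm N k M) (instTerm N k M') (P.inst N k) (Q.inst N k)
  | k, event M P => event (instTerm N k M) (P.inst N k)

end Proc

/-- What a reduction makes observable: a communication of `M` on channel `N`, an executed event,
or nothing. -/
inductive Action (S : Signature.{u, v}) : Type u
  | tau
  | comm (N M : S.Tm)
  | event (M : S.Tm)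

/-- Reduction of semantic configurations `E, 𝒳`. -/
inductive Step (S : Signature.{u, v}) :
    Finset ℕ → Multiset (Proc S) → Action S → Finset ℕ → Multiset (Proc S) → Prop
  | nil (E 𝒳) : Step S E (Proc.nil ::ₘ 𝒳) .tau E 𝒳
  | repl (E 𝒳 P) : Step S E (Proc.repl P ::ₘ 𝒳) .tau E (P ::ₘ Proc.repl P ::ₘ 𝒳)
  | par (E 𝒳 P Q) : Step S E (Proc.par P Q ::ₘ 𝒳) .tau E (P ::ₘ Q ::ₘ 𝒳)
  | res (E 𝒳 P) (a : ℕ) (ha : a ∉ E) :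
      Step S E (Proc.res P ::ₘ 𝒳) .tau (insert a E) (P.inst (Term.name a) 0 ::ₘ 𝒳)
  | io (E 𝒳 N M P Q) :
      Step S E (Proc.out N M Q ::ₘ Proc.inp N P ::ₘ 𝒳) (.comm N M) E (Q ::ₘ P.inst M 0 ::ₘ 𝒳)
  | destr₁ (E 𝒳 g M P Q M') (h : S.Reduces g M M') :
      Step S E (Proc.letd g M P Q ::ₘ 𝒳) .tau E (P.inst M' 0 ::ₘ 𝒳)
  | destr₂ (E 𝒳 g M P Q) (h : ¬ ∃ M', S.Reduces g M M') :
      Step S E (Proc.letd g M P Q ::ₘ 𝒳) .tau E (Q ::ₘ 𝒳)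
  | cond₁ (E 𝒳 M P Q) : Step S E (Proc.cond M M P Q ::ₘ 𝒳) .tau E (P ::ₘ 𝒳)
  | cond₂ (E 𝒳 M N P Q) (h : M ≠ N) : Step S E (Proc.cond M N P Q ::ₘ 𝒳) .tau E (Q ::ₘ 𝒳)
  | event (E 𝒳 M P) : Step S E (Proc.event M P ::ₘ 𝒳) (.event M) E (P ::ₘ 𝒳)

/-- Traces `E, 𝒳 →* E', 𝒳'`, with the list of their actions. -/
inductive Trace (S : Signature.{u, v}) :
    Finset ℕ → Multiset (Proc S) → List (Action S) → Finset ℕ → Multiset (Proc S) → Prop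
  | refl (E 𝒳) : Trace S E 𝒳 [] E 𝒳
  | step {E 𝒳 l E₁ 𝒳₁ tr E₂ 𝒳₂} : Step S E 𝒳 l E₁ 𝒳₁ → Trace S E₁ 𝒳₁ tr E₂ 𝒳₂ →
      Trace S E 𝒳 (l :: tr) E₂ 𝒳₂

/-! ### Correspondences -/

structure IsAdversary {S : Signature.{u, v}} (Init : Finset ℕ) (Q : Proc S) : Prop where
  closed : Q.Closed
  fn_subset : Q.fn ⊆ Init
  eventFree : Q.EventFree
  publicOnly : Q.PublicOnly

inductive Atom (S : Signature.{u, v}) : Type u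
  | attacker (M : S.Tm)
  | message (M M' : S.Tm)
  | event (M : S.Tm)

def Atom.names {S : Signature.{u, v}} : Atom S → Set ℕ
  | attacker M => M.names
  | message M M' => M.names ∪ M'.names
  | event M => M.names

def Atom.subst {S : Signature.{u, v}} (σ : ℕ → S.Tm) : Atom S → Atom S
  | attacker M => attacker (M.subst σ)
  | message M M' => message (M.subst σ) (M'.subst σ)
  | event M => event (M.subst σ)

/-- The trace with actions `tr` satisfies an atom. -/
def TraceSat {S : Signature.{u, v}} (Init : Finset ℕ) (tr : List (Action S)) : Atom S → Prop
  | .attacker M => ∃ c ∈ Init, Action.comm (Term.name c) M ∈ tr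
  | .message M M' => Action.comm M M' ∈ tr
  | .event M => Action.event M ∈ tr

/-- `P₀` satisfies the correspondence `α ⇒ ⋁ⱼ (αⱼ ⇝ ⋀ₖ event(Mⱼₖ))` against `Init`-adversaries;
the disjunct `j` is given as the pair of `αⱼ` and the list of the `Mⱼₖ`. -/
def SatisfiesCorr {S : Signature.{u, v}} (Init : Finset ℕ) (P₀ : Proc S) (α : Atom S)
    (disj : List (Atom S × List S.Tm)) : Prop :=
  ∀ Q : Proc S, IsAdversary Init Q →
  ∀ E₀ : Finset ℕ, P₀.fn ⊆ E₀ → Init ⊆ E₀ → α.names ⊆ E₀ →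
    (∀ d ∈ disj, d.1.names ⊆ E₀ ∧ ∀ M ∈ d.2, M.names ⊆ E₀) →
  ∀ (σ : ℕ → S.Tm) (tr : List (Action S)) (E' : Finset ℕ) (𝒳' : Multiset (Proc S)),
    Trace S E₀ {P₀, Q} tr E' 𝒳' → TraceSat Init tr (α.subst σ) →
    ∃ d ∈ disj, ∃ σ' : ℕ → S.Tm, d.1.subst σ' = α.subst σ ∧
      ∀ M ∈ d.2, TraceSat Init tr (Atom.event (M.subst σ'))

/-- `e(x₁, …, xₙ)` for pairwise distinct variables. -/
def Signature.conVars (S : Signature.{u, v}) (e : S.Con) : S.Tm :=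
  Term.app e (fun i => Term.var i)

/-- Non-injective agreement: `event(e(x₁, …, xₙ)) ⇝ event(e'(x₁, …, xₙ))`, which abbreviates
`event(e(x₁, …, xₙ)) ⇒ (event(e(x₁, …, xₙ)) ⇝ event(e'(x₁, …, xₙ)))`. -/
def NonInjAgreement {S : Signature.{u, v}} (Init : Finset ℕ) (P₀ : Proc S) (e e' : S.Con) : Prop :=
  SatisfiesCorr Init P₀ (Atom.event (S.conVars e))
    [(Atom.event (S.conVars e), [S.conVars e'])]

/-! ### Patterns, facts, clauses -/

/-- Name function symbols: one for each free name, one for each restriction of the protocol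
(identified by its position in the syntax tree), and the symbol `b₀` for all names that the
adversary creates. -/
inductive NameSym : Type
  | free (a : ℕ)
  | bound (pos : List ℕ)
  | adv

/-- Patterns. `sess l` is a constant session identifier. Session identifiers occur only as the last
arguments of name function symbols, so one kind of variables serves for patterns and for session
identifiers. -/
inductive Pat (C : Type u) (ar : C → ℕ) : Type u
  | var (x : ℕ)
  | sess (l : ℕ)
  | name (a : NameSym) (n : ℕ) (args : Fin n → Pat C ar)
  | app (f : C) (args : Fin (ar f) → Pat C ar)

abbrev Signature.Pt (S : Signature.{u, v}) : Type u := Pat S.Con S.arity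

namespace Pat

variable {C : Type u} {ar : C → ℕ}

def subst (σ : ℕ → Pat C ar) : Pat C ar → Pat C ar
  | var x => σ x
  | sess l => sess l
  | name a n args => name a n (fun i => (args i).subst σ)
  | app f args => app f (fun i => (args i).subst σ)

def vars : Pat C ar → Set ℕ
  | var x => {x}
  | sess _ => ∅
  | name _ _ args => ⋃ i, (args i).vars
  | app _ args => ⋃ i, (args i).vars

/-- All variables of the pattern are below its bound. -/
def bound : Pat C ar → ℕ
  | var x => x + 1
  | sess _ => 0
  | name _ _ args => Finset.univ.sup (fun i => (args i).bound)
  | app _ args => Finset.univ.sup (fun i => (args i).bound)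

/-- `a[p₁, …, pₙ]`. -/
def mkName (a : NameSym) (l : List (Pat C ar)) : Pat C ar := name a l.length l.get

end Pat

/-- The pattern of a term: `v` gives the patterns of the variables, a name `a` becomes `a[]`. -/
def Term.toPat {C : Type u} {ar : C → ℕ} (v : ℕ → Pat C ar) : Term C ar → Pat C ar
  | var x => v x
  | name a => Pat.mkName (NameSym.free a) []
  | app f args => Pat.app f (fun i => (args i).toPat v)

inductive Fact (S : Signature.{u, v}) : Type u
  | attacker (p : S.Pt)
  | message (p p' : S.Pt)
  | mevent (p : S.Pt)
  | event (p : S.Pt)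

namespace Fact

variable {S : Signature.{u, v}}

def subst (σ : ℕ → S.Pt) : Fact S → Fact S
  | attacker p => attacker (p.subst σ)
  | message p p' => message (p.subst σ) (p'.subst σ)
  | mevent p => mevent (p.subst σ)
  | event p => event (p.subst σ)

def vars : Fact S → Set ℕ
  | attacker p => p.vars
  | message p p' => p.vars ∪ p'.vars
  | mevent p => p.vars
  | event p => p.vars

def bound : Fact S → ℕ
  | attacker p => p.bound
  | message p p' => max p.bound p'.bound
  | mevent p => p.bound
  | event p => p.bound

/-- `attacker(x)` with `x` a variable, and `m-event(p)`, are the unselectable facts. -/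
def Unselectable (F : Fact S) : Prop :=
  (∃ x, F = attacker (Pat.var x)) ∨ ∃ p, F = mevent p

end Fact

/-- A clause `hyps ⇒ concl`. -/
@[ext]
structure Clause (S : Signature.{u, v}) where
  hyps : Multiset (Fact S)
  concl : Fact S

/-! ### Unification -/

/-- `σ` is a most general substitution with property `U`. -/
def MostGeneral {C : Type u} {ar : C → ℕ} (U : (ℕ → Pat C ar) → Prop) (σ : ℕ → Pat C ar) : Prop :=
  U σ ∧ ∀ τ, U τ → ∃ θ : ℕ → Pat C ar, ∀ x, τ x = (σ x).subst θ

/-- `(σ, σ')` is a most general pair of substitutions with property `U`. -/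
def MostGeneralPair {C : Type u} {ar : C → ℕ} (U : (ℕ → Pat C ar) → (ℕ → Pat C ar) → Prop)
    (s : (ℕ → Pat C ar) × (ℕ → Pat C ar)) : Prop :=
  U s.1 s.2 ∧ ∀ τ τ', U τ τ' →
    ∃ θ : ℕ → Pat C ar, (∀ x, τ x = (s.1 x).subst θ) ∧ ∀ x, τ' x = (s.2 x).subst θ

open Classical in
/-- The most general unifier of two patterns (unique up to renaming), if there is one. -/
noncomputable def mgu {C : Type u} {ar : C → ℕ} (p q : Pat C ar) : Option (ℕ → Pat C ar) :=
  if h : ∃ σ, MostGeneral (fun σ => p.subst σ = q.subst σ) σ then some h.choose else none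

open Classical in
/-- A most general pair of substitutions `(σ, σ')` (unique up to renaming) with
`σ pᵢ = σ' qᵢ` for all `i`, if there is one. -/
noncomputable def mguPair {C : Type u} {ar : C → ℕ} {n : ℕ} (p q : Fin n → Pat C ar) :
    Option ((ℕ → Pat C ar) × (ℕ → Pat C ar)) :=
  if h : ∃ s, MostGeneralPair (fun σ σ' => ∀ i, (p i).subst σ = (q i).subst σ') s
    then some h.choose else none

/-! ### Instrumentation -/

/-- A restriction label `a[M₁, …, Mₙ, i₁, …, iₖ]`. The session identifiers are de Bruijn indices
for the enclosing replications. -/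
structure RLabel (S : Signature.{u, v}) where
  sym : NameSym
  terms : List S.Tm
  sessions : List ℕ

/-- Instrumented processes: a replication also binds a session identifier (de Bruijn index `0`,
counted separately from the indices in terms), and restrictions are labeled. -/
inductive IProc (S : Signature.{u, v}) : Type (max u v)
  | out (M N : S.Tm) (P : IProc S)
  | inp (M : S.Tm) (P : IProc S)
  | nil
  | par (P Q : IProc S)
  | repl (P : IProc S)
  | res (l : RLabel S) (P : IProc S)
  | letd (g : S.Des) (M : Fin (S.desArity g) → S.Tm) (P Q : IProc S)
  | cond (M N : S.Tm) (P Q : IProc S)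
  | event (M : S.Tm) (P : IProc S)

open Classical in
/-- Instrumentation of the subprocess at position `pos` (listed from bottom to top). `t` lists,
from top to bottom, the indices of the variables bound by the inputs and by the non-deterministic
destructor applications above, and `k` is the number of replications above. -/
noncomputable def Proc.instrAt {S : Signature.{u, v}} :
    Proc S → List ℕ → List ℕ → ℕ → IProc S
  | .out M N P, pos, t, k => .out M N (P.instrAt (0 :: pos) t k)
  | .inp M P, pos, t, k => .inp M (P.instrAt (0 :: pos) (t.map Nat.succ ++ [0]) k)
  | .nil, _, _, _ => .nil
  | .par P Q, pos, t, k => .par (P.instrAt (0 :: pos) t k) (Q.instrAt (1 :: pos) t k)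
  | .repl P, pos, t, k => .repl (P.instrAt (0 :: pos) t (k + 1))
  | .res P, pos, t, k =>
      .res ⟨NameSym.bound pos, t.map Term.var, (List.range k).reverse⟩
        (P.instrAt (0 :: pos) (t.map Nat.succ) k)
  | .letd g M P Q, pos, t, k =>
      .letd g M
        (P.instrAt (0 :: pos) (if S.Nondet g then t.map Nat.succ ++ [0] else t.map Nat.succ) k)
        (Q.instrAt (1 :: pos) t k)
  | .cond M N P Q, pos, t, k => .cond M N (P.instrAt (0 :: pos) t k) (Q.instrAt (1 :: pos) t k)
  | .event M P, pos, t, k => .event M (P.instrAt (0 :: pos) t k)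

noncomputable def Proc.instr {S : Signature.{u, v}} (P₀ : Proc S) : IProc S :=
  P₀.instrAt [] [] 0

/-! ### Generation of the clauses -/

/-- A variable that does not occur in the environment or in the hypotheses. -/
def freshVar {S : Signature.{u, v}} (ρ ς : List S.Pt) (H : Multiset (Fact S)) : ℕ :=
  max (((ρ ++ ς).map Pat.bound).foldr max 0) (H.map Fact.bound).sup

/-- The pattern of a term in the environment `ρ`, the list of the patterns of the bound variables
and names, innermost first. (The default value is never used for closed processes.) -/
def envPat {S : Signature.{u, v}} (ρ : List S.Pt) (M : S.Tm) : S.Pt :=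
  M.toPat (fun k => ρ.getD k (Pat.sess 0))

/-- The clauses of a process, where `ρ` gives the patterns of bound variables and names, `ς` those
of session identifiers, and `H` the messages received and events executed so far. -/
noncomputable def IProc.clauses {S : Signature.{u, v}} :
    IProc S → List S.Pt → List S.Pt → Multiset (Fact S) → Set (Clause S)
  | .nil, _, _, _ => ∅
  | .par P Q, ρ, ς, H => P.clauses ρ ς H ∪ Q.clauses ρ ς H
  | .repl P, ρ, ς, H => P.clauses ρ (Pat.var (freshVar ρ ς H) :: ς) H
  | .res l P, ρ, ς, H =>
      P.clauses (Pat.mkName l.sym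
        (l.terms.map (envPat ρ) ++ l.sessions.map (fun i => ς.getD i (Pat.sess 0))) :: ρ) ς H
  | .inp M P, ρ, ς, H =>
      P.clauses (Pat.var (freshVar ρ ς H) :: ρ) ς
        (Fact.message (envPat ρ M) (Pat.var (freshVar ρ ς H)) ::ₘ H)
  | .out M N P, ρ, ς, H =>
      P.clauses ρ ς H ∪ {⟨H, Fact.message (envPat ρ M) (envPat ρ N)⟩}
  | .letd g M P Q, ρ, ς, H =>
      {R | ∃ r ∈ S.rules g, ∃ s ∈ mguPair (fun i => envPat ρ (M i))
            (fun i => (r.lhs i).toPat Pat.var),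
          R ∈ P.clauses ((r.rhs.toPat Pat.var).subst s.2 :: ρ.map (Pat.subst s.1))
            (ς.map (Pat.subst s.1)) (H.map (Fact.subst s.1))}
        ∪ Q.clauses ρ ς H
  | .cond M N P Q, ρ, ς, H =>
      {R | ∃ σ ∈ mgu (envPat ρ M) (envPat ρ N),
          R ∈ P.clauses (ρ.map (Pat.subst σ)) (ς.map (Pat.subst σ)) (H.map (Fact.subst σ))}
        ∪ Q.clauses ρ ς H
  | .event M P, ρ, ς, H =>
      P.clauses ρ ς (Fact.mevent (envPat ρ M) ::ₘ H) ∪ {⟨H, Fact.event (envPat ρ M)⟩}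

/-- `attacker(p₁) ∧ … ∧ attacker(pₙ)`. -/
def attackerAll {S : Signature.{u, v}} {n : ℕ} (p : Fin n → S.Pt) : Multiset (Fact S) :=
  Finset.univ.val.map (fun i => Fact.attacker (p i))

/-- The clauses for the attacker. -/
inductive AttackerClause {S : Signature.{u, v}} (Init : Finset ℕ) : Clause S → Prop
  | init (a : ℕ) (ha : a ∈ Init) :
      AttackerClause Init ⟨0, .attacker (Pat.mkName (NameSym.free a) [])⟩
  | rn : AttackerClause Init ⟨0, .attacker (Pat.mkName NameSym.adv [Pat.var 0])⟩
  | rf (f : S.Con) (hf : f ∈ S.pubCon) :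
      AttackerClause Init
        ⟨attackerAll (fun i : Fin (S.arity f) => Pat.var i),
          .attacker (Pat.app f (fun i => Pat.var i))⟩
  | rg (g : S.Des) (hg : g ∈ S.pubDes) (r) (hr : r ∈ S.rules g) :
      AttackerClause Init
        ⟨attackerAll (fun i => (r.lhs i).toPat Pat.var), .attacker (r.rhs.toPat Pat.var)⟩
  | rl : AttackerClause Init
      ⟨{.message (Pat.var 0) (Pat.var 1), .attacker (Pat.var 0)}, .attacker (Pat.var 1)⟩
  | rs : AttackerClause Init
      ⟨{.attacker (Pat.var 0), .attacker (Pat.var 1)}, .message (Pat.var 0) (Pat.var 1)⟩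

/-- The set of clauses for an instrumented protocol and initial attacker knowledge `Init`. -/
def protocolClauses {S : Signature.{u, v}} (P : IProc S) (Init : Finset ℕ) : Set (Clause S) :=
  P.clauses [] [] 0 ∪ {R | AttackerClause Init R}

/-! ### The solving algorithm -/

open Classical in
/-- The resolvent `R ∘_{F₀} R'`. Taking a most general pair of substitutions amounts to renaming
the two clauses apart and unifying. -/
noncomputable def resolve {S : Signature.{u, v}} (R : Clause S) (F₀ : Fact S) (R' : Clause S) :
    Option (Clause S) :=
  if h : F₀ ∈ R'.hyps ∧
      ∃ s, MostGeneralPair (fun σ σ' => R.concl.subst σ = F₀.subst σ') s then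
    some ⟨R.hyps.map (Fact.subst h.2.choose.1) +
        (R'.hyps.erase F₀).map (Fact.subst h.2.choose.2), R'.concl.subst h.2.choose.2⟩
  else none

/-- `R₁` subsumes `R₂`. -/
def Subsumes {S : Signature.{u, v}} (R₁ R₂ : Clause S) : Prop :=
  ∃ σ : ℕ → S.Pt, R₁.concl.subst σ = R₂.concl ∧ R₁.hyps.map (Fact.subst σ) ≤ R₂.hyps

/-- `ℛ'` results from `ℛ` by removing subsumed clauses. -/
structure IsElim {S : Signature.{u, v}} (ℛ ℛ' : Set (Clause S)) : Prop where
  subset : ℛ' ⊆ ℛ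
  covers : ∀ R ∈ ℛ, ∃ R' ∈ ℛ', Subsumes R' R
  irredundant : ∀ R ∈ ℛ', ∀ R' ∈ ℛ', Subsumes R' R → R' = R

/-- One replacement of `H ∧ H' ⇒ C` by `H' ⇒ C`, where some `σ` maps `H` into `H'` and does not
change the variables of `H'` and `C`. -/
def ElimRedundantStep {S : Signature.{u, v}} (R R' : Clause S) : Prop :=
  ∃ (H : Multiset (Fact S)) (σ : ℕ → S.Pt), R.hyps = H + R'.hyps ∧ R.concl = R'.concl ∧
    (∀ F ∈ H, F.subst σ ∈ R'.hyps) ∧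
    ∀ x, (x ∈ R'.concl.vars ∨ ∃ F ∈ R'.hyps, x ∈ F.vars) → σ x = Pat.var x

structure IsSelection {S : Signature.{u, v}} (sel : Clause S → Set (Fact S)) : Prop where
  subset : ∀ R, ∀ F ∈ sel R, F ∈ R.hyps
  selectable : ∀ R, ∀ F ∈ sel R, ¬ F.Unselectable
  attacker_var : ∀ (R : Clause S) (x : ℕ), R.concl = Fact.attacker (Pat.var x) →
    (∃ F ∈ R.hyps, ¬ F.Unselectable) → (sel R).Nonempty

/-- The parameters of the solving algorithm: the selection function, the set of facts that the
user claims to be underivable, and how far redundant hypotheses are eliminated (from not at all to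
as much as possible). -/
structure SolverParams (S : Signature.{u, v}) where
  sel : Clause S → Set (Fact S)
  isSelection : IsSelection sel
  notFacts : Set (Fact S)
  elimRedundantHyp : Clause S → Clause S
  elimRedundantHyp_spec : ∀ R, Relation.ReflTransGen ElimRedundantStep R (elimRedundantHyp R)

section Simplification

variable {S : Signature.{u, v}}

open Classical in
/-- Recursive decomposition of the data constructors at the root of a pattern. -/
noncomputable def dataParts : S.Pt → Multiset S.Pt
  | .var x => {.var x}
  | .sess l => {.sess l}
  | .name a n args => {.name a n args}
  | .app f args => if f ∈ S.data then ∑ i, dataParts (args i) else {.app f args}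

noncomputable def decompFact : Fact S → Multiset (Fact S)
  | .attacker p => (dataParts p).map Fact.attacker
  | F => {F}

/-- The clauses `attacker(x₁) ∧ … ∧ attacker(xₙ) ⇒ attacker(f(x₁, …, xₙ))` and
`attacker(f(x₁, …, xₙ)) ⇒ attacker(xᵢ)` for a data constructor `f`, up to renaming. -/
def IsDataClause (R : Clause S) : Prop :=
  ∃ f ∈ S.data, ∃ x : Fin (S.arity f) → ℕ, Function.Injective x ∧
    (R = ⟨attackerAll (fun i => Pat.var (x i)), .attacker (Pat.app f (fun i => Pat.var (x i)))⟩ ∨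
      ∃ i, R = ⟨{.attacker (Pat.app f (fun j => Pat.var (x j)))}, .attacker (Pat.var (x i))⟩)

open Classical in
noncomputable def decompHyp (R : Clause S) : Clause S :=
  if IsDataClause R then R else ⟨R.hyps.bind decompFact, R.concl⟩

open Classical in
noncomputable def decomp (R : Clause S) : Set (Clause S) :=
  if IsDataClause R then {R}
  else {R' | R'.hyps = R.hyps.bind decompFact ∧ R'.concl ∈ decompFact R.concl}

open Classical in
noncomputable def elimDup (R : Clause S) : Clause S := ⟨R.hyps.dedup, R.concl⟩

def elimNot (notFacts : Set (Fact S)) (R : Clause S) : Set (Clause S) :=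
  {R' | R' = R ∧ ¬ ∃ F ∈ R.hyps, ∃ F' ∈ notFacts, ∃ σ, F'.subst σ = F}

def elimTaut (R : Clause S) : Set (Clause S) := {R' | R' = R ∧ R.concl ∉ R.hyps}

open Classical in
/-- Remove the hypotheses `attacker(x)` such that `x` does not occur elsewhere in the clause. -/
noncomputable def elimAttX (R : Clause S) : Clause S :=
  ⟨R.hyps.filter (fun F => ¬ ∃ x, F = Fact.attacker (Pat.var x) ∧ x ∉ R.concl.vars ∧
      ∀ F' ∈ R.hyps.erase F, x ∉ F'.vars), R.concl⟩

namespace SolverParams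

variable (π : SolverParams S)

noncomputable def simplify (R : Clause S) : Set (Clause S) :=
  {R' | ∃ R₁ ∈ decomp R, ∃ R₂ ∈ elimNot π.notFacts (π.elimRedundantHyp (elimDup R₁)),
    ∃ R₃ ∈ elimTaut R₂, R' = elimAttX R₃}

noncomputable def simplify' (R : Clause S) : Set (Clause S) :=
  {R' | ∃ R₂ ∈ elimNot π.notFacts (π.elimRedundantHyp (elimDup (decompHyp R))), R' = elimAttX R₂}

/-- Inserting the clauses of a list into a set of clauses one after the other. -/
inductive InsertAll : List (Clause S) → Set (Clause S) → Set (Clause S) → Prop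
  | nil (ℛ) : InsertAll [] ℛ ℛ
  | cons {R L ℛ ℛ₁ ℛ₂} : IsElim (π.simplify R ∪ ℛ) ℛ₁ → InsertAll L ℛ₁ ℛ₂ →
      InsertAll (R :: L) ℛ ℛ₂

/-- `T` is the simplification of the composition of two clauses of `ℛ` upon a selected
hypothesis. -/
def Inferred (ℛ T : Set (Clause S)) : Prop :=
  ∃ R ∈ ℛ, π.sel R = ∅ ∧ ∃ R' ∈ ℛ, ∃ F₀ ∈ π.sel R', ∃ R'' ∈ resolve R F₀ R', T = π.simplify R''

/-- The saturation of `ℛ₀` may return `ℛ₁`: all clauses of `ℛ₀` are inserted, in some order, then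
resolution steps are performed until none of them changes the set of clauses, and the clauses
without selected hypothesis are returned. -/
def Saturates (ℛ₀ ℛ₁ : Set (Clause S)) : Prop :=
  ∃ (L : List (Clause S)) (ℛ ℛ' : Set (Clause S)),
    (∀ R, R ∈ L ↔ R ∈ ℛ₀) ∧
    InsertAll π L ∅ ℛ ∧
    Relation.ReflTransGen (fun 𝒜 ℬ => ∃ T, π.Inferred 𝒜 T ∧ IsElim (T ∪ 𝒜) ℬ) ℛ ℛ' ∧
    (∀ T, π.Inferred ℛ' T → IsElim (T ∪ ℛ') ℛ') ∧
    ℛ₁ = {R ∈ ℛ' | π.sel R = ∅}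

/-- `InDeriv π ℛ₁ R ℛ D` means that `D` belongs to `deriv(R, ℛ, ℛ₁)`: this set is empty when
`ℛ` contains a clause that subsumes `R`; otherwise it is `{R}` if `R` has no selected hypothesis,
and else the union of the sets `deriv(R₂, {R} ∪ ℛ, ℛ₁)` over the simplified resolvents `R₂` of
clauses of `ℛ₁` with `R`. -/
inductive InDeriv (ℛ₁ : Set (Clause S)) : Clause S → Set (Clause S) → Clause S → Prop
  | found {R ℛ} : (∀ R' ∈ ℛ, ¬ Subsumes R' R) → π.sel R = ∅ → InDeriv ℛ₁ R ℛ R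
  | step {R ℛ R' F₀ R₁ R₂ D} : (∀ R' ∈ ℛ, ¬ Subsumes R' R) → R' ∈ ℛ₁ → F₀ ∈ π.sel R →
      R₁ ∈ resolve R' F₀ R → R₂ ∈ π.simplify' R₁ → InDeriv ℛ₁ R₂ (insert R ℛ) D →
      InDeriv ℛ₁ R ℛ D

def derivable (F : Fact S) (ℛ₁ : Set (Clause S)) : Set (Clause S) :=
  {D | InDeriv π ℛ₁ ⟨{F}, F⟩ ∅ D}

/-- The solving algorithm may return `T` (without error) on the query `F`. -/
def SolveReturns (P : IProc S) (Init : Finset ℕ) (F : Fact S) (T : Set (Clause S)) : Prop :=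
  ∃ ℛ₁, π.Saturates (protocolClauses P Init) ℛ₁ ∧
    (∀ F' ∈ π.notFacts, π.derivable F' ℛ₁ = ∅) ∧
    T = π.derivable F ℛ₁

end SolverParams

end Simplification

end HornCorr

/-! The proof has two halves. They meet in one predicate on facts: derivability from the clauses
that saturation returns, together with the facts `m-event(p)` for the patterns `p` of the events
executed by the given trace.

Soundness of the clauses (`ConfigInv.trace`). Along a trace every name receives a pattern: `a[]` for
a name that is there initially, an instance of `b₀[x]` for a name made by the adversary, and an
instance of the restriction label for a name made by the protocol. A running protocol process is a
piece of the original code with an environment of closed terms and a substitution `θ` that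
instantiates the symbolic environment and hypotheses used in generating the clauses of that code. In
every model of the clauses that contains the `m-event` facts of the executed events, each reduction
preserves two properties: the instantiated hypotheses hold, and the adversary knows its environment.
Hence `event` holds for everything executed. Patterns determine names because protocol processes own
disjoint sets of keys (a position and a list of session identifiers), and creating a name spends one
key. The patterns are fixed before the model is chosen, so the model may depend on them.

Completeness of the solver (`solve_complete`). Derivations carry a cost. Resolving upon a selected
hypothesis with the last clause of a derivation of its instance replaces a fact of cost at least `1
+ K` by hypotheses of total cost `K`. Induction on the cost then shows that the derivable facts form
a model of the initial clauses (`isModel_der`), and that backward search reaches a clause whose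
hypotheses have derivable instances (`exists_derivable`).

Simplification must not raise the cost. The delicate case is splitting `attacker(f(p₁,…,pₙ))` for a
data constructor `f`: a clause concluding `attacker(x)` yields the whole term in one step, while its
components need `n` steps. For this reason a step costs `1 +` (cost of the hypotheses), multiplied
by the size of the conclusion, and the sizes of the `pᵢ` sum to less than the size of `f(p₁,…,pₙ)`
(`projection`). Deleting clauses because of `notFacts` is legitimate only if no instance of those
facts is derivable, which is itself shown by running the search; strong induction on the cost breaks
this circle (`notFree_of_derivable_eq_empty`).

For the theorem, an executed `event(e(…))` is derivable, so it is an instance of the conclusion of a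
returned clause. That clause contains the matching `m-event(e'(…))`. No clause concludes an
`m-event`, so its instance is the pattern of an executed event, and injectivity of patterns turns
this into equality of terms. -/

namespace HornCorr

/-! ### Substitutions -/

namespace Pat

variable {C : Type u} {ar : C → ℕ}

theorem subst_subst (σ τ : ℕ → Pat C ar) (p : Pat C ar) :
    (p.subst σ).subst τ = p.subst (fun x => (σ x).subst τ) := by
  induction p with
  | var x => rfl
  | sess l => rfl
  | name a n args ih => simp only [subst, ih]
  | app f args ih => simp only [subst, ih]

@[simp] theorem subst_var (p : Pat C ar) : p.subst Pat.var = p := by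
  induction p with
  | var x => rfl
  | sess l => rfl
  | name a n args ih => simp only [subst, ih]
  | app f args ih => simp only [subst, ih]

theorem subst_congr {σ τ : ℕ → Pat C ar} {p : Pat C ar} (h : ∀ x ∈ p.vars, σ x = τ x) :
    p.subst σ = p.subst τ := by
  induction p with
  | var x => exact h x rfl
  | sess l => rfl
  | name a n args ih =>
    simp only [subst]; congr 1; funext i
    exact ih i fun x hx => h x (Set.mem_iUnion.2 ⟨i, hx⟩)
  | app f args ih =>
    simp only [subst]; congr 1; funext i
    exact ih i fun x hx => h x (Set.mem_iUnion.2 ⟨i, hx⟩)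

theorem lt_bound {p : Pat C ar} {x : ℕ} (hx : x ∈ p.vars) : x < p.bound := by
  induction p with
  | var _ => cases hx; exact Nat.lt_succ_self _
  | sess l => cases hx
  | name a n args ih =>
    obtain ⟨i, hi⟩ := Set.mem_iUnion.1 hx
    exact (ih i hi).trans_le (Finset.le_sup (f := fun i => (args i).bound) (Finset.mem_univ i))
  | app f args ih =>
    obtain ⟨i, hi⟩ := Set.mem_iUnion.1 hx
    exact (ih i hi).trans_le (Finset.le_sup (f := fun i => (args i).bound) (Finset.mem_univ i))

/-- This is how a fresh clause variable gets its value: assigning it leaves every older pattern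
unchanged. -/
theorem subst_update {σ : ℕ → Pat C ar} {p q : Pat C ar} {x : ℕ} (h : p.bound ≤ x) :
    p.subst (Function.update σ x q) = p.subst σ :=
  subst_congr fun _ hy => Function.update_of_ne (((lt_bound hy).trans_le h).ne) _ _

/-- The number of symbols of a pattern. -/
def size : Pat C ar → ℕ
  | var _ => 1
  | sess _ => 1
  | name _ _ args => 1 + ∑ i, (args i).size
  | app _ args => 1 + ∑ i, (args i).size

theorem one_le_size (p : Pat C ar) : 1 ≤ p.size := by
  cases p <;> simp [size]

theorem size_le_size_subst {σ : ℕ → Pat C ar} {p : Pat C ar} {x : ℕ} (hx : x ∈ p.vars) :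
    (σ x).size ≤ (p.subst σ).size := by
  induction p with
  | var _ => cases hx; exact le_rfl
  | sess l => cases hx
  | name a n args ih =>
    obtain ⟨i, hi⟩ := Set.mem_iUnion.1 hx
    have := Finset.single_le_sum (f := fun i => ((args i).subst σ).size)
      (fun _ _ => Nat.zero_le _) (Finset.mem_univ i)
    have := ih i hi
    simp only [subst, size]; omega
  | app f args ih =>
    obtain ⟨i, hi⟩ := Set.mem_iUnion.1 hx
    have := Finset.single_le_sum (f := fun i => ((args i).subst σ).size)
      (fun _ _ => Nat.zero_le _) (Finset.mem_univ i)
    have := ih i hi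
    simp only [subst, size]; omega

/-- The occurs check. -/
theorem eq_var_of_subst_eq {σ : ℕ → Pat C ar} {p : Pat C ar} {x : ℕ} (hx : x ∈ p.vars)
    (h : σ x = p.subst σ) : p = var x := by
  cases p with
  | var _ => cases hx; rfl
  | sess l => cases hx
  | name a n args =>
    obtain ⟨i, hi⟩ := Set.mem_iUnion.1 hx
    have h1 := Finset.single_le_sum (f := fun i => ((args i).subst σ).size)
      (fun _ _ => Nat.zero_le _) (Finset.mem_univ i)
    have h2 := size_le_size_subst (σ := σ) hi
    have h3 := congrArg size h
    simp only [subst, size] at h3; omega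
  | app f args =>
    obtain ⟨i, hi⟩ := Set.mem_iUnion.1 hx
    have h1 := Finset.single_le_sum (f := fun i => ((args i).subst σ).size)
      (fun _ _ => Nat.zero_le _) (Finset.mem_univ i)
    have h2 := size_le_size_subst (σ := σ) hi
    have h3 := congrArg size h
    simp only [subst, size] at h3; omega

theorem eq_var_of_subst_eq_var {σ : ℕ → Pat C ar} {p : Pat C ar} {x : ℕ}
    (h : p.subst σ = var x) : ∃ y, p = var y := by
  cases p <;> simp [subst] at h ⊢

/-- The two sides index their arguments by `Fin` of the lengths of two different lists, so the
arguments are compared by heterogeneous equality. -/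
theorem mkName_subst (σ : ℕ → Pat C ar) (a : NameSym) (l : List (Pat C ar)) :
    (mkName a l).subst σ = mkName a (l.map (subst σ)) := by
  have key : ∀ (n : ℕ) (args : Fin n → Pat C ar) (l' : List (Pat C ar)),
      l' = List.ofFn args → mkName a l' = name a n args := by
    rintro n args l' rfl
    unfold mkName
    congr 1
    · simp
    · refine Function.hfunext (by simp) ?_
      intro i j hij
      rw [List.get_ofFn]
      have : Fin.cast (by simp) i = j := by
        apply Fin.ext
        have hn : (List.ofFn args).length = n := by simp
        have := (Fin.heq_ext_iff hn).1 hij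
        simpa using this
      rw [this]
  symm
  apply key
  apply List.ext_get <;> simp

/-- The arguments of a name pattern. -/
def nameArgs : Pat C ar → List (Pat C ar)
  | name _ _ args => List.ofFn args
  | _ => []

theorem mkName_injective {a b : NameSym} {l m : List (Pat C ar)} (h : mkName a l = mkName b m) :
    a = b ∧ l = m := by
  constructor
  · unfold mkName at h; injection h
  · have := congrArg nameArgs h
    simpa [mkName, nameArgs] using this

end Pat

namespace Fact

variable {S : Signature.{u, v}}

theorem subst_subst (σ τ : ℕ → S.Pt) (F : Fact S) :
    (F.subst σ).subst τ = F.subst (fun x => (σ x).subst τ) := by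
  cases F <;> simp [subst, Pat.subst_subst]

@[simp] theorem subst_var (F : Fact S) : F.subst Pat.var = F := by
  cases F <;> simp [subst]

theorem subst_update {σ : ℕ → S.Pt} {F : Fact S} {q : S.Pt} {x : ℕ} (h : F.bound ≤ x) :
    F.subst (Function.update σ x q) = F.subst σ := by
  cases F with
  | attacker p => simp only [subst]; rw [Pat.subst_update h]
  | message p p' =>
    simp only [subst]
    rw [Pat.subst_update ((le_max_left _ _).trans h), Pat.subst_update ((le_max_right _ _).trans h)]
  | mevent p => simp only [subst]; rw [Pat.subst_update h]
  | event p => simp only [subst]; rw [Pat.subst_update h]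

end Fact

/-! ### Unification -/

section Unification

variable {C : Type u} {ar : C → ℕ}

/-- `σ` solves all equations of the list. -/
def Unifies (E : List (Pat C ar × Pat C ar)) (σ : ℕ → Pat C ar) : Prop :=
  ∀ e ∈ E, e.1.subst σ = e.2.subst σ

theorem MostGeneral.congr {U V : (ℕ → Pat C ar) → Prop} (h : ∀ σ, U σ ↔ V σ) {σ : ℕ → Pat C ar}
    (hσ : MostGeneral U σ) : MostGeneral V σ :=
  ⟨(h σ).1 hσ.1, fun τ hτ => hσ.2 τ ((h τ).2 hτ)⟩

/-- The total size of the left-hand sides, instantiated by `τ`. -/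
def eqsSize (τ : ℕ → Pat C ar) (E : List (Pat C ar × Pat C ar)) : ℕ :=
  (E.map fun e => (e.1.subst τ).size).sum

/-- Variable elimination. Either the occurs check makes the equation trivial, or `r` replaces `x` in
the remaining equations. As `τ` already equates `x` and `r`, the sizes of the `τ`-instances do not
change, and the induction hypothesis still applies. -/
theorem exists_mostGeneral_var {n : ℕ}
    (ih : ∀ (E : List (Pat C ar × Pat C ar)) (τ : ℕ → Pat C ar), Unifies E τ → eqsSize τ E < n →
      ∃ σ, MostGeneral (Unifies E) σ)
    (x : ℕ) (r : Pat C ar) (E : List (Pat C ar × Pat C ar)) (τ : ℕ → Pat C ar)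
    (hx : τ x = r.subst τ) (hE : Unifies E τ) (hn : eqsSize τ E < n) :
    ∃ σ, MostGeneral (Unifies ((Pat.var x, r) :: E)) σ := by
  by_cases hxr : x ∈ r.vars
  · obtain rfl := Pat.eq_var_of_subst_eq hxr hx
    obtain ⟨σ, hσ⟩ := ih E τ hE hn
    exact ⟨σ, hσ.congr fun σ => by simp [Unifies]⟩
  -- Every solution `τ'` of the equation absorbs `δ`; this gives both the solvability of the reduced
  -- system and the generality of `σ` after `δ`.
  · set δ : ℕ → Pat C ar := Function.update Pat.var x r with hδ
    have key : ∀ τ' : ℕ → Pat C ar, τ' x = r.subst τ' → ∀ p : Pat C ar,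
        (p.subst δ).subst τ' = p.subst τ' := by
      intro τ' h p
      rw [Pat.subst_subst]
      congr 1
      funext y
      by_cases hy : y = x
      · subst hy; simp [hδ, h]
      · simp [hδ, Function.update_of_ne hy, Pat.subst]
    have unif : ∀ τ' : ℕ → Pat C ar, τ' x = r.subst τ' → Unifies E τ' →
        Unifies (E.map fun e => (e.1.subst δ, e.2.subst δ)) τ' := by
      intro τ' h hE' e he
      obtain ⟨e₁, he₁, rfl⟩ := List.mem_map.1 he
      simp only [key τ' h]
      exact hE' e₁ he₁
    obtain ⟨σ, hσ, hg⟩ := ih _ τ (unif τ hx hE) (by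
      rw [eqsSize, List.map_map]
      refine lt_of_eq_of_lt ?_ hn
      unfold eqsSize
      congr 1
      refine List.map_congr_left fun e _ => ?_
      simp [key τ hx])
    have hr : r.subst δ = r := by
      conv_rhs => rw [← Pat.subst_var r]
      refine Pat.subst_congr fun y hy => ?_
      have : y ≠ x := fun h => hxr (h ▸ hy)
      simp [hδ, Function.update_of_ne this]
    refine ⟨fun y => (δ y).subst σ, ?_, ?_⟩
    · intro e he
      rw [← Pat.subst_subst, ← Pat.subst_subst]
      rcases List.mem_cons.1 he with rfl | he
      · simp only [hr]; simp [hδ, Pat.subst]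
      · exact hσ _ (List.mem_map.2 ⟨e, he, rfl⟩)
    · intro τ' hτ'
      have h1 : τ' x = r.subst τ' := hτ' (Pat.var x, r) (by simp)
      have h2 : Unifies E τ' := fun e he => hτ' e (by simp [he])
      obtain ⟨θ, hθ⟩ := hg τ' (unif τ' h1 h2)
      refine ⟨θ, fun y => ?_⟩
      rw [Pat.subst_subst, ← funext hθ]
      exact (key τ' h1 (Pat.var y)).symm

/-- Decomposition of an equation between patterns with the same root. The measure drops by the root
symbol of the left-hand side, which is the `1` in `hp`. -/
theorem exists_mostGeneral_args {n m : ℕ} {p q : Pat C ar}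
    (ih : ∀ (E : List (Pat C ar × Pat C ar)) (τ : ℕ → Pat C ar), Unifies E τ → eqsSize τ E < n →
      ∃ σ, MostGeneral (Unifies E) σ)
    (args args' : Fin m → Pat C ar)
    (hpq : ∀ σ : ℕ → Pat C ar, p.subst σ = q.subst σ ↔
      ∀ i, (args i).subst σ = (args' i).subst σ)
    (hp : ∀ σ : ℕ → Pat C ar, (p.subst σ).size = 1 + ∑ i, ((args i).subst σ).size)
    (E : List (Pat C ar × Pat C ar)) (τ : ℕ → Pat C ar)
    (hE : Unifies ((p, q) :: E) τ) (hn : eqsSize τ ((p, q) :: E) ≤ n) :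
    ∃ σ, MostGeneral (Unifies ((p, q) :: E)) σ := by
  have equiv : ∀ σ, Unifies (List.ofFn (fun i => (args i, args' i)) ++ E) σ ↔
      Unifies ((p, q) :: E) σ := by
    intro σ
    constructor
    · intro h e he
      rcases List.mem_cons.1 he with rfl | he
      · exact (hpq σ).2 fun i => h (args i, args' i)
          (List.mem_append_left _ (List.mem_ofFn.2 ⟨i, rfl⟩))
      · exact h e (List.mem_append_right _ he)
    · intro h e he
      rcases List.mem_append.1 he with he | he
      · obtain ⟨i, rfl⟩ := List.mem_ofFn.1 he
        exact (hpq σ).1 (h (p, q) (by simp)) i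
      · exact h e (List.mem_cons_of_mem _ he)
  obtain ⟨σ, hσ⟩ := ih _ τ ((equiv τ).2 hE) (by
    refine lt_of_lt_of_le ?_ hn
    simp only [eqsSize, List.map_cons, List.sum_cons, hp, List.map_append, List.sum_append,
      List.map_ofFn, List.sum_ofFn, Function.comp_apply]
    omega)
  exact ⟨σ, hσ.congr equiv⟩

/-- A solvable system of equations has a most general unifier. -/
theorem exists_mostGeneral (n : ℕ) : ∀ (E : List (Pat C ar × Pat C ar)) (τ : ℕ → Pat C ar),
    Unifies E τ → eqsSize τ E < n → ∃ σ, MostGeneral (Unifies E) σ := by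
  induction n with
  | zero => intro E τ _ h; omega
  | succ n ih =>
    intro E τ hE hn
    match E, hE, hn with
    | [], _, _ => exact ⟨Pat.var, by simp [Unifies], fun τ _ => ⟨τ, fun x => rfl⟩⟩
    | (l, r) :: E, hE, hn =>
      have hlr : l.subst τ = r.subst τ := hE (l, r) (by simp)
      have hE' : Unifies E τ := fun e he => hE e (by simp [he])
      -- Every left-hand side has size at least one, so dropping the head equation lowers the
      -- measure, whichever way it is oriented.
      have hlt : eqsSize τ E < n := by
        have := Pat.one_le_size (l.subst τ)
        simp only [eqsSize, List.map_cons, List.sum_cons] at hn ⊢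
        omega
      have swap : ∀ σ, Unifies ((r, l) :: E) σ ↔ Unifies ((l, r) :: E) σ := fun σ => by
        simp [Unifies, eq_comm]
      have hn' := Nat.lt_succ_iff.1 hn
      match l, r, hlr with
      | .var x, r, hlr => exact exists_mostGeneral_var ih x r E τ hlr hE' hlt
      | l, .var x, hlr =>
        obtain ⟨σ, hσ⟩ := exists_mostGeneral_var ih x l E τ hlr.symm hE' hlt
        exact ⟨σ, hσ.congr swap⟩
      | .sess a, .sess b, hlr =>
        obtain ⟨σ, hσ⟩ := ih E τ hE' hlt
        refine ⟨σ, hσ.congr fun σ => ?_⟩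
        have : a = b := by simpa [Pat.subst] using hlr
        simp [Unifies, this]
      | .name a k args, .name b m args', hlr =>
        simp only [Pat.subst, Pat.name.injEq] at hlr
        obtain ⟨rfl, rfl, -⟩ := hlr
        exact exists_mostGeneral_args ih args args' (fun σ => by simp [Pat.subst, funext_iff])
          (fun σ => by simp [Pat.subst, Pat.size]) E τ hE hn'
      | .app f args, .app g args', hlr =>
        simp only [Pat.subst, Pat.app.injEq] at hlr
        obtain ⟨rfl, -⟩ := hlr
        exact exists_mostGeneral_args ih args args' (fun σ => by simp [Pat.subst, funext_iff])
          (fun σ => by simp [Pat.subst, Pat.size]) E τ hE hn'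
      | .sess _, .name _ _ _, hlr => simp [Pat.subst] at hlr
      | .sess _, .app _ _, hlr => simp [Pat.subst] at hlr
      | .name _ _ _, .sess _, hlr => simp [Pat.subst] at hlr
      | .name _ _ _, .app _ _, hlr => simp [Pat.subst] at hlr
      | .app _ _, .sess _, hlr => simp [Pat.subst] at hlr
      | .app _ _, .name _ _ _, hlr => simp [Pat.subst] at hlr

/-- A solvable system of equations between patterns with separate variables has a most general
pair of unifiers. -/
theorem exists_mostGeneralPair (E : List (Pat C ar × Pat C ar)) {τ τ' : ℕ → Pat C ar}
    (h : ∀ e ∈ E, e.1.subst τ = e.2.subst τ') :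
    ∃ s, MostGeneralPair (fun σ σ' => ∀ e ∈ E, e.1.subst σ = e.2.subst σ') s := by
  -- The two sides are renamed apart by sending their variables to the even and to the odd numbers;
  -- a pair of substitutions is then a single one.
  let left : ℕ → Pat C ar := fun x => Pat.var (2 * x)
  let right : ℕ → Pat C ar := fun x => Pat.var (2 * x + 1)
  let glue : (ℕ → Pat C ar) → (ℕ → Pat C ar) → ℕ → Pat C ar := fun τ τ' x =>
    if x % 2 = 0 then τ (x / 2) else τ' (x / 2)
  have hl : ∀ (τ τ' : ℕ → Pat C ar) x, glue τ τ' (2 * x) = τ x := fun τ τ' x => by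
    simp [glue]
  have hr : ∀ (τ τ' : ℕ → Pat C ar) x, glue τ τ' (2 * x + 1) = τ' x := fun τ τ' x => by
    have h1 : (2 * x + 1) % 2 = 1 := by omega
    have h2 : (2 * x + 1) / 2 = x := by omega
    simp [glue, h1, h2]
  have unif : ∀ τ τ' : ℕ → Pat C ar, (∀ e ∈ E, e.1.subst τ = e.2.subst τ') →
      Unifies (E.map fun e => (e.1.subst left, e.2.subst right)) (glue τ τ') := by
    intro τ τ' h e he
    obtain ⟨e₁, he₁, rfl⟩ := List.mem_map.1 he
    simp only [Pat.subst_subst, left, right, Pat.subst, hl, hr]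
    exact h e₁ he₁
  obtain ⟨σ, hσ, hg⟩ := exists_mostGeneral _ _ _ (unif τ τ' h) (Nat.lt_succ_self _)
  refine ⟨(fun x => σ (2 * x), fun x => σ (2 * x + 1)), ?_, ?_⟩
  · intro e he
    have := hσ _ (List.mem_map.2 ⟨e, he, rfl⟩)
    simpa only [Pat.subst_subst, left, right, Pat.subst] using this
  · intro τ₁ τ₂ h'
    obtain ⟨θ, hθ⟩ := hg _ (unif τ₁ τ₂ h')
    exact ⟨θ, fun x => by rw [← hθ, hl], fun x => by rw [← hθ, hr]⟩

theorem MostGeneralPair.congr {U V : (ℕ → Pat C ar) → (ℕ → Pat C ar) → Prop}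
    (h : ∀ σ σ', U σ σ' ↔ V σ σ') {s} (hs : MostGeneralPair U s) : MostGeneralPair V s :=
  ⟨(h _ _).1 hs.1, fun τ τ' hτ => hs.2 τ τ' ((h _ _).2 hτ)⟩

/-- An actual unifier excludes the `none` branch of `mgu` and factors through the chosen most
general one. -/
theorem mgu_complete {p q : Pat C ar} {τ : ℕ → Pat C ar} (h : p.subst τ = q.subst τ) :
    ∃ σ ∈ mgu p q, ∃ θ : ℕ → Pat C ar, τ = fun x => (σ x).subst θ := by
  have ex : ∃ σ, MostGeneral (fun σ => p.subst σ = q.subst σ) σ := by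
    obtain ⟨σ, hσ⟩ := exists_mostGeneral _ [(p, q)] τ (by simpa [Unifies] using h)
      (Nat.lt_succ_self _)
    exact ⟨σ, hσ.congr fun σ => by simp [Unifies]⟩
  refine ⟨ex.choose, by simp [mgu, dif_pos ex], ?_⟩
  obtain ⟨θ, hθ⟩ := ex.choose_spec.2 τ h
  exact ⟨θ, funext hθ⟩

theorem mguPair_complete {n : ℕ} {p q : Fin n → Pat C ar} {τ τ' : ℕ → Pat C ar}
    (h : ∀ i, (p i).subst τ = (q i).subst τ') :
    ∃ s ∈ mguPair p q, ∃ θ : ℕ → Pat C ar,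
      (τ = fun x => (s.1 x).subst θ) ∧ τ' = fun x => (s.2 x).subst θ := by
  have ex : ∃ s, MostGeneralPair (fun σ σ' => ∀ i, (p i).subst σ = (q i).subst σ') s := by
    obtain ⟨s, hs⟩ := exists_mostGeneralPair (List.ofFn fun i => (p i, q i)) (τ := τ) (τ' := τ')
      (by intro e he; obtain ⟨i, rfl⟩ := List.mem_ofFn.1 he; exact h i)
    exact ⟨s, hs.congr fun σ σ' => by simp [List.mem_ofFn]⟩
  refine ⟨ex.choose, by simp [mguPair, dif_pos ex], ?_⟩
  obtain ⟨θ, hθ, hθ'⟩ := ex.choose_spec.2 τ τ' h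
  exact ⟨θ, funext hθ, funext hθ'⟩

end Unification

/-! ### Resolution of two clauses -/

section Resolution

variable {S : Signature.{u, v}}

theorem exists_mostGeneralPair_fact {F G : Fact S} {τ τ' : ℕ → S.Pt}
    (h : F.subst τ = G.subst τ') :
    ∃ s, MostGeneralPair (fun σ σ' : ℕ → S.Pt => F.subst σ = G.subst σ') s := by
  have mk : ∀ E : List (S.Pt × S.Pt),
      (∀ σ σ', (∀ e ∈ E, e.1.subst σ = e.2.subst σ') ↔ F.subst σ = G.subst σ') →
      ∃ s, MostGeneralPair (fun σ σ' : ℕ → S.Pt => F.subst σ = G.subst σ') s := by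
    intro E hE
    obtain ⟨s, hs⟩ := exists_mostGeneralPair E ((hE τ τ').2 h)
    exact ⟨s, hs.congr hE⟩
  cases F <;> cases G <;> simp only [Fact.subst, reduceCtorEq] at h
  case attacker.attacker p q => exact mk [(p, q)] (by simp [Fact.subst])
  case message.message p p' q q' => exact mk [(p, q), (p', q')] (by simp [Fact.subst])
  case mevent.mevent p q => exact mk [(p, q)] (by simp [Fact.subst])
  case event.event p q => exact mk [(p, q)] (by simp [Fact.subst])

open Classical in
/-- Every common instance of a conclusion and a hypothesis comes from the resolvent. -/
theorem resolve_complete {R R' : Clause S} {F₀ : Fact S} (hF₀ : F₀ ∈ R'.hyps)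
    {τ τ' : ℕ → S.Pt} (h : R.concl.subst τ = F₀.subst τ') :
    ∃ s : (ℕ → S.Pt) × (ℕ → S.Pt),
      MostGeneralPair (fun σ σ' => R.concl.subst σ = F₀.subst σ') s ∧
      (⟨R.hyps.map (Fact.subst s.1) + (R'.hyps.erase F₀).map (Fact.subst s.2),
        R'.concl.subst s.2⟩ : Clause S) ∈ resolve R F₀ R' := by
  have hh : F₀ ∈ R'.hyps ∧ ∃ s, MostGeneralPair (fun σ σ' => R.concl.subst σ = F₀.subst σ') s :=
    ⟨hF₀, exists_mostGeneralPair_fact h⟩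
  exact ⟨hh.2.choose, hh.2.choose_spec, by rw [resolve, dif_pos hh]; rfl⟩

theorem resolve_concl {R R' R'' : Clause S} {F₀ : Fact S} (h : R'' ∈ resolve R F₀ R') :
    ∃ σ : ℕ → S.Pt, R''.concl = R'.concl.subst σ := by
  unfold resolve at h
  split at h
  · cases h; exact ⟨_, rfl⟩
  · cases h

end Resolution

/-! ### Weighted derivations -/

section Derivations

variable {S : Signature.{u, v}}

/-- The size of the pattern of an attacker fact; other facts have size one. -/
def Fact.size : Fact S → ℕ
  | .attacker p => p.size
  | _ => 1

theorem Fact.one_le_size (F : Fact S) : 1 ≤ F.size := by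
  cases F <;> simp [Fact.size, Pat.one_le_size]

/-- Derivability from the clauses `𝒦` and the facts `m-event(p)` for `p ∈ B`. A step costs the size
of its conclusion times one more than the costs of its hypotheses, and the numerical argument
bounds the cost. -/
inductive WDer (𝒦 : Set (Clause S)) (B : Set S.Pt) : ℕ → Fact S → Prop
  | base (n : ℕ) (p : S.Pt) (hp : p ∈ B) : WDer 𝒦 B n (.mevent p)
  | step (n : ℕ) (F : Fact S) (R : Clause S) (hR : R ∈ 𝒦) (σ : ℕ → S.Pt) (w : Fact S → ℕ)
      (hF : R.concl.subst σ = F) (h : ∀ F' ∈ R.hyps, WDer 𝒦 B (w F') (F'.subst σ))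
      (hn : (1 + (R.hyps.map w).sum) * F.size ≤ n) : WDer 𝒦 B n F

variable {𝒦 : Set (Clause S)} {B : Set S.Pt}

theorem WDer.mono {n m : ℕ} {F : Fact S} (h : WDer 𝒦 B n F) (hnm : n ≤ m) : WDer 𝒦 B m F := by
  cases h with
  | base _ p hp => exact .base _ _ hp
  | step _ _ R hR σ w hF h hn => exact .step _ _ R hR σ w hF h (hn.trans hnm)

variable (𝒦 B) in
/-- The least cost of a derivation. -/
noncomputable def derCost (F : Fact S) : ℕ := sInf {n | WDer 𝒦 B n F}

theorem WDer.derCost_le {n : ℕ} {F : Fact S} (h : WDer 𝒦 B n F) : derCost 𝒦 B F ≤ n :=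
  Nat.sInf_le h

theorem WDer.at_derCost {n : ℕ} {F : Fact S} (h : WDer 𝒦 B n F) : WDer 𝒦 B (derCost 𝒦 B F) F :=
  Nat.sInf_mem (s := {n | WDer 𝒦 B n F}) ⟨n, h⟩

variable (𝒦 B) in
/-- All facts of the multiset are derivable, with total cost at most `n`. -/
def MDer (G : Multiset (Fact S)) (n : ℕ) : Prop :=
  (∀ F ∈ G, ∃ m, WDer 𝒦 B m F) ∧ (G.map (derCost 𝒦 B)).sum ≤ n

namespace MDer

variable {G G' : Multiset (Fact S)} {n m : ℕ}

theorem mono (h : MDer 𝒦 B G n) (hG : G' ≤ G) (hn : n ≤ m) : MDer 𝒦 B G' m := by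
  refine ⟨fun F hF => h.1 F (Multiset.mem_of_le hG hF), le_trans ?_ (h.2.trans hn)⟩
  obtain ⟨X, rfl⟩ := Multiset.le_iff_exists_add.1 hG
  simp

theorem zero : MDer 𝒦 B 0 n := ⟨by simp, by simp⟩

theorem add (h : MDer 𝒦 B G n) (h' : MDer 𝒦 B G' m) : MDer 𝒦 B (G + G') (n + m) := by
  refine ⟨fun F hF => ?_, ?_⟩
  · rcases Multiset.mem_add.1 hF with hF | hF
    exacts [h.1 F hF, h'.1 F hF]
  · simpa using add_le_add h.2 h'.2

theorem sum {ι : Type*} (s : Finset ι) {G : ι → Multiset (Fact S)} {n : ι → ℕ}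
    (h : ∀ i ∈ s, MDer 𝒦 B (G i) (n i)) : MDer 𝒦 B (∑ i ∈ s, G i) (∑ i ∈ s, n i) := by
  classical
  induction s using Finset.induction_on with
  | empty => exact zero
  | insert a s ha ih =>
    rw [Finset.sum_insert ha, Finset.sum_insert ha]
    exact (h a (by simp)).add (ih fun i hi => h i (by simp [hi]))

theorem singleton {F : Fact S} (h : WDer 𝒦 B n F) : MDer 𝒦 B {F} n :=
  ⟨fun F' hF' => ⟨n, by rwa [Multiset.mem_singleton.1 hF']⟩, by simpa using h.derCost_le⟩

theorem cost_le (h : MDer 𝒦 B G n) {F : Fact S} (hF : F ∈ G) : WDer 𝒦 B n F := by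
  obtain ⟨m, hm⟩ := h.1 F hF
  refine hm.at_derCost.mono (le_trans ?_ h.2)
  exact Multiset.le_sum_of_mem (Multiset.mem_map_of_mem _ hF)

theorem of_forall (h : ∀ F ∈ G, ∃ m, WDer 𝒦 B m F) : MDer 𝒦 B G ((G.map (derCost 𝒦 B)).sum) :=
  ⟨h, le_rfl⟩

theorem cons {F : Fact S} (h : MDer 𝒦 B (F ::ₘ G) n) :
    ∃ k l, WDer 𝒦 B k F ∧ MDer 𝒦 B G l ∧ k = derCost 𝒦 B F ∧ k + l ≤ n := by
  obtain ⟨m, hm⟩ := h.1 F (by simp)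
  refine ⟨_, _, hm.at_derCost, ⟨fun F' hF' => h.1 F' (by simp [hF']), le_rfl⟩, rfl, ?_⟩
  simpa using h.2

end MDer

/-- Each hypothesis is charged its least cost, which is how `MDer` counts. -/
theorem WDer.of_clause {n N : ℕ} {R : Clause S} (hR : R ∈ 𝒦) {σ : ℕ → S.Pt}
    (h : MDer 𝒦 B (R.hyps.map (Fact.subst σ)) N) (hn : (1 + N) * (R.concl.subst σ).size ≤ n) :
    WDer 𝒦 B n (R.concl.subst σ) := by
  refine .step n _ R hR σ (fun F => derCost 𝒦 B (F.subst σ)) rfl (fun F hF => ?_) ?_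
  · obtain ⟨m, hm⟩ := h.1 _ (Multiset.mem_map_of_mem _ hF)
    exact hm.at_derCost
  · refine le_trans (Nat.mul_le_mul_right _ (Nat.add_le_add_left ?_ 1)) hn
    simpa [Multiset.map_map, Function.comp_def] using h.2

theorem WDer.last_step {n : ℕ} {F : Fact S} (h : WDer 𝒦 B n F) :
    (∃ p ∈ B, F = .mevent p) ∨ ∃ R ∈ 𝒦, ∃ σ : ℕ → S.Pt, ∃ N, R.concl.subst σ = F ∧
      MDer 𝒦 B (R.hyps.map (Fact.subst σ)) N ∧ (1 + N) * F.size ≤ n := by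
  cases h with
  | base _ p hp => exact .inl ⟨p, hp, rfl⟩
  | step _ _ R hR σ w hF h hn =>
    refine .inr ⟨R, hR, σ, (R.hyps.map w).sum, hF, ⟨?_, ?_⟩, hn⟩
    · intro F' hF'
      obtain ⟨F₁, hF₁, rfl⟩ := Multiset.mem_map.1 hF'
      exact ⟨_, h F₁ hF₁⟩
    · rw [Multiset.map_map]
      exact Multiset.sum_map_le_sum_map _ _ fun F' hF' => (h F' hF').derCost_le

/-- Resolution upon a hypothesis decreases the cost of the hypotheses. -/
theorem exists_resolvent {R R' : Clause S} {F₀ : Fact S} (hF₀ : F₀ ∈ R'.hyps) {σ σ' : ℕ → S.Pt}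
    {K M : ℕ} (h : R.concl.subst σ = F₀.subst σ') (hK : MDer 𝒦 B (R.hyps.map (Fact.subst σ)) K)
    (hKF : 1 + K ≤ derCost 𝒦 B (F₀.subst σ'))
    (hM : MDer 𝒦 B (R'.hyps.map (Fact.subst σ')) M) :
    ∃ R'' ∈ resolve R F₀ R', ∃ θ : ℕ → S.Pt, ∃ M' < M,
      MDer 𝒦 B (R''.hyps.map (Fact.subst θ)) M' ∧ R''.concl.subst θ = R'.concl.subst σ' := by
  classical
  obtain ⟨s, hs, hmem⟩ := resolve_complete hF₀ h
  obtain ⟨θ, hθ, hθ'⟩ := hs.2 σ σ' h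
  have e1 : σ = fun x => (s.1 x).subst θ := funext hθ
  -- The selected hypothesis contributes its least cost `k ≥ 1 + K` to `M`, and the rest contributes
  -- `l`. The resolvent has `K + l` instead.
  have e2 : σ' = fun x => (s.2 x).subst θ := funext hθ'
  have hM' : MDer 𝒦 B (F₀.subst σ' ::ₘ (R'.hyps.erase F₀).map (Fact.subst σ')) M := by
    rw [← Multiset.map_cons, Multiset.cons_erase hF₀]; exact hM
  obtain ⟨k, l, -, hl, hk, hkl⟩ := hM'.cons
  refine ⟨_, hmem, θ, K + l, by omega, ?_, ?_⟩
  · have := hK.add hl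
    rw [e1, e2] at this
    convert this using 1
    simp only [Multiset.map_add, Multiset.map_map, Function.comp_def, Fact.subst_subst]
  · rw [e2, Fact.subst_subst]

end Derivations

/-! ### Simplification -/

section Simplification

variable {S : Signature.{u, v}}

theorem Subsumes.trans {R₁ R₂ R₃ : Clause S} (h : Subsumes R₁ R₂) (h' : Subsumes R₂ R₃) :
    Subsumes R₁ R₃ := by
  obtain ⟨σ, h1, h2⟩ := h
  obtain ⟨τ, h3, h4⟩ := h'
  refine ⟨fun x => (σ x).subst τ, by rw [← Fact.subst_subst, h1, h3], le_trans ?_ h4⟩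
  have := Multiset.map_le_map (f := Fact.subst τ) h2
  simpa only [Multiset.map_map, Function.comp_def, Fact.subst_subst] using this

/-- All that completeness needs from the user setting: hypotheses are only dropped. -/
theorem elimRedundantHyp_le (π : SolverParams S) (R : Clause S) :
    (π.elimRedundantHyp R).hyps ≤ R.hyps ∧ (π.elimRedundantHyp R).concl = R.concl := by
  have h := π.elimRedundantHyp_spec R
  generalize π.elimRedundantHyp R = R' at h ⊢
  induction h with
  | refl => exact ⟨le_rfl, rfl⟩
  | tail _ h ih =>
    obtain ⟨H, σ, h1, h2, -⟩ := h
    exact ⟨le_trans (by rw [h1]; exact Multiset.le_add_left _ _) ih.1, h2 ▸ ih.2⟩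

theorem elimAttX_le (R : Clause S) : (elimAttX R).hyps ≤ R.hyps := by
  classical
  exact Multiset.filter_le _ _

theorem elimDup_le (R : Clause S) : (elimDup R).hyps ≤ R.hyps := by
  classical
  exact Multiset.dedup_le _

/-- After decomposition a clause can be lost only through `notFacts` or as a tautology. The other
phases merely remove hypotheses, so derivable hypotheses stay derivable at no higher cost. -/
theorem exists_mem_simplify (π : SolverParams S) {R R₁ : Clause S} (h₁ : R₁ ∈ decomp R)
    (hnot : ¬ ∃ F ∈ R₁.hyps, ∃ F' ∈ π.notFacts, ∃ σ, F'.subst σ = F) (htaut : R₁.concl ∉ R₁.hyps) :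
    ∃ R' ∈ π.simplify R, R'.hyps ≤ R₁.hyps ∧ R'.concl = R₁.concl := by
  have hle := (elimRedundantHyp_le π (elimDup R₁)).1.trans (elimDup_le R₁)
  have hc := (elimRedundantHyp_le π (elimDup R₁)).2
  refine ⟨elimAttX (π.elimRedundantHyp (elimDup R₁)), ⟨R₁, h₁, _, ⟨rfl, ?_⟩, _, ⟨rfl, ?_⟩, rfl⟩,
    (elimAttX_le _).trans hle, hc⟩
  · rintro ⟨F, hF, h⟩
    exact hnot ⟨F, Multiset.mem_of_le hle hF, h⟩
  · rw [hc]
    exact fun h => htaut (Multiset.mem_of_le hle h)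

theorem exists_mem_simplify' (π : SolverParams S) {R : Clause S}
    (hnot : ¬ ∃ F ∈ (decompHyp R).hyps, ∃ F' ∈ π.notFacts, ∃ σ, F'.subst σ = F) :
    ∃ R' ∈ π.simplify' R, R'.hyps ≤ (decompHyp R).hyps ∧ R'.concl = R.concl := by
  have hle := (elimRedundantHyp_le π (elimDup (decompHyp R))).1.trans (elimDup_le _)
  have hc := (elimRedundantHyp_le π (elimDup (decompHyp R))).2
  have hd : (decompHyp R).concl = R.concl := by unfold decompHyp; split <;> rfl
  refine ⟨elimAttX (π.elimRedundantHyp (elimDup (decompHyp R))), ⟨_, ⟨rfl, ?_⟩, rfl⟩,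
    (elimAttX_le _).trans hle, hc.trans hd⟩
  rintro ⟨F, hF, h⟩
  exact hnot ⟨F, Multiset.mem_of_le hle hF, h⟩

theorem simplify'_concl (π : SolverParams S) {R R' : Clause S} (h : R' ∈ π.simplify' R) :
    R'.concl = R.concl := by
  obtain ⟨_, ⟨rfl, -⟩, rfl⟩ := h
  have hd : (decompHyp R).concl = R.concl := by unfold decompHyp; split <;> rfl
  exact ((elimRedundantHyp_le π _).2.trans hd)

theorem simplify_concl_not_mem (π : SolverParams S) {R R' : Clause S} (h : R' ∈ π.simplify R) :
    R'.concl ∉ R'.hyps := by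
  obtain ⟨R₁, -, R₂, -, _, ⟨rfl, h⟩, rfl⟩ := h
  exact fun h' => h (Multiset.mem_of_le (elimAttX_le _) h')

theorem decompFact_mevent {F : Fact S} {p : S.Pt} (h : Fact.mevent p ∈ decompFact F) :
    F = .mevent p := by
  cases F with
  | attacker q => simp [decompFact] at h
  | message q q' => simp [decompFact] at h
  | mevent q => simpa [decompFact, eq_comm] using h
  | event q => simp [decompFact] at h

theorem simplify_concl_ne_mevent (π : SolverParams S) {R R' : Clause S} (h : R' ∈ π.simplify R)
    (hR : ∀ p, R.concl ≠ .mevent p) (p : S.Pt) : R'.concl ≠ .mevent p := by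
  obtain ⟨R₁, h₁, R₂, ⟨rfl, -⟩, _, ⟨rfl, -⟩, rfl⟩ := h
  intro hp
  have hp' : R₁.concl = .mevent p := (elimRedundantHyp_le π (elimDup R₁)).2.symm.trans hp
  unfold decomp at h₁
  split at h₁
  · cases h₁; exact hR p hp'
  · exact hR p (decompFact_mevent (hp' ▸ h₁.2))

/-- Were `y` absent from the conclusion, the surviving `attacker(y)` would need another hypothesis
mentioning `y`. Duplicates are gone, so that hypothesis is not of the form `attacker(x)`, and it
would have survived as well. -/
theorem simplify_hyps_singleton_var (π : SolverParams S) {R R' : Clause S}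
    (h : R' ∈ π.simplify R) {y : ℕ} (hy : R'.hyps = {.attacker (.var y)}) :
    y ∈ R'.concl.vars := by
  classical
  obtain ⟨R₁, -, R₂, ⟨rfl, -⟩, _, ⟨rfl, -⟩, rfl⟩ := h
  set R₂ := π.elimRedundantHyp (elimDup R₁) with hR₂
  have hnd : R₂.hyps.Nodup := Multiset.nodup_of_le (elimRedundantHyp_le π _).1
    (Multiset.nodup_dedup _)
  have hmem : Fact.attacker (.var y) ∈ (elimAttX R₂).hyps := by rw [hy]; simp
  have hcond := (Multiset.mem_filter.1 hmem).2
  by_contra hyc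
  apply hcond
  refine ⟨y, rfl, hyc, fun F' hF' hyF' => ?_⟩
  have hF'₂ : F' ≠ .attacker (.var y) ∧ F' ∈ R₂.hyps := by
    refine (Multiset.Nodup.mem_erase_iff hnd).1 ?_
    convert hF'
  have : F' ∈ (elimAttX R₂).hyps := by
    refine Multiset.mem_filter.2 ⟨hF'₂.2, ?_⟩
    rintro ⟨x, rfl, -⟩
    have : y = x := hyF'
    exact hF'₂.1 (this ▸ rfl)
  rw [hy] at this
  exact hF'₂.1 (Multiset.mem_singleton.1 this)

theorem dataParts_ne_app {q : S.Pt} {r : S.Pt} (hr : r ∈ dataParts q) {f : S.Con} (hf : f ∈ S.data)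
    (args : Fin (S.arity f) → S.Pt) : r ≠ .app f args := by
  induction q with
  | var x => simp only [dataParts, Multiset.mem_singleton] at hr; simp [hr]
  | sess l => simp only [dataParts, Multiset.mem_singleton] at hr; simp [hr]
  | name a n as ih => simp only [dataParts, Multiset.mem_singleton] at hr; simp [hr]
  | app g as ih =>
    unfold dataParts at hr
    split at hr
    · obtain ⟨i, -, hi⟩ := Multiset.mem_sum.1 hr
      exact ih i hi
    · rename_i hg
      rw [Multiset.mem_singleton.1 hr]
      intro h
      injection h with h1
      exact hg (h1 ▸ hf)

theorem attackerAll_nodup {n : ℕ} {x : Fin n → ℕ} (hx : Function.Injective x) :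
    (attackerAll fun i => (Pat.var (x i) : S.Pt)).Nodup :=
  (Multiset.nodup_map_iff_of_injective (fun i j h => by simpa using hx.eq_iff.1 (by simpa using h))).2
    Finset.univ.nodup

theorem mem_attackerAll {n : ℕ} {p : Fin n → S.Pt} {F : Fact S} :
    F ∈ attackerAll p ↔ ∃ i, Fact.attacker (p i) = F := by
  simp [attackerAll]

theorem map_attackerAll {n : ℕ} (p : Fin n → S.Pt) (σ : ℕ → S.Pt) :
    (attackerAll p).map (Fact.subst σ) = attackerAll fun i => (p i).subst σ := by
  simp [attackerAll, Function.comp_def, Fact.subst]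

/-- The matching substitution fixes every variable of the conclusion, so a removable hypothesis
would have to be a duplicate. This protects the clauses of data constructors from the user setting.
-/
theorem elimRedundantHyp_eq (π : SolverParams S) {R : Clause S} (hnd : R.hyps.Nodup)
    (hv : ∀ F ∈ R.hyps, ∀ x ∈ F.vars, x ∈ R.concl.vars)
    (hs : ∀ F ∈ R.hyps, ∃ x, F = .attacker (.var x)) : π.elimRedundantHyp R = R := by
  have h := π.elimRedundantHyp_spec R
  generalize π.elimRedundantHyp R = R' at h ⊢
  induction h with
  | refl => rfl
  | tail _ h ih =>
    rw [ih] at h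
    obtain ⟨H, σ, h1, h2, h3, h4⟩ := h
    have : H = 0 := by
      rw [Multiset.eq_zero_iff_forall_notMem]
      intro F hF
      have hF' : F ∈ R.hyps := by rw [h1]; exact Multiset.mem_add.2 (.inl hF)
      obtain ⟨x, rfl⟩ := hs F hF'
      have hx := h4 x (.inl (h2 ▸ hv _ hF' x rfl))
      have := h3 _ hF
      simp only [Fact.subst, Pat.subst, hx] at this
      rw [h1, Multiset.nodup_add] at hnd
      exact Multiset.disjoint_left.1 hnd.2.2 hF this
    subst this
    rw [zero_add] at h1
    exact Clause.ext h1.symm h2.symm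

/-- Decomposition leaves no data constructor at the root of an `attacker` conclusion, except in the
clause for the constructor itself, which passes through the other phases with its hypotheses intact.
-/
theorem simplify_concl_data (π : SolverParams S) {R R' : Clause S} (h : R' ∈ π.simplify R)
    {f : S.Con} (hf : f ∈ S.data) {q : Fin (S.arity f) → S.Pt}
    (hc : R'.concl = .attacker (.app f q)) : R'.hyps = attackerAll q := by
  classical
  obtain ⟨R₁, h₁, R₂, ⟨rfl, -⟩, _, ⟨rfl, -⟩, rfl⟩ := h
  have hc' : R₁.concl = .attacker (.app f q) := (elimRedundantHyp_le π (elimDup R₁)).2.symm.trans hc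
  unfold decomp at h₁
  split at h₁
  · rename_i hd
    cases h₁
    obtain ⟨g, hg, x, hx, rfl | ⟨i, rfl⟩⟩ := hd
    · simp only [Fact.attacker.injEq, Pat.app.injEq] at hc'
      obtain ⟨rfl, hq⟩ := hc'
      obtain rfl := eq_of_heq hq
      have e1 : elimDup (S := S) ⟨attackerAll fun i => .var (x i),
          .attacker (.app g fun i => .var (x i))⟩ = ⟨attackerAll fun i => .var (x i),
          .attacker (.app g fun i => .var (x i))⟩ := by
        unfold elimDup
        congr 1
        exact Multiset.dedup_eq_self.2 (attackerAll_nodup hx)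
      have hv : ∀ i, x i ∈ (Fact.attacker (.app g fun i => .var (x i)) : Fact S).vars :=
        fun i => Set.mem_iUnion.2 ⟨i, rfl⟩
      rw [e1, elimRedundantHyp_eq π (attackerAll_nodup hx)]
      · dsimp only [elimAttX]
        rw [Multiset.filter_eq_self]
        intro F hF
        obtain ⟨i, rfl⟩ := mem_attackerAll.1 hF
        rintro ⟨y, hy, hy', -⟩
        simp only [Fact.attacker.injEq, Pat.var.injEq] at hy
        exact hy' (hy ▸ hv i)
      · intro F hF y hy
        obtain ⟨i, rfl⟩ := mem_attackerAll.1 hF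
        cases hy
        exact hv i
      · intro F hF
        obtain ⟨i, rfl⟩ := mem_attackerAll.1 hF
        exact ⟨_, rfl⟩
    · simp at hc'
  · have := h₁.2
    rw [hc'] at this
    unfold decompFact at this
    split at this
    · obtain ⟨r, hr, hr'⟩ := Multiset.mem_map.1 this
      rw [Fact.attacker.injEq] at hr'
      exact absurd hr' (dataParts_ne_app hr hf q)
    · rename_i hne
      exact absurd (Multiset.mem_singleton.1 this).symm (hne _)

theorem Fact.Unselectable.of_subst {F : Fact S} {σ : ℕ → S.Pt} (h : (F.subst σ).Unselectable) :
    F.Unselectable := by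
  rcases h with ⟨x, h⟩ | ⟨p, h⟩
  · cases F with
    | attacker q =>
      simp only [Fact.subst, Fact.attacker.injEq] at h
      obtain ⟨y, rfl⟩ := Pat.eq_var_of_subst_eq_var h
      exact .inl ⟨y, rfl⟩
    | _ => simp [Fact.subst] at h
  · cases F with
    | mevent q => exact .inr ⟨q, rfl⟩
    | _ => simp [Fact.subst] at h

theorem Fact.Unselectable.decompFact_eq {F : Fact S} (h : F.Unselectable) : decompFact F = {F} := by
  rcases h with ⟨x, rfl⟩ | ⟨p, rfl⟩ <;> simp [decompFact, dataParts]

theorem sel_eq_empty (π : SolverParams S) {R : Clause S} (h : ∀ F ∈ R.hyps, F.Unselectable) :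
    π.sel R = ∅ :=
  Set.eq_empty_of_forall_notMem fun F hF =>
    π.isSelection.selectable R F hF (h F (π.isSelection.subset R F hF))

end Simplification

/-! ### Correctness of the solving algorithm -/

section Solver

variable {S : Signature.{u, v}}

theorem decomp_of_isDataClause {R : Clause S} (h : IsDataClause R) : decomp R = {R} := by
  unfold decomp; rw [if_pos h]

theorem decompHyp_mem_decomp {R R₁ : Clause S} (h : R₁ ∈ decomp R) :
    R₁.hyps = (decompHyp R).hyps := by
  unfold decomp at h
  unfold decompHyp
  split at h <;> rename_i hd
  · cases h; rw [if_pos hd]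
  · rw [if_neg hd]; exact h.1

/-- What the saturated set of clauses `ℛ` has to do with the set `ℛ₀` it was computed from. -/
structure IsSaturated (π : SolverParams S) (ℛ₀ ℛ : Set (Clause S)) : Prop where
  simplified : ∀ R ∈ ℛ, ∃ R₀, R ∈ π.simplify R₀
  covers : ∀ R₀ ∈ ℛ₀, ∀ R ∈ π.simplify R₀, ∃ R' ∈ ℛ, Subsumes R' R
  closed : ∀ R ∈ ℛ, π.sel R = ∅ → ∀ R' ∈ ℛ, ∀ F₀ ∈ π.sel R', ∀ R₁ ∈ resolve R F₀ R',
    ∀ R₂ ∈ π.simplify R₁, ∃ R₃ ∈ ℛ, Subsumes R₃ R₂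
  concl_ne_mevent : ∀ R ∈ ℛ, ∀ p, R.concl ≠ .mevent p

/-- The part of the invariant of saturation that holds before the fixpoint is reached. -/
structure IsPartlySaturated (π : SolverParams S) (ℛ₀ ℛ : Set (Clause S)) : Prop where
  simplified : ∀ R ∈ ℛ, ∃ R₀, R ∈ π.simplify R₀
  covers : ∀ R₀ ∈ ℛ₀, ∀ R ∈ π.simplify R₀, ∃ R' ∈ ℛ, Subsumes R' R
  concl_ne_mevent : ∀ R ∈ ℛ, ∀ p, R.concl ≠ .mevent p

/-- Transitivity of subsumption lets earlier clauses remain covered when their representatives are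
eliminated. The lemma serves both the insertion of initial clauses and the resolution steps. -/
theorem IsPartlySaturated.elim {π : SolverParams S} {ℛ₀ ℛ ℛ' : Set (Clause S)} {R : Clause S}
    (h : IsPartlySaturated π ℛ₀ ℛ) (hR : ∀ p, R.concl ≠ .mevent p)
    (he : IsElim (π.simplify R ∪ ℛ) ℛ') : IsPartlySaturated π (insert R ℛ₀) ℛ' where
  simplified R' hR' := (he.subset hR').elim (fun h' => ⟨R, h'⟩) (h.simplified R')
  covers R₀ hR₀ R₁ hR₁ := by
    rcases hR₀ with rfl | hR₀
    · exact he.covers _ (.inl hR₁)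
    · obtain ⟨R₂, hR₂, hs⟩ := h.covers R₀ hR₀ R₁ hR₁
      obtain ⟨R₃, hR₃, hs'⟩ := he.covers _ (.inr hR₂)
      exact ⟨R₃, hR₃, hs'.trans hs⟩
  concl_ne_mevent R' hR' := (he.subset hR').elim
    (fun h' => simplify_concl_ne_mevent π h' hR) (h.concl_ne_mevent R')

theorem IsPartlySaturated.anti {π : SolverParams S} {ℛ₀ ℛ₀' ℛ : Set (Clause S)}
    (h : IsPartlySaturated π ℛ₀ ℛ) (hs : ℛ₀' ⊆ ℛ₀) : IsPartlySaturated π ℛ₀' ℛ :=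
  ⟨h.simplified, fun R₀ hR₀ => h.covers R₀ (hs hR₀), h.concl_ne_mevent⟩

theorem IsPartlySaturated.insertAll {π : SolverParams S} {L : List (Clause S)}
    {ℛ₀ ℛ ℛ' : Set (Clause S)} (hi : SolverParams.InsertAll π L ℛ ℛ')
    (hL : ∀ R ∈ L, ∀ p, R.concl ≠ .mevent p) (h : IsPartlySaturated π ℛ₀ ℛ) :
    IsPartlySaturated π (ℛ₀ ∪ {R | R ∈ L}) ℛ' := by
  induction hi generalizing ℛ₀ with
  | nil ℛ => simpa using h
  | cons he _ ih =>
    refine (ih (fun R hR => hL R (by simp [hR])) (h.elim (hL _ (by simp)) he)).anti ?_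
    intro R hR
    simp only [List.mem_cons, Set.mem_union, Set.mem_ofPred_eq, Set.mem_insert_iff] at hR ⊢
    tauto

/-- Closure under resolution comes from the fixpoint: since adding an inferred set and eliminating
gives the same set back, that set already subsumes everything inferred. -/
theorem exists_isSaturated {π : SolverParams S} {ℛ₀ ℛ₁ : Set (Clause S)}
    (h : π.Saturates ℛ₀ ℛ₁) (h₀ : ∀ R ∈ ℛ₀, ∀ p, R.concl ≠ .mevent p) :
    ∃ ℛ, IsSaturated π ℛ₀ ℛ ∧ ℛ₁ = {R ∈ ℛ | π.sel R = ∅} := by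
  obtain ⟨L, ℛ, ℛ', hL, hi, hr, hfix, rfl⟩ := h
  have h1 : IsPartlySaturated π ℛ₀ ℛ := by
    have := IsPartlySaturated.insertAll (ℛ₀ := ∅) hi (fun R hR => h₀ R ((hL R).1 hR))
      ⟨by simp, by simp, by simp⟩
    exact this.anti fun R hR => .inr ((hL R).2 hR)
  have h2 : IsPartlySaturated π ℛ₀ ℛ' := by
    clear hfix hi
    induction hr with
    | refl => exact h1
    | tail _ h ih =>
      obtain ⟨T, ⟨R, hR, -, R', hR', F₀, hF₀, R'', hR'', rfl⟩, he⟩ := h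
      refine (ih.elim (fun p hp => ?_) he).anti (Set.subset_insert _ _)
      obtain ⟨σ, hσ⟩ := resolve_concl hR''
      have := ih.concl_ne_mevent R' hR'
      rw [hσ] at hp
      cases hc : R'.concl with
      | mevent q => exact this q hc
      | _ => simp [hc, Fact.subst] at hp
  refine ⟨ℛ', ⟨h2.simplified, h2.covers, ?_, h2.concl_ne_mevent⟩, rfl⟩
  intro R hR hs R' hR' F₀ hF₀ R₁ hR₁ R₂ hR₂
  exact (hfix _ ⟨R, hR, hs, R', hR', F₀, hF₀, R₁, hR₁, rfl⟩).covers _ (.inl hR₂)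

/-- No instance of a fact of `notFacts` can be derived with cost at most `n`. -/
def NotFree (π : SolverParams S) (𝒦 : Set (Clause S)) (B : Set S.Pt) (n : ℕ) : Prop :=
  ∀ F ∈ π.notFacts, ∀ σ : ℕ → S.Pt, ¬ WDer 𝒦 B n (F.subst σ)

theorem NotFree.anti {π : SolverParams S} {𝒦 : Set (Clause S)} {B : Set S.Pt} {n m : ℕ}
    (h : NotFree π 𝒦 B n) (hm : m ≤ n) : NotFree π 𝒦 B m :=
  fun F hF σ hd => h F hF σ (hd.mono hm)

/-- A hypothesis that is an instance of a fact of `notFacts` would have a derivable instance, so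
this test never deletes a clause that is used in a derivation. -/
theorem NotFree.not_instance {π : SolverParams S} {𝒦 : Set (Clause S)} {B : Set S.Pt} {n : ℕ}
    (h : NotFree π 𝒦 B n) {H : Multiset (Fact S)} {σ : ℕ → S.Pt}
    (hH : MDer 𝒦 B (H.map (Fact.subst σ)) n) :
    ¬ ∃ F ∈ H, ∃ F' ∈ π.notFacts, ∃ τ, F'.subst τ = F := by
  rintro ⟨_, hF, F', hF', τ, rfl⟩
  have := hH.cost_le (Multiset.mem_map_of_mem _ hF)
  rw [Fact.subst_subst] at this
  exact h F' hF' _ this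

/-! ### Decomposition of data constructors without increase of cost -/

variable {π : SolverParams S} {Init : Finset ℕ} {ℛ₀ ℛ : Set (Clause S)} {B : Set S.Pt}

/-- The clauses without selected hypothesis. -/
abbrev unselected (π : SolverParams S) (ℛ : Set (Clause S)) : Set (Clause S) :=
  {R ∈ ℛ | π.sel R = ∅}

theorem cover_decomp {R R₁ : Clause S} (hcov : ∀ R' ∈ π.simplify R, ∃ R₃ ∈ ℛ, Subsumes R₃ R')
    (h₁ : R₁ ∈ decomp R) {σ : ℕ → S.Pt} {n : ℕ}
    (hd : MDer (unselected π ℛ) B (R₁.hyps.map (Fact.subst σ)) n)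
    (hf : NotFree π (unselected π ℛ) B n) :
    R₁.concl ∈ R₁.hyps ∨ ∃ R₃ ∈ ℛ, Subsumes R₃ R₁ := by
  by_cases ht : R₁.concl ∈ R₁.hyps
  · exact .inl ht
  obtain ⟨R', hR', hle, hc⟩ := exists_mem_simplify π h₁ (hf.not_instance hd) ht
  obtain ⟨R₃, hR₃, σ', h1, h2⟩ := hcov R' hR'
  exact .inr ⟨R₃, hR₃, σ', h1.trans hc, h2.trans hle⟩

theorem projection_clause_mem (hatt : ∀ R, AttackerClause Init R → R ∈ ℛ₀) {f : S.Con}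
    (hf : f ∈ S.data) (i : Fin (S.arity f)) :
    (⟨{.attacker (.app f fun j => .var j)}, .attacker (.var i)⟩ : Clause S) ∈ ℛ₀ := by
  obtain ⟨g, hg, har, hr⟩ := S.data_proj f hf i
  have := hatt _ (AttackerClause.rg (Init := Init) g hg _ (by rw [hr]; exact Set.mem_singleton _))
  convert this using 2
  · simp [attackerAll, har, Term.toPat]
  · rfl

/-- The substitution that maps the first variables to the given patterns. -/
def argSubst {n : ℕ} (p : Fin n → S.Pt) (k : ℕ) : S.Pt :=
  if h : k < n then p ⟨k, h⟩ else .var k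

@[simp] theorem argSubst_val {n : ℕ} (p : Fin n → S.Pt) (i : Fin n) : argSubst p i = p i := by
  simp [argSubst]

/-- Resolving `R` with the projection clause of `f` gives a clause with hypotheses corresponding to
those of `R` and with conclusion a variable, instantiated by `p i`. Saturation covers this resolvent
by an unselected clause, so `p i` is reached in one step from facts of total cost `N`. -/
theorem projection_of_var (hsat : IsSaturated π ℛ₀ ℛ)
    (hatt : ∀ R, AttackerClause Init R → R ∈ ℛ₀) {f : S.Con} (hf : f ∈ S.data)
    {p : Fin (S.arity f) → S.Pt} {n N : ℕ} (hfree : NotFree π (unselected π ℛ) B n)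
    (hd : WDer (unselected π ℛ) B n (.attacker (.app f p)))
    {R : Clause S} (hR : R ∈ unselected π ℛ) {x : ℕ} (hx : R.concl = .attacker (.var x))
    {σ : ℕ → S.Pt} (hσ : σ x = .app f p)
    (hN : MDer (unselected π ℛ) B (R.hyps.map (Fact.subst σ)) N) (hNn : N ≤ n)
    (i : Fin (S.arity f)) :
    WDer (unselected π ℛ) B ((1 + N) * (p i).size) (.attacker (p i)) := by
  classical
  have huns : ∀ F ∈ R.hyps, F.Unselectable := by
    by_contra! h
    exact (π.isSelection.attacker_var R x hx h).ne_empty hR.2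
  have hdata : IsDataClause
      (⟨{.attacker (.app f fun j => .var j)}, .attacker (.var i)⟩ : Clause S) :=
    ⟨f, hf, fun j => j, Fin.val_injective, .inr ⟨i, rfl⟩⟩
  -- `R₂` represents the projection clause in `ℛ`. It may be more general; the possible shapes of
  -- its hypotheses are examined below.
  have hcov := cover_decomp (B := B) (σ := argSubst p) (n := n)
    (hsat.covers _ (projection_clause_mem hatt hf i))
    (by rw [decomp_of_isDataClause hdata]; exact Set.mem_singleton _)
    (by simpa [Fact.subst, Pat.subst] using MDer.singleton hd) hfree
  rcases hcov with h | ⟨R₂, hR₂, σ₂, hc, hh⟩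
  · simp at h
  have hpi : ((R₂.concl.subst σ₂).subst (argSubst p)) = .attacker (p i) := by
    rw [hc]; simp [Fact.subst, Pat.subst]
  obtain ⟨z, hz⟩ : ∃ z, R₂.concl = .attacker (.var z) := by
    cases hR₂c : R₂.concl with
    | attacker q =>
      rw [hR₂c] at hc
      simp only [Fact.subst, Fact.attacker.injEq] at hc
      obtain ⟨y, rfl⟩ := Pat.eq_var_of_subst_eq_var hc
      exact ⟨y, rfl⟩
    | _ => simp [hR₂c, Fact.subst] at hc
  rw [hz] at hc
  simp only [Fact.subst, Pat.subst, Fact.attacker.injEq] at hc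
  obtain ⟨R₀, hR₀⟩ := hsat.simplified _ hR₂
  rcases Multiset.empty_or_exists_mem R₂.hyps with h0 | ⟨F₀, hF₀⟩
  · have hR₂s : R₂ ∈ unselected π ℛ := ⟨hR₂, sel_eq_empty π (by simp [h0])⟩
    have := WDer.of_clause (B := B) (σ := fun x => (σ₂ x).subst (argSubst p)) (N := N)
      (n := (1 + N) * (p i).size) hR₂s (by rw [h0]; exact MDer.zero)
    rw [← Fact.subst_subst, hpi] at this
    exact this le_rfl
  have hhF : R₂.hyps = {F₀} ∧ F₀.subst σ₂ = .attacker (.app f fun j => .var j) := by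
    obtain ⟨t, ht⟩ := Multiset.exists_cons_of_mem hF₀
    rw [ht, Multiset.map_cons] at hh
    have hcard := Multiset.card_le_card hh
    have ht0 : t = 0 := by
      simpa using hcard
    subst ht0
    refine ⟨ht, ?_⟩
    have := Multiset.mem_of_le hh (Multiset.mem_cons_self _ _)
    simpa using this
  obtain ⟨hF, hFσ⟩ := hhF
  obtain ⟨q, rfl⟩ : ∃ q, F₀ = .attacker q := by
    cases F₀ <;> simp [Fact.subst] at hFσ ⊢
  simp only [Fact.subst, Fact.attacker.injEq] at hFσ
  obtain ⟨ys, rfl⟩ | ⟨y, rfl⟩ : (∃ ys : Fin (S.arity f) → ℕ, q = .app f fun j => .var (ys j)) ∨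
      ∃ y, q = .var y := by
    cases q with
    | var y => exact .inr ⟨y, rfl⟩
    | sess l => simp [Pat.subst] at hFσ
    | name a n args => simp [Pat.subst] at hFσ
    | app g args =>
      simp only [Pat.subst, Pat.app.injEq] at hFσ
      obtain ⟨rfl, h⟩ := hFσ
      have h := eq_of_heq h
      have : ∀ j, ∃ y, args j = .var y := fun j =>
        Pat.eq_var_of_subst_eq_var (congrFun h j)
      choose ys hys using this
      exact .inl ⟨ys, by rw [funext hys]⟩
  swap
  -- The shape `attacker(y) ⇒ attacker(z)` is impossible: it forces `y = z`, and tautologies are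
  -- deleted.
  · have := simplify_hyps_singleton_var π hR₀ hF
    rw [hz] at this
    obtain rfl : y = z := this
    exact absurd (by rw [hz, hF]; simp) (simplify_concl_not_mem π hR₀)
  have hsel : .attacker (.app f fun j => .var (ys j)) ∈ π.sel R₂ := by
    obtain ⟨F, hF'⟩ := π.isSelection.attacker_var R₂ z hz
      ⟨_, hF₀, by rintro (⟨x, h⟩ | ⟨p, h⟩) <;> simp at h⟩
    have := π.isSelection.subset _ _ hF'
    rw [hF, Multiset.mem_singleton] at this
    exact this ▸ hF'
  have hunif : R.concl.subst σ = (Fact.attacker (.app f fun j => .var (ys j)) : Fact S).subst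
      (fun x => (σ₂ x).subst (argSubst p)) := by
    rw [hx, ← Fact.subst_subst]
    simp only [Fact.subst, hFσ]
    simp [Pat.subst, hσ]
  obtain ⟨s, hs, hmem⟩ := resolve_complete hF₀ hunif
  obtain ⟨θ, hθ, hθ'⟩ := hs.2 _ _ hunif
  -- A second, purely symbolic unifier. Since it factors through `s`, the substitution `s` can only
  -- rename the variables of `R₂` and those of `R` other than `x`.
  obtain ⟨θ₁, hθ₁, hθ₁'⟩ := hs.2 (Function.update Pat.var x (.app f fun j => .var (ys j))) Pat.var
    (by rw [hx]; simp [Fact.subst, Pat.subst])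
  -- Needed because `x` is the one variable of `R` that resolution may instantiate by more than a
  -- variable.
  have hRx : Fact.attacker (.var x) ∉ R.hyps := by
    obtain ⟨R₁, hR₁⟩ := hsat.simplified _ hR.1
    have := simplify_concl_not_mem π hR₁
    rwa [hx] at this
  obtain ⟨z', hz'⟩ : ∃ z', s.2 z = .var z' := Pat.eq_var_of_subst_eq_var (hθ₁' z).symm
  set R'' : Clause S := ⟨R.hyps.map (Fact.subst s.1) +
    (R₂.hyps.erase (.attacker (.app f fun j => .var (ys j)))).map (Fact.subst s.2),
    R₂.concl.subst s.2⟩ with hR''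
  have hh'' : R''.hyps = R.hyps.map (Fact.subst s.1) := by
    rw [hR'']; simp [hF]
  have hc'' : R''.concl = .attacker (.var z') := by
    rw [hR'']; simp [hz, Fact.subst, Pat.subst, hz']
  have huns'' : ∀ F ∈ R''.hyps, F.Unselectable := by
    intro F hF'
    rw [hh''] at hF'
    obtain ⟨F₁, hF₁, rfl⟩ := Multiset.mem_map.1 hF'
    rcases huns F₁ hF₁ with ⟨y, rfl⟩ | ⟨p, rfl⟩
    · have hyx : y ≠ x := fun h => hRx (h ▸ hF₁)
      have := hθ₁ y
      rw [Function.update_of_ne hyx] at this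
      obtain ⟨y', hy'⟩ := Pat.eq_var_of_subst_eq_var this.symm
      exact .inl ⟨y', by simp [Fact.subst, Pat.subst, hy']⟩
    · exact .inr ⟨_, rfl⟩
  -- With variables in all `attacker` facts there is nothing to decompose.
  have hdec : R'' ∈ decomp R'' := by
    unfold decomp
    split
    · exact Set.mem_singleton _
    · refine ⟨?_, by rw [hc'']; simp [decompFact, dataParts]⟩
      conv_lhs => rw [← Multiset.map_id R''.hyps, ← Multiset.bind_singleton]
      exact Multiset.bind_congr fun F hF' => ((huns'' F hF').decompFact_eq).symm
  have hinst : R''.hyps.map (Fact.subst θ) = R.hyps.map (Fact.subst σ) := by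
    rw [hh'', Multiset.map_map]
    refine Multiset.map_congr rfl fun F _ => ?_
    rw [Function.comp_apply, Fact.subst_subst, funext hθ]
  have hinstc : R''.concl.subst θ = .attacker (p i) := by
    rw [← hpi, hR'', Fact.subst_subst, Fact.subst_subst, ← funext hθ']
  have hN'' : MDer (unselected π ℛ) B (R''.hyps.map (Fact.subst θ)) N := by rwa [hinst]
  rcases cover_decomp (fun R' hR' => hsat.closed R hR.1 hR.2 R₂ hR₂ _ hsel _ hmem R' hR')
    hdec hN'' (hfree.anti hNn) with h | ⟨R₄, hR₄, σ₄, hc₄, hh₄⟩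
  · have := hN''.cost_le (Multiset.mem_map_of_mem (Fact.subst θ) h)
    rw [hinstc] at this
    refine this.mono ?_
    have := Pat.one_le_size (p i)
    nlinarith
  · have hR₄s : R₄ ∈ unselected π ℛ := ⟨hR₄, sel_eq_empty π fun F hF' =>
      Fact.Unselectable.of_subst (σ := σ₄)
        (huns'' _ (Multiset.mem_of_le hh₄ (Multiset.mem_map_of_mem _ hF')))⟩
    have := WDer.of_clause (B := B) (σ := fun x => (σ₄ x).subst θ) (N := N)
      (n := (1 + N) * (p i).size) hR₄s (by
        have h := Multiset.map_le_map (f := Fact.subst θ) hh₄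
        simp only [Multiset.map_map, Function.comp_def, Fact.subst_subst] at h
        exact hN''.mono h le_rfl)
    rw [← Fact.subst_subst, hc₄, hinstc] at this
    exact this le_rfl

/-- The arguments of a derivable application of a data constructor are derivable at no higher
total cost. -/
theorem projection (hsat : IsSaturated π ℛ₀ ℛ)
    (hatt : ∀ R, AttackerClause Init R → R ∈ ℛ₀) {f : S.Con} (hf : f ∈ S.data)
    {p : Fin (S.arity f) → S.Pt} {n : ℕ} (hfree : NotFree π (unselected π ℛ) B n)
    (hd : WDer (unselected π ℛ) B n (.attacker (.app f p))) :
    MDer (unselected π ℛ) B (attackerAll p) n := by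
  rcases hd.last_step with ⟨q, -, h⟩ | ⟨R, hR, σ, N, hc, hN, hn⟩
  · cases h
  simp only [Fact.size, Pat.size] at hn
  have hNn : N ≤ n := by
    have := Nat.le_mul_of_pos_right (1 + N) (show 0 < 1 + ∑ i, (p i).size by omega)
    omega
  cases hRc : R.concl with
  | attacker q =>
    rw [hRc] at hc
    simp only [Fact.subst, Fact.attacker.injEq] at hc
    cases q with
    | var x =>
      -- The factor `1 + N` is common to all arguments, so the costs add up to `(1 + N) · ∑ size (p
      -- i)`, below the cost `(1 + N) · (1 + ∑ size (p i))` of the application.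
      have h := MDer.sum Finset.univ fun i _ =>
        MDer.singleton (projection_of_var hsat hatt hf hfree hd hR hRc hc hN hNn i)
      refine h.mono (le_of_eq ?_) (le_trans ?_ hn)
      · exact (Multiset.bind_singleton Finset.univ.val _).symm
      · rw [← Finset.mul_sum]
        exact Nat.mul_le_mul_left _ (Nat.le_add_left _ _)
    | sess l => simp [Pat.subst] at hc
    | name a m args => simp [Pat.subst] at hc
    | app g q =>
      simp only [Pat.subst, Pat.app.injEq] at hc
      obtain ⟨rfl, hc⟩ := hc
      obtain rfl := eq_of_heq hc
      obtain ⟨R₀, hR₀⟩ := hsat.simplified _ hR.1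
      rw [simplify_concl_data π hR₀ hf hRc, map_attackerAll] at hN
      exact hN.mono le_rfl hNn
  | _ => simp [hRc, Fact.subst] at hc

/-- `projection` bounds the sum of the least costs of the arguments, so each argument can be
decomposed recursively within its own share. -/
theorem mder_dataParts (hsat : IsSaturated π ℛ₀ ℛ)
    (hatt : ∀ R, AttackerClause Init R → R ∈ ℛ₀) (σ : ℕ → S.Pt) (q : S.Pt) {n : ℕ}
    (hfree : NotFree π (unselected π ℛ) B n)
    (hd : WDer (unselected π ℛ) B n (.attacker (q.subst σ))) :
    MDer (unselected π ℛ) B ((dataParts q).map fun r => .attacker (r.subst σ)) n := by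
  induction q generalizing n with
  | var x => simpa [dataParts] using MDer.singleton hd
  | sess l => simpa [dataParts] using MDer.singleton hd
  | name a m args ih => simpa [dataParts] using MDer.singleton hd
  | app f args ih =>
    unfold dataParts
    split
    · rename_i hf
      have h := projection hsat hatt hf hfree hd
      have hi := MDer.sum Finset.univ fun i _ => ih i
        (hfree.anti (le_trans (Multiset.le_sum_of_mem (Multiset.mem_map_of_mem _
          (mem_attackerAll.2 ⟨i, rfl⟩))) h.2))
        (Exists.choose_spec (h.1 _ (mem_attackerAll.2 ⟨i, rfl⟩))).at_derCost
      refine hi.mono (le_of_eq ?_) (le_trans (le_of_eq ?_) h.2)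
      · exact map_sum (Multiset.mapAddMonoidHom fun r : S.Pt => Fact.attacker (r.subst σ)) _ _
      · simp [attackerAll, Finset.sum, Function.comp_def]
    · simpa using MDer.singleton hd

theorem mder_decompFact (hsat : IsSaturated π ℛ₀ ℛ)
    (hatt : ∀ R, AttackerClause Init R → R ∈ ℛ₀) (σ : ℕ → S.Pt) (F : Fact S) {n : ℕ}
    (hfree : NotFree π (unselected π ℛ) B n)
    (hd : WDer (unselected π ℛ) B n (F.subst σ)) :
    MDer (unselected π ℛ) B ((decompFact F).map (Fact.subst σ)) n := by
  cases F with
  | attacker q =>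
    simpa [decompFact, Multiset.map_map, Function.comp_def, Fact.subst] using
      mder_dataParts hsat hatt σ q hfree hd
  | _ => simpa [decompFact] using MDer.singleton hd

theorem mder_bind_decompFact (hsat : IsSaturated π ℛ₀ ℛ)
    (hatt : ∀ R, AttackerClause Init R → R ∈ ℛ₀) (σ : ℕ → S.Pt) (H : Multiset (Fact S)) {n : ℕ}
    (hfree : NotFree π (unselected π ℛ) B n)
    (hd : MDer (unselected π ℛ) B (H.map (Fact.subst σ)) n) :
    MDer (unselected π ℛ) B ((H.bind decompFact).map (Fact.subst σ)) n := by
  induction H using Multiset.induction_on generalizing n with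
  | empty => exact MDer.zero
  | cons F H ih =>
    rw [Multiset.map_cons] at hd
    obtain ⟨k, l, hk, hl, -, hkl⟩ := hd.cons
    rw [Multiset.cons_bind, Multiset.map_add]
    exact ((mder_decompFact hsat hatt σ F (hfree.anti (by omega)) hk).add
      (ih (hfree.anti (by omega)) hl)).mono le_rfl hkl

theorem mder_decompHyp (hsat : IsSaturated π ℛ₀ ℛ)
    (hatt : ∀ R, AttackerClause Init R → R ∈ ℛ₀) (σ : ℕ → S.Pt) (R : Clause S) {n : ℕ}
    (hfree : NotFree π (unselected π ℛ) B n)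
    (hd : MDer (unselected π ℛ) B (R.hyps.map (Fact.subst σ)) n) :
    MDer (unselected π ℛ) B ((decompHyp R).hyps.map (Fact.subst σ)) n := by
  unfold decompHyp
  split
  · exact hd
  · exact mder_bind_decompFact hsat hatt σ _ hfree hd

/-! #### Backward search -/

/-- The arguments of the calls of `deriv` in `derivable(F, ℛ₁)`. -/
inductive DerivNode (π : SolverParams S) (ℛ₁ : Set (Clause S)) (F : Fact S) :
    Clause S → Set (Clause S) → Prop
  | root : DerivNode π ℛ₁ F ⟨{F}, F⟩ ∅
  | child {R 𝒜 R' F₀ R₁ R₂} : DerivNode π ℛ₁ F R 𝒜 → (∀ R' ∈ 𝒜, ¬ Subsumes R' R) → R' ∈ ℛ₁ →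
      F₀ ∈ π.sel R → R₁ ∈ resolve R' F₀ R → R₂ ∈ π.simplify' R₁ → DerivNode π ℛ₁ F R₂ (insert R 𝒜)

theorem DerivNode.mem_derivable {ℛ₁ : Set (Clause S)} {F : Fact S} {R : Clause S}
    {𝒜 : Set (Clause S)} (h : DerivNode π ℛ₁ F R 𝒜) {D : Clause S}
    (hD : SolverParams.InDeriv π ℛ₁ R 𝒜 D) : D ∈ π.derivable F ℛ₁ := by
  induction h with
  | root => exact hD
  | child _ h1 h2 h3 h4 h5 ih => exact ih (.step h1 h2 h3 h4 h5 hD)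

/-- An ancestor was expanded, so it passed its own subsumption check. The search can resume there
without failing that check again. -/
theorem DerivNode.ancestor {ℛ₁ : Set (Clause S)} {F : Fact S} {R : Clause S}
    {𝒜 : Set (Clause S)} (h : DerivNode π ℛ₁ F R 𝒜) {R' : Clause S} (hR' : R' ∈ 𝒜) :
    ∃ 𝒜', DerivNode π ℛ₁ F R' 𝒜' ∧ ∀ R'' ∈ 𝒜', ¬ Subsumes R'' R' := by
  induction h with
  | root => cases hR'
  | child h h1 _ _ _ _ ih =>
    rcases hR' with rfl | hR'
    · exact ⟨_, h, h1⟩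
    · exact ih hR'

theorem inDeriv_concl {ℛ₁ : Set (Clause S)} {F : Fact S} {R D : Clause S} {𝒜 : Set (Clause S)}
    (h : SolverParams.InDeriv π ℛ₁ R 𝒜 D) (hR : ∃ σ, R.concl = F.subst σ) :
    ∃ σ, D.concl = F.subst σ := by
  induction h with
  | found _ _ => exact hR
  | step _ _ _ h4 h5 _ ih =>
    apply ih
    obtain ⟨σ, hσ⟩ := hR
    obtain ⟨τ, hτ⟩ := resolve_concl h4
    exact ⟨_, by rw [simplify'_concl π h5, hτ, hσ, Fact.subst_subst]⟩

theorem derivable_concl {ℛ₁ : Set (Clause S)} {F : Fact S} {D : Clause S}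
    (h : D ∈ π.derivable F ℛ₁) : ∃ σ, D.concl = F.subst σ :=
  inDeriv_concl h ⟨.var, (Fact.subst_var F).symm⟩

/-- Resolution upon a selected hypothesis decreases the cost of the hypotheses. -/
theorem exists_resolvent_of_selected {R : Clause S} {F₀ : Fact S}
    (hF₀ : F₀ ∈ π.sel R) {σ : ℕ → S.Pt} {M : ℕ}
    (hM : MDer (unselected π ℛ) B (R.hyps.map (Fact.subst σ)) M) :
    ∃ R' ∈ unselected π ℛ, ∃ R₁ ∈ resolve R' F₀ R, ∃ θ : ℕ → S.Pt, ∃ M' < M,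
      MDer (unselected π ℛ) B (R₁.hyps.map (Fact.subst θ)) M' ∧
      R₁.concl.subst θ = R.concl.subst σ := by
  have hmem := π.isSelection.subset _ _ hF₀
  obtain ⟨m, hm⟩ := hM.1 _ (Multiset.mem_map_of_mem (Fact.subst σ) hmem)
  rcases hm.at_derCost.last_step with ⟨p, -, hp⟩ | ⟨R', hR', τ, K, hc, hK, hKn⟩
  · exact absurd (Fact.Unselectable.of_subst (σ := σ) (.inr ⟨p, hp⟩))
      (π.isSelection.selectable _ _ hF₀)
  · refine ⟨R', hR', exists_resolvent hmem hc hK ?_ hM⟩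
    exact le_trans (Nat.le_mul_of_pos_right _ (Fact.one_le_size _)) hKn

/-- Induction on the cost of the instantiated hypotheses. A selected hypothesis is resolved with the
last clause of its cheapest derivation, and the child node is strictly cheaper. As the costs met
after resolution are below `N`, freedom from `notFacts` is required only below `N`. -/
theorem exists_derivable_of_node (hsat : IsSaturated π ℛ₀ ℛ)
    (hatt : ∀ R, AttackerClause Init R → R ∈ ℛ₀) (F G : Fact S) (N : ℕ)
    (hfree : ∀ k < N, NotFree π (unselected π ℛ) B k) (M : ℕ) : M ≤ N →
    ∀ (R : Clause S) (𝒜 : Set (Clause S)), DerivNode π (unselected π ℛ) F R 𝒜 →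
    ∀ σ : ℕ → S.Pt, R.concl.subst σ = G →
    MDer (unselected π ℛ) B (R.hyps.map (Fact.subst σ)) M →
    ∃ D ∈ π.derivable F (unselected π ℛ), ∃ τ : ℕ → S.Pt, D.concl.subst τ = G ∧
      ∀ F' ∈ D.hyps, ∃ m, WDer (unselected π ℛ) B m (F'.subst τ) := by
  induction M using Nat.strong_induction_on with
  | _ M ih =>
  intro hMN
  have main : ∀ (R : Clause S) (𝒜 : Set (Clause S)), DerivNode π (unselected π ℛ) F R 𝒜 →
      (∀ R' ∈ 𝒜, ¬ Subsumes R' R) →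
      ∀ σ : ℕ → S.Pt, R.concl.subst σ = G →
      MDer (unselected π ℛ) B (R.hyps.map (Fact.subst σ)) M →
      ∃ D ∈ π.derivable F (unselected π ℛ), ∃ τ : ℕ → S.Pt, D.concl.subst τ = G ∧
        ∀ F' ∈ D.hyps, ∃ m, WDer (unselected π ℛ) B m (F'.subst τ) := by
    intro R 𝒜 hnode hns σ hG hM
    rcases Set.eq_empty_or_nonempty (π.sel R) with hs | ⟨F₀, hF₀⟩
    · exact ⟨R, hnode.mem_derivable (.found hns hs), σ, hG,
        fun F' hF' => hM.1 _ (Multiset.mem_map_of_mem _ hF')⟩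
    · obtain ⟨R', hR', R₁, hR₁, θ, M', hM', hd, hc⟩ := exists_resolvent_of_selected hF₀ hM
      have hf := hfree M' (hM'.trans_le hMN)
      have hd' := mder_decompHyp hsat hatt θ R₁ hf hd
      obtain ⟨R₂, hR₂, hle, hc₂⟩ := exists_mem_simplify' π (hf.not_instance hd')
      refine ih M' hM' (hM'.le.trans hMN) R₂ _ (.child hnode hns hR' hF₀ hR₁ hR₂) θ ?_ ?_
      · rw [hc₂, hc, hG]
      · exact hd'.mono (Multiset.map_le_map hle) le_rfl
  intro R 𝒜 hnode σ hG hM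
  by_cases hns : ∀ R' ∈ 𝒜, ¬ Subsumes R' R
  · exact main R 𝒜 hnode hns σ hG hM
  -- The node is cut off by a subsuming ancestor. Instances of the ancestor's hypotheses are among
  -- those of `R`, so the argument continues at the ancestor with the same cost `M`.
  · push Not at hns
    obtain ⟨R', hR', τ, hc, hh⟩ := hns
    obtain ⟨𝒜', hnode', hns'⟩ := hnode.ancestor hR'
    refine main R' 𝒜' hnode' hns' (fun x => (τ x).subst σ) (by rw [← Fact.subst_subst, hc, hG]) ?_
    have h := Multiset.map_le_map (f := Fact.subst σ) hh
    simp only [Multiset.map_map, Function.comp_def, Fact.subst_subst] at h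
    exact hM.mono h le_rfl

theorem exists_derivable (hsat : IsSaturated π ℛ₀ ℛ)
    (hatt : ∀ R, AttackerClause Init R → R ∈ ℛ₀) (F : Fact S) (σ : ℕ → S.Pt) (N : ℕ)
    (hfree : ∀ k < N, NotFree π (unselected π ℛ) B k)
    (hd : WDer (unselected π ℛ) B N (F.subst σ)) :
    ∃ D ∈ π.derivable F (unselected π ℛ), ∃ τ : ℕ → S.Pt, D.concl.subst τ = F.subst σ ∧
      ∀ F' ∈ D.hyps, ∃ m, WDer (unselected π ℛ) B m (F'.subst τ) :=
  exists_derivable_of_node hsat hatt F _ N hfree N le_rfl _ _ .root σ rfl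
    (by simpa using MDer.singleton hd)

/-- A derivable instance of cost `n` would make the search for that fact succeed, and that search
relies on freedom from `notFacts` only at smaller costs. -/
theorem notFree_of_derivable_eq_empty (hsat : IsSaturated π ℛ₀ ℛ)
    (hatt : ∀ R, AttackerClause Init R → R ∈ ℛ₀)
    (hnot : ∀ F ∈ π.notFacts, π.derivable F (unselected π ℛ) = ∅) (n : ℕ) :
    NotFree π (unselected π ℛ) B n := by
  induction n using Nat.strong_induction_on with
  | _ n ih =>
    intro F hF σ hd
    obtain ⟨D, hD, -⟩ := exists_derivable hsat hatt F σ n ih hd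
    rw [hnot F hF] at hD
    exact hD

/-! #### Saturation -/

variable (ℛ₀) in
/-- The predicate holds for the conclusion of every instance of a clause whose hypotheses it
holds for. -/
def IsModel (I : Fact S → Prop) : Prop :=
  ∀ R ∈ ℛ₀, ∀ σ : ℕ → S.Pt, (∀ F ∈ R.hyps, I (F.subst σ)) → I (R.concl.subst σ)

/-- The constructor clause has only hypotheses `attacker(x)`, so whatever subsumes it has no
selectable hypothesis and belongs to the returned clauses. -/
theorem construct (hsat : IsSaturated π ℛ₀ ℛ)
    (hatt : ∀ R, AttackerClause Init R → R ∈ ℛ₀)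
    (hfree : ∀ n, NotFree π (unselected π ℛ) B n) {f : S.Con} (hf : f ∈ S.data)
    (p : Fin (S.arity f) → S.Pt) (hp : ∀ i, ∃ m, WDer (unselected π ℛ) B m (.attacker (p i))) :
    ∃ m, WDer (unselected π ℛ) B m (.attacker (.app f p)) := by
  set R : Clause S := ⟨attackerAll (fun i : Fin (S.arity f) => .var i),
    .attacker (.app f (fun i => .var i))⟩ with hRdef
  have hR : R ∈ ℛ₀ := hatt _ (.rf f (S.data_public hf))
  have hdata : IsDataClause R := ⟨f, hf, fun j => j, Fin.val_injective, .inl rfl⟩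
  have hd : MDer (unselected π ℛ) B (R.hyps.map (Fact.subst (argSubst p))) _ :=
    MDer.of_forall fun F hF => by
      rw [hRdef, map_attackerAll] at hF
      obtain ⟨i, rfl⟩ := mem_attackerAll.1 hF
      simpa [Pat.subst] using hp i
  rcases cover_decomp (hsat.covers R hR)
    (by rw [decomp_of_isDataClause hdata]; exact Set.mem_singleton _) hd (hfree _) with
    h | ⟨R₂, hR₂, σ₂, hc, hh⟩
  · obtain ⟨i, hi⟩ := mem_attackerAll.1 h
    cases hi
  · have hR₂s : R₂ ∈ unselected π ℛ := ⟨hR₂, sel_eq_empty π fun F hF => by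
      have := Multiset.mem_of_le hh (Multiset.mem_map_of_mem _ hF)
      obtain ⟨i, hi⟩ := mem_attackerAll.1 this
      exact Fact.Unselectable.of_subst (σ := σ₂) (.inl ⟨_, hi.symm⟩)⟩
    have h := Multiset.map_le_map (f := Fact.subst (argSubst p)) hh
    simp only [Multiset.map_map, Function.comp_def, Fact.subst_subst] at h
    have := WDer.of_clause (n := _) (σ := fun x => (σ₂ x).subst (argSubst p)) hR₂s
      (hd.mono h le_rfl) le_rfl
    rw [← Fact.subst_subst, hc] at this
    exact ⟨_, by simpa [hRdef, Fact.subst, Pat.subst] using this⟩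

theorem der_of_dataParts (hsat : IsSaturated π ℛ₀ ℛ)
    (hatt : ∀ R, AttackerClause Init R → R ∈ ℛ₀)
    (hfree : ∀ n, NotFree π (unselected π ℛ) B n) (σ : ℕ → S.Pt) (q : S.Pt)
    (h : ∀ r ∈ dataParts q, ∃ m, WDer (unselected π ℛ) B m (.attacker (r.subst σ))) :
    ∃ m, WDer (unselected π ℛ) B m (.attacker (q.subst σ)) := by
  induction q with
  | var x => exact h _ (by simp [dataParts])
  | sess l => exact h _ (by simp [dataParts])
  | name a n args ih => exact h _ (by simp [dataParts])
  | app f args ih =>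
    by_cases hf : f ∈ S.data
    · refine construct hsat hatt hfree hf _ fun i => ih i fun r hr => h r ?_
      unfold dataParts
      rw [if_pos hf]
      exact Multiset.mem_sum.2 ⟨i, Finset.mem_univ i, hr⟩
    · exact h _ (by simp [dataParts, hf])

/-- Decomposing a conclusion loses nothing, because the adversary can rebuild data from its parts.
-/
theorem der_of_decomp (hsat : IsSaturated π ℛ₀ ℛ)
    (hatt : ∀ R, AttackerClause Init R → R ∈ ℛ₀)
    (hfree : ∀ n, NotFree π (unselected π ℛ) B n) (σ : ℕ → S.Pt) (R : Clause S)
    (h : ∀ R₁ ∈ decomp R, ∃ m, WDer (unselected π ℛ) B m (R₁.concl.subst σ)) :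
    ∃ m, WDer (unselected π ℛ) B m (R.concl.subst σ) := by
  by_cases hd : IsDataClause R
  · exact h R (by rw [decomp_of_isDataClause hd]; exact Set.mem_singleton _)
  · have h' : ∀ c ∈ decompFact R.concl, ∃ m, WDer (unselected π ℛ) B m (c.subst σ) := by
      intro c hc
      exact h ⟨_, c⟩ (by unfold decomp; rw [if_neg hd]; exact ⟨rfl, hc⟩)
    cases hc : R.concl with
    | attacker q =>
      rw [hc] at h'
      exact der_of_dataParts hsat hatt hfree σ q fun r hr => h' _ (Multiset.mem_map_of_mem _ hr)
    | _ => exact h' _ (by simp [hc, decompFact])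

/-- A clause holds for derivable facts if its simplifications are covered by clauses that hold. -/
theorem der_of_covered (hsat : IsSaturated π ℛ₀ ℛ)
    (hatt : ∀ R, AttackerClause Init R → R ∈ ℛ₀)
    (hfree : ∀ n, NotFree π (unselected π ℛ) B n) {M : ℕ}
    (hcl : ∀ R ∈ ℛ, ∀ σ : ℕ → S.Pt, MDer (unselected π ℛ) B (R.hyps.map (Fact.subst σ)) M →
      ∃ m, WDer (unselected π ℛ) B m (R.concl.subst σ))
    {R : Clause S} (hcov : ∀ R' ∈ π.simplify R, ∃ R₃ ∈ ℛ, Subsumes R₃ R') {σ : ℕ → S.Pt}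
    (hM : MDer (unselected π ℛ) B (R.hyps.map (Fact.subst σ)) M) :
    ∃ m, WDer (unselected π ℛ) B m (R.concl.subst σ) := by
  refine der_of_decomp hsat hatt hfree σ R fun R₁ hR₁ => ?_
  have hd := mder_decompHyp hsat hatt σ R (hfree M) hM
  rw [← decompHyp_mem_decomp hR₁] at hd
  rcases cover_decomp hcov hR₁ hd (hfree M) with h | ⟨R₃, hR₃, σ₃, hc, hh⟩
  · exact ⟨_, hd.cost_le (Multiset.mem_map_of_mem _ h)⟩
  · have h := Multiset.map_le_map (f := Fact.subst σ) hh
    simp only [Multiset.map_map, Function.comp_def, Fact.subst_subst] at h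
    have := hcl R₃ hR₃ _ (hd.mono h le_rfl)
    rwa [← Fact.subst_subst, hc] at this

/-- Discarding clauses with selected hypotheses loses no consequence. Induction on the cost of the
hypotheses: a selected one is resolved away, and the resolvent is covered by clauses of `ℛ` to which
the induction hypothesis applies. -/
theorem der_of_saturated (hsat : IsSaturated π ℛ₀ ℛ)
    (hatt : ∀ R, AttackerClause Init R → R ∈ ℛ₀)
    (hfree : ∀ n, NotFree π (unselected π ℛ) B n) (M : ℕ) :
    ∀ R ∈ ℛ, ∀ σ : ℕ → S.Pt, MDer (unselected π ℛ) B (R.hyps.map (Fact.subst σ)) M →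
      ∃ m, WDer (unselected π ℛ) B m (R.concl.subst σ) := by
  induction M using Nat.strong_induction_on with
  | _ M ih =>
    intro R hR σ hM
    rcases Set.eq_empty_or_nonempty (π.sel R) with hs | ⟨F₀, hF₀⟩
    · exact ⟨_, WDer.of_clause (𝒦 := unselected π ℛ) ⟨hR, hs⟩ hM le_rfl⟩
    · obtain ⟨R', hR', R₁, hR₁, θ, M', hM', hd, hc⟩ := exists_resolvent_of_selected hF₀ hM
      rw [← hc]
      exact der_of_covered hsat hatt hfree (ih M' hM')
        (hsat.closed R' hR'.1 hR'.2 R hR F₀ hF₀ R₁ hR₁) hd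

theorem isModel_der (hsat : IsSaturated π ℛ₀ ℛ)
    (hatt : ∀ R, AttackerClause Init R → R ∈ ℛ₀)
    (hfree : ∀ n, NotFree π (unselected π ℛ) B n) :
    IsModel ℛ₀ fun F => ∃ m, WDer (unselected π ℛ) B m F := by
  intro R hR σ h
  refine der_of_covered hsat hatt hfree (der_of_saturated hsat hatt hfree _)
    (hsat.covers R hR) (MDer.of_forall fun F hF => ?_)
  obtain ⟨F₁, hF₁, rfl⟩ := Multiset.mem_map.1 hF
  exact h F₁ hF₁

/-- Protocol and attacker clauses never conclude an `m-event`, and saturation preserves this; such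
facts enter only through `B`. -/
theorem mem_of_der_mevent (hsat : IsSaturated π ℛ₀ ℛ) {n : ℕ} {p : S.Pt}
    (h : WDer (unselected π ℛ) B n (.mevent p)) : p ∈ B := by
  rcases h.last_step with ⟨q, hq, h⟩ | ⟨R, hR, σ, N, hc, -⟩
  · cases h; exact hq
  · cases hRc : R.concl with
    | mevent q => exact absurd hRc (hsat.concl_ne_mevent R hR.1 q)
    | _ => simp [hRc, Fact.subst] at hc

end Solver

/-! ### Terms with an environment -/

namespace Term

variable {C : Type u} {ar : C → ℕ}

theorem subst_subst (σ τ : ℕ → Term C ar) (M : Term C ar) :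
    (M.subst σ).subst τ = M.subst (fun x => (σ x).subst τ) := by
  induction M with
  | var x => rfl
  | name a => rfl
  | app f args ih => simp only [subst, ih]

theorem subst_eq_self {σ : ℕ → Term C ar} {M : Term C ar} (h : ∀ x ∈ M.vars, σ x = var x) :
    M.subst σ = M := by
  induction M with
  | var x => exact h x rfl
  | name a => rfl
  | app f args ih =>
    simp only [subst]; congr 1; funext i
    exact ih i fun x hx => h x (Set.mem_iUnion.2 ⟨i, hx⟩)

theorem mem_vars_subst {σ : ℕ → Term C ar} {M : Term C ar} {x : ℕ} :
    x ∈ (M.subst σ).vars ↔ ∃ y ∈ M.vars, x ∈ (σ y).vars := by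
  induction M with
  | var y => simp [subst, vars]
  | name a => simp [subst, vars]
  | app f args ih =>
    simp only [subst, vars, Set.mem_iUnion, ih]
    exact ⟨fun ⟨i, y, h, h'⟩ => ⟨y, ⟨i, h⟩, h'⟩, fun ⟨y, ⟨i, h⟩, h'⟩ => ⟨i, y, h, h'⟩⟩

theorem mem_names_subst {σ : ℕ → Term C ar} {M : Term C ar} {a : ℕ} :
    a ∈ (M.subst σ).names ↔ a ∈ M.names ∨ ∃ y ∈ M.vars, a ∈ (σ y).names := by
  induction M with
  | var y => simp [subst, vars, names]
  | name a => simp [subst, vars, names]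
  | app f args ih =>
    simp only [subst, vars, names, Set.mem_iUnion, ih]
    constructor
    · rintro ⟨i, h | ⟨y, h, h'⟩⟩
      exacts [.inl ⟨i, h⟩, .inr ⟨y, ⟨i, h⟩, h'⟩]
    · rintro (⟨i, h⟩ | ⟨y, ⟨i, h⟩, h'⟩)
      exacts [⟨i, .inl h⟩, ⟨i, .inr ⟨y, h, h'⟩⟩]

/-- The pattern of a closed term when `ν` gives the patterns of the names. -/
def patOf (ν : ℕ → Pat C ar) : Term C ar → Pat C ar
  | var _ => Pat.sess 0
  | name a => ν a
  | app f args => Pat.app f (fun i => (args i).patOf ν)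

theorem patOf_congr {ν ν' : ℕ → Pat C ar} {M : Term C ar} (h : ∀ a ∈ M.names, ν' a = ν a) :
    M.patOf ν' = M.patOf ν := by
  induction M with
  | var x => rfl
  | name a => exact h a rfl
  | app f args ih =>
    simp only [patOf]; congr 1; funext i
    exact ih i fun x hx => h x (Set.mem_iUnion.2 ⟨i, hx⟩)

/-- Rewrite rules contain no names, so evaluating a rule under a substitution of terms is the same
as instantiating its pattern. -/
theorem patOf_subst {ν : ℕ → Pat C ar} {σ : ℕ → Term C ar} {M : Term C ar} (h : M.names = ∅) :
    (M.subst σ).patOf ν = (M.toPat Pat.var).subst fun x => (σ x).patOf ν := by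
  induction M with
  | var x => rfl
  | name a => simp [names] at h
  | app f args ih =>
    simp only [subst, patOf, toPat, Pat.subst]; congr 1; funext i
    refine ih i (Set.eq_empty_of_subset_empty fun a ha => ?_)
    rw [← h]
    exact Set.mem_iUnion.2 ⟨i, ha⟩

/-- A closed term with names in `E`. -/
structure Ground (E : Finset ℕ) (M : Term C ar) : Prop where
  vars_eq : M.vars = ∅
  names_subset : ∀ a ∈ M.names, a ∈ E

theorem Ground.mono {E E' : Finset ℕ} {M : Term C ar} (h : M.Ground E) (hE : E ⊆ E') :
    M.Ground E' :=
  ⟨h.vars_eq, fun a ha => hE (h.names_subset a ha)⟩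

theorem Ground.arg {E : Finset ℕ} {f : C} {args : Fin (ar f) → Term C ar}
    (h : (app f args).Ground E) (i : Fin (ar f)) : (args i).Ground E :=
  ⟨Set.eq_empty_of_subset_empty fun x hx => by
    rw [← h.vars_eq]; exact Set.mem_iUnion.2 ⟨i, hx⟩,
    fun a ha => h.names_subset a (Set.mem_iUnion.2 ⟨i, ha⟩)⟩

/-- Constructors stay constructors and names become name patterns, so the two cannot be confused and
injectivity on names suffices. -/
theorem patOf_injective {ν : ℕ → Pat C ar} {E : Finset ℕ} (hinj : Set.InjOn ν E)
    (hname : ∀ a ∈ E, ∃ s l, ν a = Pat.mkName s l) {M N : Term C ar} (hM : M.Ground E)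
    (hN : N.Ground E) (h : M.patOf ν = N.patOf ν) : M = N := by
  induction M generalizing N with
  | var x => have := hM.vars_eq; simp [vars] at this
  | name a =>
    have ha := hM.names_subset a rfl
    cases N with
    | var x => have := hN.vars_eq; simp [vars] at this
    | name b => exact congrArg name (hinj ha (hN.names_subset b rfl) h)
    | app f args =>
      obtain ⟨s, l, hs⟩ := hname a ha
      simp [patOf, hs, Pat.mkName] at h
  | app f args ih =>
    cases N with
    | var x => have := hN.vars_eq; simp [vars] at this
    | name b =>
      obtain ⟨s, l, hs⟩ := hname b (hN.names_subset b rfl)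
      simp [patOf, hs, Pat.mkName] at h
    | app g args' =>
      simp only [patOf, Pat.app.injEq] at h
      obtain ⟨rfl, h⟩ := h
      congr 1
      funext i
      exact ih i (hM.arg i) (hN.arg i) (congrFun (eq_of_heq h) i)

/-- The substitution of the terms of `env` for the indices from `d` on. -/
def envSubst (env : List (Term C ar)) (d : ℕ) : ℕ → Term C ar :=
  fun j => if j < d then var j else env.getD (j - d) (var j)

/-- The instance of a term for an environment. -/
abbrev close (env : List (Term C ar)) (d : ℕ) (M : Term C ar) : Term C ar :=
  M.subst (envSubst env d)

theorem close_nil (d : ℕ) (M : Term C ar) : M.close [] d = M :=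
  subst_eq_self fun x _ => by simp [envSubst]

theorem envSubst_zero {env : List (Term C ar)} {x : ℕ} (hx : x < env.length) :
    envSubst env 0 x = env[x] := by
  simp [envSubst, hx]

theorem Ground.close {E : Finset ℕ} {env : List (Term C ar)} (henv : ∀ M ∈ env, M.Ground E)
    {M : Term C ar} (hv : ∀ x ∈ M.vars, x < env.length) (hn : ∀ a ∈ M.names, a ∈ E) :
    (M.close env 0).Ground E where
  vars_eq := Set.eq_empty_of_forall_notMem fun x hx => by
    obtain ⟨y, hy, hx⟩ := mem_vars_subst.1 hx
    rw [envSubst_zero (hv y hy), (henv _ (List.getElem_mem _)).vars_eq] at hx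
    exact hx
  names_subset a ha := by
    rcases mem_names_subst.1 ha with h | ⟨y, hy, h⟩
    · exact hn a h
    · rw [envSubst_zero (hv y hy)] at h
      exact (henv _ (List.getElem_mem _)).names_subset a h

end Term

/-! ### Closing terms and processes over an environment -/

section Env

variable {S : Signature.{u, v}}

theorem Signature.Reduces.ground {g : S.Des} {M : Fin (S.desArity g) → S.Tm} {M' : S.Tm}
    (h : S.Reduces g M M') {E : Finset ℕ} (hM : ∀ i, (M i).Ground E) : M'.Ground E := by
  obtain ⟨r, hr, σ, h1, rfl⟩ := h
  have hv : ∀ y ∈ r.rhs.vars, (σ y).Ground E := by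
    intro y hy
    obtain ⟨i, hi⟩ := Set.mem_iUnion.1 (S.rules_vars g r hr hy)
    have := hM i
    rw [h1 i] at this
    exact ⟨Set.eq_empty_of_forall_notMem fun x hx => by
      have hx' := Term.mem_vars_subst.2 ⟨y, hi, hx⟩
      rw [this.vars_eq] at hx'
      exact hx', fun a ha => this.names_subset a (Term.mem_names_subst.2 (.inr ⟨y, hi, ha⟩))⟩
  refine ⟨Set.eq_empty_of_forall_notMem fun x hx => ?_, fun a ha => ?_⟩
  · obtain ⟨y, hy, hx⟩ := Term.mem_vars_subst.1 hx
    rw [(hv y hy).vars_eq] at hx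
    exact hx
  · rcases Term.mem_names_subst.1 ha with h | ⟨y, hy, h⟩
    · rw [(S.rules_nameless g r hr).2] at h
      exact absurd h (Set.notMem_empty a)
    · exact (hv y hy).names_subset a h

theorem envPat_subst {ν : ℕ → S.Pt} {ρ : List S.Pt} {θ : ℕ → S.Pt} {env : List S.Tm}
    (hρ : ρ.map (Pat.subst θ) = env.map (Term.patOf ν)) {M : S.Tm}
    (hv : ∀ x ∈ M.vars, x < env.length)
    (hn : ∀ a ∈ M.names, ν a = Pat.mkName (NameSym.free a) []) :
    (envPat ρ M).subst θ = (M.close env 0).patOf ν := by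
  unfold envPat
  induction M with
  | var x =>
    have hx := hv x rfl
    have hlen : ρ.length = env.length := by simpa using congrArg List.length hρ
    have hx' : x < ρ.length := hlen ▸ hx
    have := List.getElem_of_eq hρ (i := x) (by simpa using hx')
    simp only [List.getElem_map] at this
    simp only [Term.toPat, Term.close, Term.subst, Term.envSubst_zero hx]
    rw [← this]
    simp [hx']
  | name a =>
    simp only [Term.toPat, Term.close, Term.subst, Term.patOf, Pat.mkName_subst, hn a rfl,
      List.map_nil]
  | app f args ih =>
    simp only [Term.toPat, Term.close, Term.subst, Term.patOf, Pat.subst]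
    congr 1
    funext i
    exact ih i (fun x hx => hv x (Set.mem_iUnion.2 ⟨i, hx⟩))
      (fun a ha => hn a (Set.mem_iUnion.2 ⟨i, ha⟩))

/-- Environment entries are closed, so instantiating index `d` afterwards cannot affect them.
Reduction can therefore be read as extending the environment while the code stays fixed. -/
theorem instTerm_close {env : List S.Tm} (henv : ∀ M ∈ env, M.vars = ∅) (N : S.Tm) (d : ℕ)
    (M : S.Tm) : Proc.instTerm N d (M.close env (d + 1)) = M.close (N :: env) d := by
  unfold Proc.instTerm Term.close
  rw [Term.subst_subst]
  congr 1
  funext j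
  unfold Term.envSubst
  rcases lt_trichotomy j d with h | rfl | h
  · rw [if_pos (by omega), if_pos h]
    simp [Term.subst, h.ne]
  · simp [Term.subst]
  · rw [if_neg (by omega), if_neg (by omega)]
    obtain ⟨k, rfl⟩ : ∃ k, j = d + 1 + k := ⟨j - (d + 1), by omega⟩
    have e1 : d + 1 + k - (d + 1) = k := by omega
    have e2 : d + 1 + k - d = k + 1 := by omega
    rw [e1, e2, List.getD_cons_succ]
    by_cases hk : k < env.length
    · rw [List.getD_eq_getElem _ _ hk]
      refine Term.subst_eq_self fun x hx => ?_
      rw [henv _ (List.getElem_mem _)] at hx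
      exact absurd hx (Set.notMem_empty x)
    · rw [List.getD_eq_default _ _ (by omega)]
      simp [Term.subst, h.ne']

namespace Proc

/-- The instance of a process for an environment of its indices from `d` on. -/
def close (env : List S.Tm) : ℕ → Proc S → Proc S
  | d, out M N P => out (M.close env d) (N.close env d) (P.close env d)
  | d, inp M P => inp (M.close env d) (P.close env (d + 1))
  | _, nil => nil
  | d, par P Q => par (P.close env d) (Q.close env d)
  | d, repl P => repl (P.close env d)
  | d, res P => res (P.close env (d + 1))
  | d, letd g M P Q => letd g (fun i => (M i).close env d) (P.close env (d + 1)) (Q.close env d)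
  | d, cond M N P Q => cond (M.close env d) (N.close env d) (P.close env d) (Q.close env d)
  | d, event M P => event (M.close env d) (P.close env d)

theorem close_nil (P : Proc S) (d : ℕ) : P.close [] d = P := by
  induction P generalizing d <;> simp_all [close, Term.close_nil]

theorem inst_close {env : List S.Tm} (henv : ∀ M ∈ env, M.vars = ∅) (N : S.Tm) (P : Proc S)
    (d : ℕ) : (P.close env (d + 1)).inst N d = P.close (N :: env) d := by
  induction P generalizing d <;> simp_all [close, inst, instTerm_close henv]

end Proc

theorem freshVar_spec (ρ ς : List S.Pt) (H : Multiset (Fact S)) :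
    (∀ p ∈ ρ, p.bound ≤ freshVar ρ ς H) ∧ (∀ p ∈ ς, p.bound ≤ freshVar ρ ς H) ∧
      ∀ F ∈ H, F.bound ≤ freshVar ρ ς H := by
  have key : ∀ (l : List ℕ), ∀ n ∈ l, n ≤ l.foldr max 0 := by
    intro l
    induction l with
    | nil => simp
    | cons a l ih =>
      intro n hn
      rcases List.mem_cons.1 hn with rfl | hn
      · exact le_max_left _ _
      · exact (ih n hn).trans (le_max_right _ _)
  refine ⟨fun p hp => ?_, fun p hp => ?_, fun F hF => ?_⟩
  · exact (key _ _ (List.mem_map_of_mem (List.mem_append_left _ hp))).trans (le_max_left _ _)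
  · exact (key _ _ (List.mem_map_of_mem (List.mem_append_right _ hp))).trans (le_max_left _ _)
  · exact (Multiset.le_sup (Multiset.mem_map_of_mem _ hF)).trans (le_max_right _ _)

theorem map_subst_update {ρ : List S.Pt} {θ : ℕ → S.Pt} {x : ℕ} {q : S.Pt}
    (h : ∀ p ∈ ρ, p.bound ≤ x) :
    ρ.map (Pat.subst (Function.update θ x q)) = ρ.map (Pat.subst θ) :=
  List.map_congr_left fun p hp => Pat.subst_update (h p hp)

theorem map_map_subst (ρ : List S.Pt) (σ θ : ℕ → S.Pt) :
    (ρ.map (Pat.subst σ)).map (Pat.subst θ) = ρ.map (Pat.subst fun x => (σ x).subst θ) := by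
  simp [Pat.subst_subst]

end Env

/-! ### Annotated processes -/

section Items

variable {S : Signature.{u, v}}

namespace Proc

/-- The number of replications above the position given by a path from the root. -/
def replsAbove : Proc S → List ℕ → ℕ
  | out _ _ P, p => match p with | [] => 0 | _ :: p => P.replsAbove p
  | inp _ P, p => match p with | [] => 0 | _ :: p => P.replsAbove p
  | nil, _ => 0
  | par P Q, p => match p with | [] => 0 | 0 :: p => P.replsAbove p | _ :: p => Q.replsAbove p
  | repl P, p => match p with | [] => 0 | _ :: p => 1 + P.replsAbove p
  | res P, p => match p with | [] => 0 | _ :: p => P.replsAbove p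
  | letd _ _ P Q, p => match p with | [] => 0 | 0 :: p => P.replsAbove p | _ :: p => Q.replsAbove p
  | cond _ _ P Q, p => match p with | [] => 0 | 0 :: p => P.replsAbove p | _ :: p => Q.replsAbove p
  | event _ P, p => match p with | [] => 0 | _ :: p => P.replsAbove p

theorem replsAbove_nil (P : Proc S) : P.replsAbove [] = 0 := by cases P <;> rfl

end Proc

/-- All keys for a position below `pos` and a list of session identifiers that extends `ss`. -/
def OwnsAll (pos ss : List ℕ) (K : Set (List ℕ × List ℕ)) : Prop :=
  ∀ pos' xs : List ℕ, pos <:+ pos' → (pos', xs ++ ss) ∈ K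

theorem OwnsAll.below {pos ss : List ℕ} {K : Set (List ℕ × List ℕ)} (h : OwnsAll pos ss K)
    (i : ℕ) : OwnsAll (i :: pos) ss K :=
  fun pos' xs hp => h pos' xs ((List.suffix_cons i pos).trans hp)

/-- `K` contains the keys (positions with session identifiers) of all restrictions that can be
executed by the process at position `pos` with session identifiers `ss`. A replication has already
used some session identifiers. -/
def Proc.Owns (P : Proc S) (pos ss : List ℕ) (K : Set (List ℕ × List ℕ)) : Prop :=
  match P with
  | .repl _ => ∃ n, ∀ pos' xs : List ℕ, ∀ l, 0 :: pos <:+ pos' → n ≤ l →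
      (pos', xs ++ l :: ss) ∈ K
  | _ => OwnsAll pos ss K

theorem OwnsAll.owns {pos ss : List ℕ} {K : Set (List ℕ × List ℕ)} (h : OwnsAll pos ss K)
    (P : Proc S) : P.Owns pos ss K := by
  cases P with
  | repl P =>
    refine ⟨0, fun pos' xs l hp _ => ?_⟩
    have := h pos' (xs ++ [l]) ((List.suffix_cons 0 pos).trans hp)
    simpa using this
  | _ => exact h

/-- A process of the protocol: the code at position `pos`, an environment of terms, and data for
the clauses of this code. -/
structure ProtItem (S : Signature.{u, v}) where
  code : Proc S
  pos : List ℕ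
  t : List ℕ
  env : List S.Tm
  ρ : List S.Pt
  ς : List S.Pt
  H : Multiset (Fact S)
  θ : ℕ → S.Pt
  ss : List ℕ
  K : Set (List ℕ × List ℕ)

/-- The processes of a configuration with their origin. -/
inductive Item (S : Signature.{u, v})
  | prot (i : ProtItem S)
  | adv (code : Proc S) (env : List S.Tm)

def Item.proc : Item S → Proc S
  | prot i => i.code.close i.env 0
  | adv code env => code.close env 0

def Item.keys : Item S → Set (List ℕ × List ℕ)
  | prot i => i.K
  | adv _ _ => ∅

/-- Created names live only in the environment; names in the code are the original free ones and
have the pattern `a[]`. The field `repls` says that the position in `P₀` determines the number of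
session identifiers, which is later used to read them off a name pattern. -/
structure ProtItem.WF (P₀ : Proc S) (𝒞 : Set (Clause S)) (ν : ℕ → S.Pt) (E : Finset ℕ)
    (i : ProtItem S) : Prop where
  closed : i.code.ClosedAt i.env.length
  env : ∀ M ∈ i.env, M.Ground E
  fn : ∀ a ∈ i.code.fn, a ∈ E ∧ ν a = Pat.mkName (NameSym.free a) []
  ρ : i.ρ.map (Pat.subst i.θ) = i.env.map (Term.patOf ν)
  ς : i.ς.map (Pat.subst i.θ) = i.ss.map Pat.sess
  clauses : (i.code.instrAt i.pos i.t i.ss.length).clauses i.ρ i.ς i.H ⊆ 𝒞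
  repls : ∀ path, P₀.replsAbove (i.pos.reverse ++ path) = i.ss.length + i.code.replsAbove path
  owns : i.code.Owns i.pos i.ss i.K

structure AdvWF (Init : Finset ℕ) (ν : ℕ → S.Pt) (E : Finset ℕ) (code : Proc S)
    (env : List S.Tm) : Prop where
  closed : code.ClosedAt env.length
  env : ∀ M ∈ env, M.Ground E
  fn : ∀ a ∈ code.fn, a ∈ E ∧ a ∈ Init ∧ ν a = Pat.mkName (NameSym.free a) []
  eventFree : code.EventFree
  publicOnly : code.PublicOnly

def Item.WF (P₀ : Proc S) (Init : Finset ℕ) (ν : ℕ → S.Pt) (E : Finset ℕ) : Item S → Prop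
  | prot i => i.WF P₀ (protocolClauses P₀.instr Init) ν E
  | adv code env => AdvWF Init ν E code env

/-- The facts that an item relies on: its hypotheses, or the knowledge of the adversary. -/
def Item.OK (ν : ℕ → S.Pt) (I : Fact S → Prop) : Item S → Prop
  | prot i => ∀ F ∈ i.H, I (F.subst i.θ)
  | adv _ env => ∀ M ∈ env, I (.attacker (M.patOf ν))

/-- `it` may be replaced by `new`: if the facts `pre` hold, then the facts `post` do, and so do
the facts that `new` relies on. -/
structure Evolves (P₀ : Proc S) (Init : Finset ℕ) (ν : ℕ → S.Pt) (E : Finset ℕ) (it : Item S)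
    (new : Multiset (Item S)) (pre post : Set (Fact S)) : Prop where
  wf : ∀ j ∈ new, j.WF P₀ Init ν E
  keys : ∀ κ, (new.map fun j => j.keys.indicator (fun _ => 1) κ).sum ≤
    it.keys.indicator (fun _ => 1) κ
  sound : ∀ I : Fact S → Prop, IsModel (protocolClauses P₀.instr Init) I → it.OK ν I →
    (∀ F ∈ pre, I F) → (∀ j ∈ new, j.OK ν I) ∧ ∀ F ∈ post, I F

variable {P₀ : Proc S} {Init : Finset ℕ} {ν : ℕ → S.Pt} {E : Finset ℕ}

/-- The data of a protocol item for the process below it. -/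
theorem ProtItem.WF.repls_below {𝒞 : Set (Clause S)} {i : ProtItem S} (h : i.WF P₀ 𝒞 ν E)
    {b n : ℕ} {P : Proc S} (hP : ∀ path, i.ss.length + i.code.replsAbove (b :: path) =
      n + P.replsAbove path) (path : List ℕ) :
    P₀.replsAbove ((b :: i.pos).reverse ++ path) = n + P.replsAbove path := by
  rw [List.reverse_cons, List.append_assoc, List.singleton_append, h.repls, hP]

theorem ProtItem.WF.evalPat {𝒞 : Set (Clause S)} {i : ProtItem S} (h : i.WF P₀ 𝒞 ν E) {M : S.Tm}
    (hv : ∀ x ∈ M.vars, x < i.env.length)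
    (hn : ∀ a ∈ M.names, a ∈ i.code.fn) :
    (envPat i.ρ M).subst i.θ = (M.close i.env 0).patOf ν :=
  envPat_subst h.ρ hv fun a ha => (h.fn a (hn a ha)).2

theorem ProtItem.WF.ground {𝒞 : Set (Clause S)} {i : ProtItem S} (h : i.WF P₀ 𝒞 ν E) {M : S.Tm}
    (hv : ∀ x ∈ M.vars, x < i.env.length)
    (hn : ∀ a ∈ M.names, a ∈ i.code.fn) : (M.close i.env 0).Ground E :=
  Term.Ground.close h.env hv fun a ha => (h.fn a (hn a ha)).1

theorem ProtItem.WF.vars_eq {𝒞 : Set (Clause S)} {i : ProtItem S} (h : i.WF P₀ 𝒞 ν E) :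
    ∀ M ∈ i.env, M.vars = ∅ :=
  fun M hM => (h.env M hM).vars_eq

theorem keys_singleton {j : Item S} {K : Set (List ℕ × List ℕ)} (h : j.keys ⊆ K)
    (κ : List ℕ × List ℕ) :
    ((({j} : Multiset (Item S)).map fun j => j.keys.indicator (fun _ => 1) κ).sum : ℕ) ≤
      K.indicator (fun _ => 1) κ := by
  rw [Multiset.map_singleton, Multiset.sum_singleton]
  exact Set.indicator_le_indicator_of_subset h (fun _ => Nat.zero_le _) κ

/-- Stated with sums of indicators because the items form a multiset: a bound by one says that each
key has at most one owner, counted with multiplicity. -/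
theorem keys_pair {j k : Item S} {K : Set (List ℕ × List ℕ)} (hj : j.keys ⊆ K) (hk : k.keys ⊆ K)
    (hjk : Disjoint j.keys k.keys) (κ : List ℕ × List ℕ) :
    ((({j, k} : Multiset (Item S)).map fun j => j.keys.indicator (fun _ => 1) κ).sum : ℕ) ≤
      K.indicator (fun _ => 1) κ := by
  classical
  have h1 := @hj κ
  have h2 := @hk κ
  have h3 : κ ∈ j.keys → κ ∉ k.keys := fun h => Set.disjoint_left.1 hjk h
  simp only [Multiset.insert_eq_cons, Multiset.map_cons, Multiset.map_singleton,
    Multiset.sum_cons, Multiset.sum_singleton, Set.indicator_apply]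
  split_ifs <;> simp_all

/-! #### Steps of protocol processes -/

/-- The keys are divided by the branch of the syntax tree in which their position lies. -/
theorem ProtItem.evolves_par {i : ProtItem S}
    (h : i.WF P₀ (protocolClauses P₀.instr Init) ν E) {X Y : Proc S}
    (hX : i.code.close i.env 0 = .par X Y) :
    ∃ j k : Item S, j.proc = X ∧ k.proc = Y ∧ Evolves P₀ Init ν E (.prot i) {j, k} ∅ ∅ := by
  obtain ⟨code, pos, t, env, ρ, ς, H, θ, ss, K⟩ := i
  cases code <;> simp only [Proc.close, reduceCtorEq, Proc.par.injEq] at hX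
  rename_i P Q
  obtain ⟨rfl, rfl⟩ := hX
  have hcl := h.closed
  simp only [Proc.ClosedAt] at hcl
  have hfn := h.fn
  simp only [Proc.fn] at hfn
  have hcs := h.clauses
  simp only [Proc.instrAt, IProc.clauses, Set.union_subset_iff] at hcs
  have how : OwnsAll pos ss K := h.owns
  refine ⟨.prot ⟨P, 0 :: pos, t, env, ρ, ς, H, θ, ss, {κ ∈ K | 0 :: pos <:+ κ.1}⟩,
    .prot ⟨Q, 1 :: pos, t, env, ρ, ς, H, θ, ss, {κ ∈ K | 1 :: pos <:+ κ.1}⟩, rfl, rfl, ?_, ?_, ?_⟩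
  · intro j hj
    rcases Multiset.mem_cons.1 hj with rfl | hj
    · exact ⟨hcl.1, h.env, fun a ha => hfn a (.inl ha), h.ρ, h.ς, hcs.1,
        h.repls_below fun path => rfl,
        by refine OwnsAll.owns ?_ P; exact fun pos' xs hp => ⟨how.below 0 _ _ hp, hp⟩⟩
    · obtain rfl := Multiset.mem_singleton.1 hj
      exact ⟨hcl.2, h.env, fun a ha => hfn a (.inr ha), h.ρ, h.ς, hcs.2,
        h.repls_below fun path => rfl,
        by refine OwnsAll.owns ?_ Q; exact fun pos' xs hp => ⟨how.below 1 _ _ hp, hp⟩⟩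
  · refine keys_pair (fun κ hκ => hκ.1) (fun κ hκ => hκ.1) ?_
    rw [Set.disjoint_left]
    rintro κ ⟨-, h0⟩ ⟨-, h1⟩
    have := List.suffix_of_suffix_length_le h0 h1 (by simp)
    have := this.eq_of_length (by simp)
    simp at this
  · intro I _ hok _
    refine ⟨fun j hj => ?_, by simp⟩
    rcases Multiset.mem_cons.1 hj with rfl | hj
    · exact hok
    · obtain rfl := Multiset.mem_singleton.1 hj
      exact hok

/-- The new copy takes the first unused session identifier `n` and with it all keys whose session
list ends with `n :: ss`; the replication keeps the others. -/
theorem ProtItem.evolves_repl {i : ProtItem S}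
    (h : i.WF P₀ (protocolClauses P₀.instr Init) ν E) {X : Proc S}
    (hX : i.code.close i.env 0 = .repl X) :
    ∃ j k : Item S, j.proc = X ∧ k.proc = .repl X ∧
      Evolves P₀ Init ν E (.prot i) {j, k} ∅ ∅ := by
  obtain ⟨code, pos, t, env, ρ, ς, H, θ, ss, K⟩ := i
  cases code <;> simp only [Proc.close, reduceCtorEq, Proc.repl.injEq] at hX
  rename_i P
  subst hX
  have hcl := h.closed
  simp only [Proc.ClosedAt] at hcl
  have hfn := h.fn
  simp only [Proc.fn] at hfn
  have hcs := h.clauses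
  simp only [Proc.instrAt, IProc.clauses] at hcs
  obtain ⟨n, how⟩ := h.owns
  set x := freshVar ρ ς H with hx
  obtain ⟨fρ, fς, fH⟩ := freshVar_spec ρ ς H
  rw [← hx] at fρ fς fH
  refine ⟨.prot ⟨P, 0 :: pos, t, env, ρ, .var x :: ς, H, Function.update θ x (.sess n), n :: ss,
      {κ ∈ K | ∃ xs, κ.2 = xs ++ n :: ss}⟩,
    .prot ⟨.repl P, pos, t, env, ρ, ς, H, θ, ss, {κ ∈ K | ¬ ∃ xs, κ.2 = xs ++ n :: ss}⟩,
    rfl, rfl, ?_, ?_, ?_⟩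
  · intro j hj
    rcases Multiset.mem_cons.1 hj with rfl | hj
    · refine ⟨hcl, h.env, hfn, ?_, ?_, hcs, h.repls_below fun path => ?_,
        by refine OwnsAll.owns ?_ P; exact fun pos' xs hp => ⟨how _ _ _ hp le_rfl, xs, rfl⟩⟩
      · exact (map_subst_update fρ).trans h.ρ
      · have := h.ς
        simp only [List.map_cons, map_subst_update fς, Pat.subst, Function.update_self]
        rw [this]
      · simp only [Proc.replsAbove, List.length_cons]; omega
    · obtain rfl := Multiset.mem_singleton.1 hj
      refine ⟨h.closed, h.env, h.fn, h.ρ, h.ς, h.clauses, h.repls, n + 1,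
        fun pos' xs l hp hl => ⟨how _ _ _ hp (by omega), ?_⟩⟩
      rintro ⟨ys, hys⟩
      have := (List.append_inj' hys (by simp)).2
      simp only [List.cons.injEq, and_true] at this
      omega
  · refine keys_pair (fun κ hκ => hκ.1) (fun κ hκ => hκ.1) ?_
    rw [Set.disjoint_left]
    rintro κ ⟨-, h0⟩ ⟨-, h1⟩
    exact h1 h0
  · intro I _ hok _
    refine ⟨fun j hj => ?_, by simp⟩
    rcases Multiset.mem_cons.1 hj with rfl | hj
    · intro F hF
      rw [Fact.subst_update (fH F hF)]
      exact hok F hF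
    · obtain rfl := Multiset.mem_singleton.1 hj
      exact hok

theorem ProtItem.evolves_out {i : ProtItem S}
    (h : i.WF P₀ (protocolClauses P₀.instr Init) ν E) {M N : S.Tm} {X : Proc S}
    (hX : i.code.close i.env 0 = .out M N X) :
    M.Ground E ∧ N.Ground E ∧ ∃ j : Item S, j.proc = X ∧
      Evolves P₀ Init ν E (.prot i) {j} ∅ {.message (M.patOf ν) (N.patOf ν)} := by
  obtain ⟨code, pos, t, env, ρ, ς, H, θ, ss, K⟩ := i
  cases code <;> simp only [Proc.close, reduceCtorEq, Proc.out.injEq] at hX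
  rename_i M' N' P
  obtain ⟨rfl, rfl, rfl⟩ := hX
  have hcl := h.closed
  simp only [Proc.ClosedAt] at hcl
  have hfn := h.fn
  simp only [Proc.fn] at hfn
  have hcs := h.clauses
  simp only [Proc.instrAt, IProc.clauses, Set.union_subset_iff, Set.singleton_subset_iff] at hcs
  have how : OwnsAll pos ss K := h.owns
  have hM : ∀ a ∈ M'.names, a ∈ (Proc.out M' N' P).fn := fun a ha => .inl (.inl ha)
  have hN : ∀ a ∈ N'.names, a ∈ (Proc.out M' N' P).fn := fun a ha => .inl (.inr ha)
  refine ⟨h.ground hcl.1 hM, h.ground hcl.2.1 hN,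
    .prot ⟨P, 0 :: pos, t, env, ρ, ς, H, θ, ss, K⟩, rfl, ?_, ?_, ?_⟩
  · intro j hj
    obtain rfl := Multiset.mem_singleton.1 hj
    exact ⟨hcl.2.2, h.env, fun a ha => hfn a (.inr ha), h.ρ, h.ς, hcs.1,
      h.repls_below fun path => rfl, (how.below 0).owns P⟩
  · exact keys_singleton subset_rfl
  · intro I hI hok _
    refine ⟨fun j hj => by obtain rfl := Multiset.mem_singleton.1 hj; exact hok, ?_⟩
    rintro F rfl
    have := hI _ hcs.2 θ hok
    simp only [Fact.subst] at this
    rwa [h.evalPat hcl.1 hM, h.evalPat hcl.2.1 hN] at this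

/-- The fresh variable of the clause is instantiated by the pattern of the received term; the
assumed message fact is the new hypothesis. -/
theorem ProtItem.evolves_inp {i : ProtItem S}
    (h : i.WF P₀ (protocolClauses P₀.instr Init) ν E) {M N : S.Tm} {X : Proc S}
    (hX : i.code.close i.env 0 = .inp M X) (hN : N.Ground E) :
    ∃ j : Item S, j.proc = X.inst N 0 ∧
      Evolves P₀ Init ν E (.prot i) {j} {.message (M.patOf ν) (N.patOf ν)} ∅ := by
  obtain ⟨code, pos, t, env, ρ, ς, H, θ, ss, K⟩ := i
  cases code <;> simp only [Proc.close, reduceCtorEq, Proc.inp.injEq] at hX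
  rename_i M' P
  obtain ⟨rfl, rfl⟩ := hX
  have hcl := h.closed
  simp only [Proc.ClosedAt] at hcl
  have hfn := h.fn
  simp only [Proc.fn] at hfn
  have hcs := h.clauses
  simp only [Proc.instrAt, IProc.clauses] at hcs
  have how : OwnsAll pos ss K := h.owns
  set x := freshVar ρ ς H with hx
  obtain ⟨fρ, fς, fH⟩ := freshVar_spec ρ ς H
  rw [← hx] at fρ fς fH
  have hρ : ρ.map (Pat.subst (Function.update θ x (N.patOf ν))) = env.map (Term.patOf ν) :=
    (map_subst_update fρ).trans h.ρ
  refine ⟨.prot ⟨P, 0 :: pos, t.map Nat.succ ++ [0], N :: env, .var x :: ρ, ς,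
      .message (envPat ρ M') (.var x) ::ₘ H, Function.update θ x (N.patOf ν), ss, K⟩,
    (Proc.inst_close h.vars_eq N P 0).symm, ?_, ?_, ?_⟩
  · intro j hj
    obtain rfl := Multiset.mem_singleton.1 hj
    refine ⟨hcl.2, ?_, fun a ha => hfn a (.inr ha), ?_, (map_subst_update fς).trans h.ς, hcs,
      h.repls_below fun path => rfl, (how.below 0).owns P⟩
    · intro M hM
      rcases List.mem_cons.1 hM with rfl | hM
      exacts [hN, h.env M hM]
    · simp only [List.map_cons, hρ, Pat.subst, Function.update_self]
  · exact keys_singleton subset_rfl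
  · intro I hI hok hpre
    refine ⟨?_, by simp⟩
    intro j hj
    obtain rfl := Multiset.mem_singleton.1 hj
    intro F hF
    rcases Multiset.mem_cons.1 hF with rfl | hF
    · simp only [Fact.subst, Pat.subst, Function.update_self]
      rw [envPat_subst hρ hcl.1 fun a ha => (h.fn a (.inl ha)).2]
      exact hpre _ rfl
    · simp only [Fact.subst_update (fH F hF)]
      exact hok F hF

theorem ProtItem.evolves_letd {i : ProtItem S}
    (h : i.WF P₀ (protocolClauses P₀.instr Init) ν E) {g : S.Des}
    {M : Fin (S.desArity g) → S.Tm} {X Y : Proc S}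
    (hX : i.code.close i.env 0 = .letd g M X Y) :
    (∀ M', S.Reduces g M M' → ∃ j : Item S, j.proc = X.inst M' 0 ∧
      Evolves P₀ Init ν E (.prot i) {j} ∅ ∅) ∧
    ∃ j : Item S, j.proc = Y ∧ Evolves P₀ Init ν E (.prot i) {j} ∅ ∅ := by
  obtain ⟨code, pos, t, env, ρ, ς, H, θ, ss, K⟩ := i
  cases code <;> simp only [Proc.close, reduceCtorEq, Proc.letd.injEq] at hX
  rename_i g' M₁ P Q
  obtain ⟨rfl, hX, rfl, rfl⟩ := hX
  obtain rfl := eq_of_heq hX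
  have hcl := h.closed
  simp only [Proc.ClosedAt] at hcl
  have hfn := h.fn
  simp only [Proc.fn] at hfn
  have hcs := h.clauses
  simp only [Proc.instrAt, IProc.clauses, Set.union_subset_iff] at hcs
  have how : OwnsAll pos ss K := h.owns
  have hnames : ∀ k, ∀ a ∈ (M₁ k).names, a ∈ (Proc.letd g' M₁ P Q).fn :=
    fun k a ha => .inl (.inl (Set.mem_iUnion.2 ⟨k, ha⟩))
  constructor
  · intro M' hM'
    have hgr : M'.Ground E := hM'.ground fun k => h.ground (hcl.1 k) (hnames k)
    obtain ⟨r, hr, σr, hlhs, hrhs⟩ := hM'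
    -- The actual reduction is a unifier of the symbolic arguments with the left-hand sides of the
    -- rule. It factors through the pair used in generating the clauses, and `θ'` is the
    -- substitution for the continuation.
    obtain ⟨s, hs, θ', rfl, hθ'⟩ := mguPair_complete (p := fun k => envPat ρ (M₁ k))
      (q := fun k => (r.lhs k).toPat Pat.var) (τ := θ) (τ' := fun x => (σr x).patOf ν) (by
        intro k
        rw [← Term.patOf_subst ((S.rules_nameless g' r hr).1 k), ← hlhs]
        exact h.evalPat (hcl.1 k) (hnames k))
    classical
    refine ⟨.prot ⟨P, 0 :: pos,
        if S.Nondet g' then t.map Nat.succ ++ [0] else t.map Nat.succ, M' :: env, (r.rhs.toPat Pat.var).subst s.2 ::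
        ρ.map (Pat.subst s.1), ς.map (Pat.subst s.1), H.map (Fact.subst s.1), θ', ss, K⟩,
      (Proc.inst_close h.vars_eq M' P 0).symm, ?_, ?_, ?_⟩
    · intro j hj
      obtain rfl := Multiset.mem_singleton.1 hj
      refine ⟨hcl.2.1, ?_, fun a ha => hfn a (.inl (.inr ha)), ?_, ?_,
        fun R hR => hcs.1 ⟨r, hr, s, hs, hR⟩, h.repls_below fun path => rfl, (how.below 0).owns P⟩
      · intro M hM
        rcases List.mem_cons.1 hM with rfl | hM
        exacts [hgr, h.env M hM]
      · have := h.ρ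
        simp only [List.map_cons, map_map_subst, List.cons.injEq]
        refine ⟨?_, this⟩
        rw [Pat.subst_subst, ← hθ', hrhs, Term.patOf_subst (S.rules_nameless g' r hr).2]
      · exact (map_map_subst _ _ _).trans h.ς
    · exact keys_singleton subset_rfl
    · intro I hI hok _
      refine ⟨?_, by simp⟩
      intro j hj
      obtain rfl := Multiset.mem_singleton.1 hj
      intro F hF
      obtain ⟨F₁, hF₁, rfl⟩ := Multiset.mem_map.1 hF
      simp only [Fact.subst_subst]
      exact hok F₁ hF₁
  · refine ⟨.prot ⟨Q, 1 :: pos, t, env, ρ, ς, H, θ, ss, K⟩, rfl, ?_, ?_, ?_⟩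
    · intro j hj
      obtain rfl := Multiset.mem_singleton.1 hj
      exact ⟨hcl.2.2, h.env, fun a ha => hfn a (.inr ha), h.ρ, h.ς, hcs.2,
        h.repls_below fun path => rfl, (how.below 1).owns Q⟩
    · exact keys_singleton subset_rfl
    · intro I hI hok _
      exact ⟨fun j hj => by obtain rfl := Multiset.mem_singleton.1 hj; exact hok, by simp⟩

theorem ProtItem.evolves_cond {i : ProtItem S}
    (h : i.WF P₀ (protocolClauses P₀.instr Init) ν E) {M N : S.Tm} {X Y : Proc S}
    (hX : i.code.close i.env 0 = .cond M N X Y) :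
    (M = N → ∃ j : Item S, j.proc = X ∧ Evolves P₀ Init ν E (.prot i) {j} ∅ ∅) ∧
    ∃ j : Item S, j.proc = Y ∧ Evolves P₀ Init ν E (.prot i) {j} ∅ ∅ := by
  obtain ⟨code, pos, t, env, ρ, ς, H, θ, ss, K⟩ := i
  cases code <;> simp only [Proc.close, reduceCtorEq, Proc.cond.injEq] at hX
  rename_i M₁ N₁ P Q
  obtain ⟨rfl, rfl, rfl, rfl⟩ := hX
  have hcl := h.closed
  simp only [Proc.ClosedAt] at hcl
  have hfn := h.fn
  simp only [Proc.fn] at hfn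
  have hcs := h.clauses
  simp only [Proc.instrAt, IProc.clauses, Set.union_subset_iff] at hcs
  have how : OwnsAll pos ss K := h.owns
  constructor
  · intro hMN
    obtain ⟨s, hs, θ', rfl⟩ := mgu_complete (p := envPat ρ M₁) (q := envPat ρ N₁) (τ := θ) (by
        have h1 := h.evalPat hcl.1 (fun a ha => .inl (.inl (.inl ha)))
        have h2 := h.evalPat hcl.2.1 (fun a ha => .inl (.inl (.inr ha)))
        exact h1.trans ((congrArg _ hMN).trans h2.symm))
    refine ⟨.prot ⟨P, 0 :: pos, t, env, ρ.map (Pat.subst s), ς.map (Pat.subst s),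
      H.map (Fact.subst s), θ', ss, K⟩, rfl, ?_, ?_, ?_⟩
    · intro j hj
      obtain rfl := Multiset.mem_singleton.1 hj
      exact ⟨hcl.2.2.1, h.env, fun a ha => hfn a (.inl (.inr ha)),
        (map_map_subst _ _ _).trans h.ρ, (map_map_subst _ _ _).trans h.ς,
        fun R hR => hcs.1 ⟨s, hs, hR⟩, h.repls_below fun path => rfl, (how.below 0).owns P⟩
    · exact keys_singleton subset_rfl
    · intro I hI hok _
      refine ⟨?_, by simp⟩
      intro j hj
      obtain rfl := Multiset.mem_singleton.1 hj
      intro F hF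
      obtain ⟨F₁, hF₁, rfl⟩ := Multiset.mem_map.1 hF
      simp only [Fact.subst_subst]
      exact hok F₁ hF₁
  · refine ⟨.prot ⟨Q, 1 :: pos, t, env, ρ, ς, H, θ, ss, K⟩, rfl, ?_, ?_, ?_⟩
    · intro j hj
      obtain rfl := Multiset.mem_singleton.1 hj
      exact ⟨hcl.2.2.2, h.env, fun a ha => hfn a (.inr ha), h.ρ, h.ς, hcs.2,
        h.repls_below fun path => rfl, (how.below 1).owns Q⟩
    · exact keys_singleton subset_rfl
    · intro I hI hok _
      exact ⟨fun j hj => by obtain rfl := Multiset.mem_singleton.1 hj; exact hok, by simp⟩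

theorem ProtItem.evolves_event {i : ProtItem S}
    (h : i.WF P₀ (protocolClauses P₀.instr Init) ν E) {M : S.Tm} {X : Proc S}
    (hX : i.code.close i.env 0 = .event M X) :
    M.Ground E ∧ ∃ j : Item S, j.proc = X ∧
      Evolves P₀ Init ν E (.prot i) {j} {.mevent (M.patOf ν)} {.event (M.patOf ν)} := by
  obtain ⟨code, pos, t, env, ρ, ς, H, θ, ss, K⟩ := i
  cases code <;> simp only [Proc.close, reduceCtorEq, Proc.event.injEq] at hX
  rename_i M' P
  obtain ⟨rfl, rfl⟩ := hX
  have hcl := h.closed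
  simp only [Proc.ClosedAt] at hcl
  have hfn := h.fn
  simp only [Proc.fn] at hfn
  have hcs := h.clauses
  simp only [Proc.instrAt, IProc.clauses, Set.union_subset_iff, Set.singleton_subset_iff] at hcs
  have how : OwnsAll pos ss K := h.owns
  have hM : ∀ a ∈ M'.names, a ∈ (Proc.event M' P).fn := fun a ha => .inl ha
  have heval := h.evalPat hcl.1 hM
  refine ⟨h.ground hcl.1 hM,
    .prot ⟨P, 0 :: pos, t, env, ρ, ς, .mevent (envPat ρ M') ::ₘ H, θ, ss, K⟩, rfl, ?_, ?_, ?_⟩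
  · intro j hj
    obtain rfl := Multiset.mem_singleton.1 hj
    exact ⟨hcl.2, h.env, fun a ha => hfn a (.inr ha), h.ρ, h.ς, hcs.1,
      h.repls_below fun path => rfl, (how.below 0).owns P⟩
  · exact keys_singleton subset_rfl
  · intro I hI hok hpre
    constructor
    · intro j hj
      obtain rfl := Multiset.mem_singleton.1 hj
      intro F hF
      rcases Multiset.mem_cons.1 hF with rfl | hF
      · simp only [Fact.subst, heval]
        exact hpre _ rfl
      · exact hok F hF
    · rintro F rfl
      have := hI _ hcs.2 θ hok
      simp only [Fact.subst] at this
      rwa [heval] at this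

end Items

section Adversary

variable {S : Signature.{u, v}} {P₀ : Proc S} {Init : Finset ℕ} {ν : ℕ → S.Pt} {E : Finset ℕ}

/-! #### Steps of adversary processes -/

/-- The adversary can rebuild such a term from its environment, the names in `Init` and public
constructors, each step being one of the attacker clauses. -/
theorem attacker_of_publicOnly {P : IProc S} {I : Fact S → Prop}
    (hI : IsModel (protocolClauses P Init) I) {env : List S.Tm}
    (henv : ∀ M ∈ env, I (.attacker (M.patOf ν))) {M : S.Tm} (hv : ∀ x ∈ M.vars, x < env.length)
    (hn : ∀ a ∈ M.names, a ∈ Init ∧ ν a = Pat.mkName (NameSym.free a) [])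
    (hp : M.AllCon (· ∈ S.pubCon)) : I (.attacker ((M.close env 0).patOf ν)) := by
  induction M with
  | var x =>
    have hx := hv x rfl
    simp only [Term.close, Term.subst, Term.envSubst_zero hx]
    exact henv _ (List.getElem_mem _)
  | name a =>
    obtain ⟨ha, hν⟩ := hn a rfl
    have := hI _ (.inr (.init a ha)) Pat.var (by simp)
    simp only [Term.close, Term.subst, Term.patOf, hν]
    simpa using this
  | app f args ih =>
    have h := hI _ (.inr (.rf f hp.1)) (argSubst fun i => ((args i).close env 0).patOf ν) (by
      intro F hF
      obtain ⟨i, rfl⟩ := mem_attackerAll.1 hF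
      simp only [Fact.subst, Pat.subst, argSubst_val]
      exact ih i (fun x hx => hv x (Set.mem_iUnion.2 ⟨i, hx⟩))
        (fun a ha => hn a (Set.mem_iUnion.2 ⟨i, ha⟩)) (hp.2 i))
    simp only [Fact.subst, Pat.subst, argSubst_val] at h
    exact h

theorem message_of_attacker {P : IProc S} {I : Fact S → Prop}
    (hI : IsModel (protocolClauses P Init) I) {p q : S.Pt} (hp : I (.attacker p))
    (hq : I (.attacker q)) : I (.message p q) := by
  have := hI _ (.inr .rs) (fun x => if x = 0 then p else q) (by
    intro F hF
    simp only [Multiset.insert_eq_cons, Multiset.mem_cons, Multiset.mem_singleton] at hF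
    rcases hF with rfl | rfl
    exacts [by simpa [Fact.subst, Pat.subst] using hp, by simpa [Fact.subst, Pat.subst] using hq])
  simpa [Fact.subst, Pat.subst] using this

theorem attacker_of_message {P : IProc S} {I : Fact S → Prop}
    (hI : IsModel (protocolClauses P Init) I) {p q : S.Pt} (hp : I (.attacker p))
    (hq : I (.message p q)) : I (.attacker q) := by
  have := hI _ (.inr .rl) (fun x => if x = 0 then p else q) (by
    intro F hF
    simp only [Multiset.insert_eq_cons, Multiset.mem_cons, Multiset.mem_singleton] at hF
    rcases hF with rfl | rfl
    exacts [by simpa [Fact.subst, Pat.subst] using hq, by simpa [Fact.subst, Pat.subst] using hp])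
  simpa [Fact.subst, Pat.subst] using this

theorem attacker_of_reduces {P : IProc S} {I : Fact S → Prop}
    (hI : IsModel (protocolClauses P Init) I) {g : S.Des} (hg : g ∈ S.pubDes)
    {M : Fin (S.desArity g) → S.Tm} {M' : S.Tm} (h : S.Reduces g M M')
    (hM : ∀ i, I (.attacker ((M i).patOf ν))) : I (.attacker (M'.patOf ν)) := by
  obtain ⟨r, hr, σ, h1, rfl⟩ := h
  have := hI _ (.inr (.rg g hg r hr)) (fun x => (σ x).patOf ν) (by
    intro F hF
    obtain ⟨i, rfl⟩ := mem_attackerAll.1 hF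
    simp only [Fact.subst]
    rw [← Term.patOf_subst ((S.rules_nameless g r hr).1 i), ← h1]
    exact hM i)
  simp only [Fact.subst] at this
  rwa [← Term.patOf_subst (S.rules_nameless g r hr).2] at this

theorem AdvWF.vars_eq {code : Proc S} {env : List S.Tm} (h : AdvWF Init ν E code env) :
    ∀ M ∈ env, M.vars = ∅ :=
  fun M hM => (h.env M hM).vars_eq

theorem AdvWF.ground {code : Proc S} {env : List S.Tm} (h : AdvWF Init ν E code env) {M : S.Tm}
    (hv : ∀ x ∈ M.vars, x < env.length) (hn : ∀ a ∈ M.names, a ∈ code.fn) :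
    (M.close env 0).Ground E :=
  Term.Ground.close h.env hv fun a ha => (h.fn a (hn a ha)).1

theorem AdvWF.knows {code : Proc S} {env : List S.Tm} (h : AdvWF Init ν E code env) {P : IProc S}
    {I : Fact S → Prop} (hI : IsModel (protocolClauses P Init) I)
    (henv : ∀ M ∈ env, I (.attacker (M.patOf ν))) {M : S.Tm}
    (hv : ∀ x ∈ M.vars, x < env.length) (hn : ∀ a ∈ M.names, a ∈ code.fn)
    (hp : M.AllCon (· ∈ S.pubCon)) : I (.attacker ((M.close env 0).patOf ν)) :=
  attacker_of_publicOnly hI henv hv (fun a ha => (h.fn a (hn a ha)).2) hp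

/-- The adversary item for a subprocess with one more term in the environment. -/
theorem AdvWF.cons {code P : Proc S} {env : List S.Tm} (h : AdvWF Init ν E code env) {N : S.Tm}
    (hN : N.Ground E) (hc : P.ClosedAt (env.length + 1)) (hfn : P.fn ⊆ code.fn)
    (hev : P.EventFree) (hp : P.PublicOnly) : AdvWF Init ν E P (N :: env) where
  closed := hc
  env M hM := by
    rcases List.mem_cons.1 hM with rfl | hM
    exacts [hN, h.env M hM]
  fn a ha := h.fn a (hfn ha)
  eventFree := hev
  publicOnly := hp

theorem AdvWF.sub {code P : Proc S} {env : List S.Tm} (h : AdvWF Init ν E code env)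
    (hc : P.ClosedAt env.length) (hfn : P.fn ⊆ code.fn)
    (hev : P.EventFree) (hp : P.PublicOnly) : AdvWF Init ν E P env :=
  ⟨hc, h.env, fun a ha => h.fn a (hfn ha), hev, hp⟩

theorem evolves_adv_single {code P : Proc S} {env env' : List S.Tm} {pre post : Set (Fact S)}
    (hwf : AdvWF Init ν E P env')
    (hs : ∀ I : Fact S → Prop, IsModel (protocolClauses P₀.instr Init) I →
      (∀ M ∈ env, I (.attacker (M.patOf ν))) → (∀ F ∈ pre, I F) →
      (∀ M ∈ env', I (.attacker (M.patOf ν))) ∧ ∀ F ∈ post, I F) :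
    Evolves P₀ Init ν E (.adv code env) {.adv P env'} pre post where
  wf j hj := by obtain rfl := Multiset.mem_singleton.1 hj; exact hwf
  keys := keys_singleton subset_rfl
  sound I hI hok hpre := by
    obtain ⟨h1, h2⟩ := hs I hI hok hpre
    refine ⟨fun j hj => ?_, h2⟩
    obtain rfl := Multiset.mem_singleton.1 hj
    exact h1

theorem evolves_adv_pair {code P Q : Proc S} {env : List S.Tm}
    (hP : AdvWF Init ν E P env) (hQ : AdvWF Init ν E Q env) :
    Evolves P₀ Init ν E (.adv code env) {.adv P env, .adv Q env} ∅ ∅ where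
  wf j hj := by
    rcases Multiset.mem_cons.1 hj with rfl | hj
    · exact hP
    · obtain rfl := Multiset.mem_singleton.1 hj
      exact hQ
  keys := keys_pair subset_rfl subset_rfl (Set.disjoint_empty _)
  sound I hI hok hpre := by
    refine ⟨fun j hj => ?_, by simp⟩
    rcases Multiset.mem_cons.1 hj with rfl | hj
    · exact hok
    · obtain rfl := Multiset.mem_singleton.1 hj
      exact hok

/-! #### Steps of all processes -/

namespace Item

variable {it : Item S}

theorem evolves_nil : Evolves P₀ Init ν E it 0 ∅ ∅ := ⟨by simp, by simp, by simp⟩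

theorem evolves_par (h : it.WF P₀ Init ν E) {X Y : Proc S} (hX : it.proc = .par X Y) :
    ∃ j k : Item S, j.proc = X ∧ k.proc = Y ∧ Evolves P₀ Init ν E it {j, k} ∅ ∅ := by
  cases it with
  | prot i => exact ProtItem.evolves_par h hX
  | adv code env =>
    cases code <;> simp only [Item.proc, Proc.close, reduceCtorEq, Proc.par.injEq] at hX
    obtain ⟨rfl, rfl⟩ := hX
    obtain ⟨hc, -, -, hev, hp⟩ := id h
    exact ⟨_, _, rfl, rfl, evolves_adv_pair (AdvWF.sub h hc.1 Set.subset_union_left hev.1 hp.1)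
      (AdvWF.sub h hc.2 Set.subset_union_right hev.2 hp.2)⟩

theorem evolves_repl (h : it.WF P₀ Init ν E) {X : Proc S} (hX : it.proc = .repl X) :
    ∃ j k : Item S, j.proc = X ∧ k.proc = .repl X ∧ Evolves P₀ Init ν E it {j, k} ∅ ∅ := by
  cases it with
  | prot i => exact ProtItem.evolves_repl h hX
  | adv code env =>
    have hX' := hX
    cases code <;> simp only [Item.proc, Proc.close, reduceCtorEq, Proc.repl.injEq] at hX
    rename_i P
    obtain ⟨hc, -, -, hev, hp⟩ := id h
    exact ⟨.adv P env, .adv (.repl P) env, hX, hX',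
      evolves_adv_pair (AdvWF.sub h hc subset_rfl hev hp) h⟩

theorem evolves_out (h : it.WF P₀ Init ν E) {M N : S.Tm} {X : Proc S}
    (hX : it.proc = .out M N X) :
    M.Ground E ∧ N.Ground E ∧ ∃ j : Item S, j.proc = X ∧
      Evolves P₀ Init ν E it {j} ∅ {.message (M.patOf ν) (N.patOf ν)} := by
  cases it with
  | prot i => exact ProtItem.evolves_out h hX
  | adv code env =>
    cases code <;> simp only [Item.proc, Proc.close, reduceCtorEq, Proc.out.injEq] at hX
    obtain ⟨rfl, rfl, rfl⟩ := hX
    obtain ⟨hc, -, -, hev, hp⟩ := id h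
    refine ⟨AdvWF.ground h hc.1 fun a ha => .inl (.inl ha),
      AdvWF.ground h hc.2.1 fun a ha => .inl (.inr ha), _, rfl,
      evolves_adv_single (AdvWF.sub h hc.2.2 Set.subset_union_right hev hp.2.2) ?_⟩
    intro I hI henv _
    refine ⟨henv, ?_⟩
    rintro F rfl
    exact message_of_attacker hI
      (AdvWF.knows h hI henv hc.1 (fun a ha => .inl (.inl ha)) hp.1)
      (AdvWF.knows h hI henv hc.2.1 (fun a ha => .inl (.inr ha)) hp.2.1)

theorem evolves_inp (h : it.WF P₀ Init ν E) {M N : S.Tm} {X : Proc S}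
    (hX : it.proc = .inp M X) (hN : N.Ground E) :
    ∃ j : Item S, j.proc = X.inst N 0 ∧
      Evolves P₀ Init ν E it {j} {.message (M.patOf ν) (N.patOf ν)} ∅ := by
  cases it with
  | prot i => exact ProtItem.evolves_inp h hX hN
  | adv code env =>
    cases code <;> simp only [Item.proc, Proc.close, reduceCtorEq, Proc.inp.injEq] at hX
    rename_i M' P
    obtain ⟨rfl, rfl⟩ := hX
    obtain ⟨hc, -, -, hev, hp⟩ := id h
    refine ⟨.adv P (N :: env), (Proc.inst_close (AdvWF.vars_eq h) N P 0).symm,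
      evolves_adv_single (AdvWF.cons h hN hc.2 Set.subset_union_right hev hp.2) ?_⟩
    intro I hI henv hpre
    refine ⟨fun M hM => ?_, by simp⟩
    rcases List.mem_cons.1 hM with rfl | hM
    · exact attacker_of_message hI (AdvWF.knows h hI henv hc.1 (fun a ha => .inl ha) hp.1)
        (hpre _ rfl)
    · exact henv M hM

theorem evolves_letd (h : it.WF P₀ Init ν E) {g : S.Des} {M : Fin (S.desArity g) → S.Tm}
    {X Y : Proc S} (hX : it.proc = .letd g M X Y) :
    (∀ M', S.Reduces g M M' → ∃ j : Item S, j.proc = X.inst M' 0 ∧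
      Evolves P₀ Init ν E it {j} ∅ ∅) ∧
    ∃ j : Item S, j.proc = Y ∧ Evolves P₀ Init ν E it {j} ∅ ∅ := by
  cases it with
  | prot i => exact ProtItem.evolves_letd h hX
  | adv code env =>
    cases code <;> simp only [Item.proc, Proc.close, reduceCtorEq, Proc.letd.injEq] at hX
    rename_i g' M₁ P Q
    obtain ⟨rfl, hX, rfl, rfl⟩ := hX
    obtain rfl := eq_of_heq hX
    obtain ⟨hc, -, -, hev, hp⟩ := id h
    have hn : ∀ k, ∀ a ∈ (M₁ k).names, a ∈ (Proc.letd g' M₁ P Q).fn :=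
      fun k a ha => .inl (.inl (Set.mem_iUnion.2 ⟨k, ha⟩))
    constructor
    · intro M' hM'
      refine ⟨.adv P (M' :: env), (Proc.inst_close (AdvWF.vars_eq h) M' P 0).symm,
        evolves_adv_single (AdvWF.cons h
          (hM'.ground fun k => AdvWF.ground h (hc.1 k) (hn k)) hc.2.1
          (fun a ha => .inl (.inr ha)) hev.1 hp.2.2.1) ?_⟩
      intro I hI henv hpre
      refine ⟨fun M hM => ?_, by simp⟩
      rcases List.mem_cons.1 hM with rfl | hM
      · exact attacker_of_reduces hI hp.1 hM' fun k =>
          AdvWF.knows h hI henv (hc.1 k) (hn k) (hp.2.1 k)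
      · exact henv M hM
    · exact ⟨_, rfl, evolves_adv_single (AdvWF.sub h hc.2.2 (fun a ha => .inr ha) hev.2 hp.2.2.2)
        fun I _ henv _ => ⟨henv, by simp⟩⟩

theorem evolves_cond (h : it.WF P₀ Init ν E) {M N : S.Tm} {X Y : Proc S}
    (hX : it.proc = .cond M N X Y) :
    (M = N → ∃ j : Item S, j.proc = X ∧ Evolves P₀ Init ν E it {j} ∅ ∅) ∧
    ∃ j : Item S, j.proc = Y ∧ Evolves P₀ Init ν E it {j} ∅ ∅ := by
  cases it with
  | prot i => exact ProtItem.evolves_cond h hX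
  | adv code env =>
    cases code <;> simp only [Item.proc, Proc.close, reduceCtorEq, Proc.cond.injEq] at hX
    obtain ⟨rfl, rfl, rfl, rfl⟩ := hX
    obtain ⟨hc, -, -, hev, hp⟩ := id h
    exact ⟨fun _ => ⟨_, rfl, evolves_adv_single
        (AdvWF.sub h hc.2.2.1 (fun a ha => .inl (.inr ha)) hev.1 hp.2.2.1)
        fun I _ henv _ => ⟨henv, by simp⟩⟩,
      ⟨_, rfl, evolves_adv_single
        (AdvWF.sub h hc.2.2.2 (fun a ha => .inr ha) hev.2 hp.2.2.2)
        fun I _ henv _ => ⟨henv, by simp⟩⟩⟩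

theorem evolves_event (h : it.WF P₀ Init ν E) {M : S.Tm} {X : Proc S}
    (hX : it.proc = .event M X) :
    M.Ground E ∧ ∃ j : Item S, j.proc = X ∧
      Evolves P₀ Init ν E it {j} {.mevent (M.patOf ν)} {.event (M.patOf ν)} := by
  cases it with
  | prot i => exact ProtItem.evolves_event h hX
  | adv code env =>
    cases code <;> simp only [Item.proc, Proc.close, reduceCtorEq] at hX
    exact h.eventFree.elim

/-- Patterns are assigned once and for all, so adding a name does not disturb the other processes.
-/
theorem WF.mono (h : it.WF P₀ Init ν E) {ν' : ℕ → S.Pt} {E' : Finset ℕ} (hE : E ⊆ E')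
    (hν : ∀ a ∈ E, ν' a = ν a) : it.WF P₀ Init ν' E' := by
  cases it with
  | prot i =>
    refine ⟨h.closed, fun M hM => (h.env M hM).mono hE, fun a ha => ?_, ?_, h.ς, h.clauses,
      h.repls, h.owns⟩
    · obtain ⟨h1, h2⟩ := h.fn a ha
      exact ⟨hE h1, (hν a h1).trans h2⟩
    · rw [h.ρ]
      exact List.map_congr_left fun M hM =>
        (Term.patOf_congr fun a ha => hν a ((h.env M hM).names_subset a ha)).symm
  | adv code env =>
    refine ⟨h.closed, fun M hM => (h.env M hM).mono hE, fun a ha => ?_, h.eventFree, h.publicOnly⟩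
    obtain ⟨h1, h2, h3⟩ := h.fn a ha
    exact ⟨hE h1, h2, (hν a h1).trans h3⟩

theorem OK.mono (h : it.WF P₀ Init ν E) {I : Fact S → Prop} (hok : it.OK ν I) {ν' : ℕ → S.Pt}
    (hν : ∀ a ∈ E, ν' a = ν a) : it.OK ν' I := by
  cases it with
  | prot i => exact hok
  | adv code env =>
    intro M hM
    rw [Term.patOf_congr fun a ha => hν a ((h.env M hM).names_subset a ha)]
    exact hok M hM

end Item

/-! ### Names created by restrictions -/

/-- The pattern of a name created at position `pos` in the sessions `ss`. -/
def boundName (pos : List ℕ) (ts : List S.Pt) (ss : List ℕ) : S.Pt :=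
  Pat.mkName (NameSym.bound pos) (ts ++ ss.reverse.map Pat.sess)

/-- Variables and session identifiers are concatenated in one argument list; knowing the number of
session identifiers for the position makes the split unique. -/
theorem boundName_injective {pos pos' : List ℕ} {ts ts' : List S.Pt} {ss ss' : List ℕ}
    (h : boundName pos ts ss = boundName pos' ts' ss') (hl : pos = pos' → ss.length = ss'.length) :
    pos = pos' ∧ ss = ss' := by
  obtain ⟨h1, h2⟩ := Pat.mkName_injective h
  have h1 : pos = pos' := by simpa using h1
  refine ⟨h1, ?_⟩
  have h3 := (List.append_inj' h2 (by simpa using hl h1)).2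
  have h4 := (List.map_injective_iff.2 fun a b hab => by simpa using hab) h3
  simpa using h4

/-- The key of the restriction is spent. Code below has a strictly longer position, so it still owns
every key it needs. -/
theorem ProtItem.exists_res {i : ProtItem S}
    (h : i.WF P₀ (protocolClauses P₀.instr Init) ν E) {X : Proc S}
    (hX : i.code.close i.env 0 = .res X) (a : ℕ) :
    ∃ (pos ss : List ℕ) (ts : List S.Pt) (j : Item S), (pos, ss) ∈ i.K ∧
      P₀.replsAbove pos.reverse = ss.length ∧ j.proc = X.inst (.name a) 0 ∧
      j.keys = i.K \ {(pos, ss)} ∧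
      (∀ ν' : ℕ → S.Pt, (∀ b ∈ E, ν' b = ν b) → ν' a = boundName pos ts ss →
        j.WF P₀ Init ν' (insert a E)) ∧
      ∀ (ν' : ℕ → S.Pt) (I : Fact S → Prop), (Item.prot i).OK ν I → j.OK ν' I := by
  obtain ⟨code, pos, t, env, ρ, ς, H, θ, ss, K⟩ := i
  cases code <;> simp only [Proc.close, reduceCtorEq, Proc.res.injEq] at hX
  rename_i P
  subst hX
  have hcl := h.closed
  simp only [Proc.ClosedAt] at hcl
  have hfn := h.fn
  simp only [Proc.fn] at hfn
  have hcs := h.clauses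
  simp only [Proc.instrAt, IProc.clauses] at hcs
  have how : OwnsAll pos ss K := h.owns
  set ts : List S.Pt := (t.map Term.var).map (envPat ρ) with hts
  refine ⟨pos, ss, ts.map (Pat.subst θ),
    .prot ⟨P, 0 :: pos, t.map Nat.succ, .name a :: env,
      Pat.mkName (NameSym.bound pos)
        (ts ++ (List.range ss.length).reverse.map fun i => ς.getD i (Pat.sess 0)) :: ρ,
      ς, H, θ, ss, K \ {(pos, ss)}⟩,
    how pos [] List.suffix_rfl, ?_, (Proc.inst_close h.vars_eq _ P 0).symm, rfl, ?_, ?_⟩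
  · have := h.repls []
    simpa [Proc.replsAbove_nil] using this
  · intro ν' hν' ha
    have hm := Item.WF.mono (it := .prot _) (E' := insert a E) h (Finset.subset_insert a E) hν'
    refine ⟨hcl, ?_, hm.fn, ?_, h.ς, hcs, h.repls_below fun path => rfl, OwnsAll.owns ?_ P⟩
    · intro M hM
      rcases List.mem_cons.1 hM with rfl | hM
      · exact ⟨rfl, fun b hb => by rw [show b = a from hb]; exact Finset.mem_insert_self a E⟩
      · exact hm.env M hM
    · have hmρ := hm.ρ
      simp only [List.map_cons, List.cons.injEq]
      refine ⟨?_, hmρ⟩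
      have hς := h.ς
      have hlen : ς.length = ss.length := by simpa using congrArg List.length hς
      -- The label lists the indices from the outermost replication inwards, whereas `ς` has the
      -- innermost session first.
      have hrev : (List.range ss.length).reverse.map (fun k => ς.getD k (Pat.sess 0)) =
          ς.reverse := by
        rw [← hlen, List.map_reverse]
        congr 1
        apply List.ext_getElem
        · simp
        · intro n h1 h2
          simp [h2]
      simp only [Term.patOf, ha, boundName, Pat.mkName_subst, List.map_append, hrev,
        List.map_reverse]
      simp only at hς
      rw [hς]
    · intro pos' xs hp
      refine ⟨how.below 0 _ _ hp, fun heq => ?_⟩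
      have : pos' = pos := congrArg Prod.fst heq
      subst this
      have := hp.length_le
      simp at this
  · exact fun ν' I hok => hok

end Adversary

/-! ### Configurations -/

section Configurations

variable {S : Signature.{u, v}} {P₀ : Proc S} {Init : Finset ℕ} {ν : ℕ → S.Pt} {E : Finset ℕ}

/-- The multiset `items` describes a configuration with the names `E`; different names have
different patterns, and processes of the protocol do not compete for the patterns of new names. -/
structure ConfigInv (P₀ : Proc S) (Init : Finset ℕ) (ν : ℕ → S.Pt) (E : Finset ℕ)
    (items : Multiset (Item S)) : Prop where
  wf : ∀ it ∈ items, it.WF P₀ Init ν E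
  keys : ∀ κ, (items.map fun j => j.keys.indicator (fun _ => 1) κ).sum ≤ 1
  names : ∀ a ∈ E, ν a = Pat.mkName (NameSym.free a) [] ∨
    ν a = Pat.mkName NameSym.adv [Pat.sess a] ∨
    ∃ pos ts ss, ν a = boundName pos ts ss ∧ P₀.replsAbove pos.reverse = ss.length
  used : ∀ a ∈ E, ∀ pos ts ss, ν a = boundName pos ts ss →
    P₀.replsAbove pos.reverse = ss.length → ∀ it ∈ items, (pos, ss) ∉ it.keys
  inj : Set.InjOn ν E

theorem Evolves.keys_subset {it : Item S} {new : Multiset (Item S)} {pre post : Set (Fact S)}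
    (h : Evolves P₀ Init ν E it new pre post) {j : Item S} (hj : j ∈ new) :
    j.keys ⊆ it.keys := by
  intro κ hκ
  by_contra hn
  have h1 := h.keys κ
  rw [Set.indicator_of_notMem hn] at h1
  have h2 := Multiset.le_sum_of_mem (Multiset.mem_map_of_mem
    (fun j : Item S => (j.keys.indicator (fun _ => 1) κ : ℕ)) hj)
  simp only [Set.indicator_of_mem hκ] at h2
  omega

theorem ConfigInv.evolve {it : Item S} {rest new : Multiset (Item S)} {pre post : Set (Fact S)}
    (h : ConfigInv P₀ Init ν E (it ::ₘ rest)) (he : Evolves P₀ Init ν E it new pre post) :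
    ConfigInv P₀ Init ν E (new + rest) where
  wf j hj := (Multiset.mem_add.1 hj).elim (he.wf j) fun hj => h.wf j (Multiset.mem_cons_of_mem hj)
  keys κ := by
    have h1 := h.keys κ
    have h2 := he.keys κ
    simp only [Multiset.map_cons, Multiset.sum_cons] at h1
    rw [Multiset.map_add, Multiset.sum_add]
    omega
  names := h.names
  used a ha pos ts ss hν hl j hj := (Multiset.mem_add.1 hj).elim
    (fun hj hk => h.used a ha pos ts ss hν hl it (by simp) (he.keys_subset hj hk))
    fun hj => h.used a ha pos ts ss hν hl j (Multiset.mem_cons_of_mem hj)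
  inj := h.inj

/-- The configuration described by `items` can make a step with the action `l` to `E', 𝒳'`, and
the events and the facts that processes rely on are consequences of the clauses. -/
def Advances (P₀ : Proc S) (Init : Finset ℕ) (ν : ℕ → S.Pt) (E : Finset ℕ)
    (items : Multiset (Item S)) (l : Action S) (E' : Finset ℕ) (𝒳' : Multiset (Proc S)) : Prop :=
  ∃ (ν' : ℕ → S.Pt) (items' : Multiset (Item S)), items'.map Item.proc = 𝒳' ∧
    ConfigInv P₀ Init ν' E' items' ∧ E ⊆ E' ∧ (∀ a ∈ E, ν' a = ν a) ∧
    (∀ M, l = .event M → M.Ground E) ∧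
    ∀ I : Fact S → Prop, IsModel (protocolClauses P₀.instr Init) I →
      (∀ it ∈ items, it.OK ν I) → (∀ M, l = .event M → I (.mevent (M.patOf ν))) →
      (∀ it ∈ items', it.OK ν' I) ∧ ∀ M, l = .event M → I (.event (M.patOf ν))

theorem ConfigInv.advances_tau {it : Item S} {rest new : Multiset (Item S)}
    (h : ConfigInv P₀ Init ν E (it ::ₘ rest)) (he : Evolves P₀ Init ν E it new ∅ ∅)
    {𝒳' : Multiset (Proc S)} (h𝒳 : (new + rest).map Item.proc = 𝒳') :
    Advances P₀ Init ν E (it ::ₘ rest) .tau E 𝒳' := by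
  refine ⟨ν, new + rest, h𝒳, h.evolve he, subset_rfl, fun _ _ => rfl, by simp, ?_⟩
  intro I hI hok _
  refine ⟨fun j hj => ?_, by simp⟩
  rcases Multiset.mem_add.1 hj with hj | hj
  · exact (he.sound I hI (hok it (by simp)) (by simp)).1 j hj
  · exact hok j (Multiset.mem_cons_of_mem hj)

theorem ConfigInv.advances_io {it₁ it₂ : Item S} {rest : Multiset (Item S)}
    (h : ConfigInv P₀ Init ν E (it₁ ::ₘ it₂ ::ₘ rest)) {N M : S.Tm} {X Y : Proc S}
    (h₁ : it₁.proc = .out N M Y) (h₂ : it₂.proc = .inp N X) :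
    Advances P₀ Init ν E (it₁ ::ₘ it₂ ::ₘ rest) (.comm N M) E
      (Y ::ₘ X.inst M 0 ::ₘ rest.map Item.proc) := by
  obtain ⟨-, hM, j, rfl, hj⟩ := Item.evolves_out (h.wf it₁ (by simp)) h₁
  obtain ⟨k, hk, hk'⟩ := Item.evolves_inp (h.wf it₂ (by simp)) h₂ hM
  have h' := h.evolve hj
  rw [Multiset.singleton_add, Multiset.cons_swap] at h'
  have h'' := h'.evolve hk'
  rw [Multiset.singleton_add, Multiset.cons_swap] at h''
  refine ⟨ν, _, by simp [hk], h'', subset_rfl, fun _ _ => rfl, by simp, ?_⟩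
  intro I hI hok _
  have s1 := hj.sound I hI (hok it₁ (by simp)) (by simp)
  have s2 := hk'.sound I hI (hok it₂ (by simp)) s1.2
  refine ⟨fun i hi => ?_, by simp⟩
  simp only [Multiset.mem_cons] at hi
  rcases hi with rfl | rfl | hi
  · exact s1.1 _ (by simp)
  · exact s2.1 _ (by simp)
  · exact hok i (by simp [hi])

theorem ConfigInv.advances_event {it : Item S} {rest : Multiset (Item S)}
    (h : ConfigInv P₀ Init ν E (it ::ₘ rest)) {M : S.Tm} {X : Proc S}
    (h₁ : it.proc = .event M X) :
    Advances P₀ Init ν E (it ::ₘ rest) (.event M) E (X ::ₘ rest.map Item.proc) := by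
  obtain ⟨hM, j, rfl, hj⟩ := Item.evolves_event (h.wf it (by simp)) h₁
  refine ⟨ν, {j} + rest, by simp, h.evolve hj, subset_rfl, fun _ _ => rfl, ?_, ?_⟩
  · rintro _ ⟨⟩
    exact hM
  · intro I hI hok hpre
    have s := hj.sound I hI (hok it (by simp)) (by rintro F rfl; exact hpre M rfl)
    refine ⟨fun i hi => ?_, ?_⟩
    · rcases Multiset.mem_add.1 hi with hi | hi
      · exact s.1 i hi
      · exact hok i (by simp [hi])
    · rintro _ ⟨⟩
      exact s.2 _ rfl

theorem boundName_ne_free {pos : List ℕ} {ts : List S.Pt} {ss : List ℕ} {a : ℕ}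
    {l : List S.Pt} : boundName pos ts ss ≠ Pat.mkName (NameSym.free a) l := fun h => by
  simpa using (Pat.mkName_injective h).1

theorem boundName_ne_adv {pos : List ℕ} {ts : List S.Pt} {ss : List ℕ}
    {l : List S.Pt} : boundName pos ts ss ≠ Pat.mkName NameSym.adv l := fun h => by
  simpa using (Pat.mkName_injective h).1

theorem injOn_insert_of_forall_ne {E : Finset ℕ} {ν ν' : ℕ → S.Pt} {a : ℕ}
    (hinj : Set.InjOn ν E) (hν : ∀ b ∈ E, ν' b = ν b) (ha : ∀ b ∈ E, ν b ≠ ν' a) :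
    Set.InjOn ν' (insert a E : Finset ℕ) := by
  intro b hb c hc hbc
  rcases Finset.mem_insert.1 (Finset.mem_coe.1 hb) with rfl | hb' <;>
    rcases Finset.mem_insert.1 (Finset.mem_coe.1 hc) with rfl | hc'
  · rfl
  · exact absurd (hbc.trans (hν c hc')).symm (ha c hc')
  · exact absurd ((hν b hb').symm.trans hbc) (ha b hb')
  · exact hinj hb' hc' ((hν b hb').symm.trans (hbc.trans (hν c hc')))

theorem ConfigInv.advances_res {it : Item S} {rest : Multiset (Item S)}
    (h : ConfigInv P₀ Init ν E (it ::ₘ rest)) {X : Proc S} (h₁ : it.proc = .res X) {a : ℕ}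
    (ha : a ∉ E) :
    Advances P₀ Init ν E (it ::ₘ rest) .tau (insert a E)
      (X.inst (.name a) 0 ::ₘ rest.map Item.proc) := by
  have hup : ∀ q : S.Pt, ∀ b ∈ E, Function.update ν a q b = ν b := fun q b hb =>
    Function.update_of_ne (ne_of_mem_of_not_mem hb ha) _ _
  have hwf := h.wf it (by simp)
  have hrest : ∀ q : S.Pt, ∀ j ∈ rest, j.WF P₀ Init (Function.update ν a q) (insert a E) :=
    fun q j hj => (h.wf j (Multiset.mem_cons_of_mem hj)).mono (Finset.subset_insert a E) (hup q)
  cases it with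
  | prot i =>
    obtain ⟨pos, ss, ts, j, hK, hl, hp, hk, hw, hok'⟩ := ProtItem.exists_res hwf h₁ a
    set q := boundName pos ts ss with hq
    -- An older name with this very pattern would have spent the key `(pos, ss)`, which the item
    -- still owns.
    have hused : ∀ b ∈ E, ν b ≠ q := fun b hb hbq =>
      h.used b hb pos ts ss hbq hl (.prot i) (by simp) hK
    refine ⟨Function.update ν a q, j ::ₘ rest, by simp [hp], ⟨?_, ?_, ?_, ?_, ?_⟩,
      Finset.subset_insert a E, hup q, by simp, ?_⟩
    · intro k hk
      rcases Multiset.mem_cons.1 hk with rfl | hk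
      · exact hw _ (hup q) (Function.update_self _ _ _)
      · exact hrest q k hk
    · intro κ
      have h1 := h.keys κ
      have h2 : (j.keys.indicator (fun _ => 1) κ : ℕ) ≤
          (Item.prot i).keys.indicator (fun _ => 1) κ :=
        Set.indicator_le_indicator_of_subset (hk ▸ Set.sdiff_subset) (fun _ => Nat.zero_le _) κ
      simp only [Multiset.map_cons, Multiset.sum_cons] at h1 ⊢
      omega
    · intro b hb
      rcases Finset.mem_insert.1 hb with rfl | hb
      · exact .inr (.inr ⟨pos, ts, ss, Function.update_self _ _ _, hl⟩)
      · rw [hup q b hb]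
        exact h.names b hb
    · intro b hb pos' ts' ss' hb' hl' k hk'
      rcases Finset.mem_insert.1 hb with rfl | hb
      · rw [Function.update_self] at hb'
        obtain ⟨rfl, rfl⟩ := boundName_injective hb' fun hpos => by rw [← hl, ← hl', hpos]
        -- The item that made the name has given up the key, and no other item had it, since the
        -- indicators sum to at most one.
        rcases Multiset.mem_cons.1 hk' with rfl | hk'
        · rw [hk]
          exact fun hmem => hmem.2 rfl
        · intro hmem
          have h1 := h.keys (pos, ss)
          have h2 := Multiset.le_sum_of_mem (Multiset.mem_map_of_mem
            (fun j : Item S => (j.keys.indicator (fun _ => 1) (pos, ss) : ℕ)) hk')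
          have h3 : (pos, ss) ∈ (Item.prot i).keys := hK
          simp only [Multiset.map_cons, Multiset.sum_cons, Set.indicator_of_mem h3,
            Set.indicator_of_mem hmem] at h1 h2
          omega
      · rw [hup q b hb] at hb'
        rcases Multiset.mem_cons.1 hk' with rfl | hk'
        · intro hmem
          rw [hk] at hmem
          exact h.used b hb pos' ts' ss' hb' hl' (.prot i) (by simp) hmem.1
        · exact h.used b hb pos' ts' ss' hb' hl' k (by simp [hk'])
    · exact injOn_insert_of_forall_ne h.inj (hup q) (by simpa using hused)
    · intro I _ hok _
      refine ⟨fun k hk => ?_, by simp⟩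
      rcases Multiset.mem_cons.1 hk with rfl | hk
      · exact hok' _ I (hok _ (by simp))
      · exact (hok k (by simp [hk])).mono (h.wf k (by simp [hk])) (hup q)
  | adv code env =>
    cases code <;> simp only [Item.proc, Proc.close, reduceCtorEq, Proc.res.injEq] at h₁
    rename_i P
    subst h₁
    set q : S.Pt := Pat.mkName NameSym.adv [Pat.sess a] with hq
    have hm := hwf.mono (Finset.subset_insert a E) (hup q)
    obtain ⟨hc, -, -, hev, hpub⟩ := id hwf
    refine ⟨Function.update ν a q, .adv P (.name a :: env) ::ₘ rest,
      by simp [Item.proc, Proc.inst_close (AdvWF.vars_eq hwf)], ⟨?_, ?_, ?_, ?_, ?_⟩,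
      Finset.subset_insert a E, hup q, by simp, ?_⟩
    · intro k hk
      rcases Multiset.mem_cons.1 hk with rfl | hk
      · refine AdvWF.cons hm ⟨rfl, fun b hb => ?_⟩ hc subset_rfl hev hpub
        rw [show b = a from hb]
        exact Finset.mem_insert_self a E
      · exact hrest q k hk
    · intro κ
      simpa [Item.keys] using h.keys κ
    · intro b hb
      rcases Finset.mem_insert.1 hb with rfl | hb
      · exact .inr (.inl (Function.update_self _ _ _))
      · rw [hup q b hb]
        exact h.names b hb
    · intro b hb pos' ts' ss' hb' hl' k hk
      rcases Finset.mem_insert.1 hb with rfl | hb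
      · rw [Function.update_self] at hb'
        exact absurd hb'.symm boundName_ne_adv
      · rw [hup q b hb] at hb'
        rcases Multiset.mem_cons.1 hk with rfl | hk
        · exact Set.notMem_empty _
        · exact h.used b hb pos' ts' ss' hb' hl' k (by simp [hk])
    · refine injOn_insert_of_forall_ne h.inj (hup q) fun b hb hbq => ?_
      rw [Function.update_self] at hbq
      rcases h.names b hb with h1 | h1 | ⟨pos, ts, ss, h1, -⟩ <;> rw [h1] at hbq
      · simpa using (Pat.mkName_injective hbq).1
      · have : b = a := by simpa using (Pat.mkName_injective hbq).2
        exact ha (this ▸ hb)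
      · exact boundName_ne_adv hbq
    · intro I hI hok _
      refine ⟨fun k hk => ?_, by simp⟩
      rcases Multiset.mem_cons.1 hk with rfl | hk
      · have hold : (Item.adv (Proc.res P) env).OK (Function.update ν a q) I :=
          (hok _ (by simp)).mono hwf (hup q)
        intro M hM
        rcases List.mem_cons.1 hM with rfl | hM
        -- The variable of `b₀[x]` is instantiated by the session constant `a`, the number of the
        -- new name, which keeps names of the adversary apart.
        · have := hI _ (.inr .rn) (fun _ => Pat.sess a) (by simp)
          simpa [Term.patOf, hq, Fact.subst, Pat.mkName_subst, Pat.subst] using this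
        · exact hold M hM
      · exact (hok k (by simp [hk])).mono (h.wf k (by simp [hk])) (hup q)

theorem exists_cons_of_map_eq {items : Multiset (Item S)} {X : Proc S} {𝒳 : Multiset (Proc S)}
    (h : items.map Item.proc = X ::ₘ 𝒳) :
    ∃ it rest, items = it ::ₘ rest ∧ it.proc = X ∧ rest.map Item.proc = 𝒳 := by
  obtain ⟨it, hit, rfl⟩ : ∃ it ∈ items, it.proc = X :=
    Multiset.mem_map.1 (h ▸ Multiset.mem_cons_self X 𝒳)
  obtain ⟨rest, rfl⟩ := Multiset.exists_cons_of_mem hit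
  exact ⟨it, rest, rfl, rfl, by simpa using h⟩

theorem ConfigInv.step {items : Multiset (Item S)} (h : ConfigInv P₀ Init ν E items)
    {𝒳 𝒳' : Multiset (Proc S)} {l : Action S} {E' : Finset ℕ} (hs : Step S E 𝒳 l E' 𝒳')
    (h𝒳 : items.map Item.proc = 𝒳) : Advances P₀ Init ν E items l E' 𝒳' := by
  cases hs with
  | nil =>
    obtain ⟨it, rest, rfl, hit, rfl⟩ := exists_cons_of_map_eq h𝒳
    exact h.advances_tau Item.evolves_nil (by simp)
  | repl _ P =>
    obtain ⟨it, rest, rfl, hit, rfl⟩ := exists_cons_of_map_eq h𝒳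
    obtain ⟨j, k, hj, hk, he⟩ := Item.evolves_repl (h.wf it (by simp)) hit
    exact h.advances_tau he (by simp [hj, hk])
  | par _ P Q =>
    obtain ⟨it, rest, rfl, hit, rfl⟩ := exists_cons_of_map_eq h𝒳
    obtain ⟨j, k, hj, hk, he⟩ := Item.evolves_par (h.wf it (by simp)) hit
    exact h.advances_tau he (by simp [hj, hk])
  | res _ P a ha =>
    obtain ⟨it, rest, rfl, hit, rfl⟩ := exists_cons_of_map_eq h𝒳
    exact h.advances_res hit ha
  | io _ N M P Q =>
    obtain ⟨it, rest, rfl, hit, hr⟩ := exists_cons_of_map_eq h𝒳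
    obtain ⟨it₂, rest, rfl, hit₂, rfl⟩ := exists_cons_of_map_eq hr
    exact h.advances_io hit hit₂
  | destr₁ _ g M P Q M' hM' =>
    obtain ⟨it, rest, rfl, hit, rfl⟩ := exists_cons_of_map_eq h𝒳
    obtain ⟨j, hj, he⟩ := (Item.evolves_letd (h.wf it (by simp)) hit).1 M' hM'
    exact h.advances_tau he (by simp [hj])
  | destr₂ _ g M P Q hM' =>
    obtain ⟨it, rest, rfl, hit, rfl⟩ := exists_cons_of_map_eq h𝒳
    obtain ⟨j, hj, he⟩ := (Item.evolves_letd (h.wf it (by simp)) hit).2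
    exact h.advances_tau he (by simp [hj])
  | cond₁ _ M P Q =>
    obtain ⟨it, rest, rfl, hit, rfl⟩ := exists_cons_of_map_eq h𝒳
    obtain ⟨j, hj, he⟩ := (Item.evolves_cond (h.wf it (by simp)) hit).1 rfl
    exact h.advances_tau he (by simp [hj])
  | cond₂ _ M N P Q hMN =>
    obtain ⟨it, rest, rfl, hit, rfl⟩ := exists_cons_of_map_eq h𝒳
    obtain ⟨j, hj, he⟩ := (Item.evolves_cond (h.wf it (by simp)) hit).2
    exact h.advances_tau he (by simp [hj])
  | event _ M P =>
    obtain ⟨it, rest, rfl, hit, rfl⟩ := exists_cons_of_map_eq h𝒳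
    exact h.advances_event hit

theorem ConfigInv.name_form {items : Multiset (Item S)} (h : ConfigInv P₀ Init ν E items) {a : ℕ}
    (ha : a ∈ E) : ∃ s l, ν a = Pat.mkName s l := by
  rcases h.names a ha with h1 | h1 | ⟨pos, ts, ss, h1, -⟩
  exacts [⟨_, _, h1⟩, ⟨_, _, h1⟩, ⟨_, _, h1⟩]

/-- The clauses are sound: the events of a trace are consequences of the clauses and of the
events that are executed. -/
theorem ConfigInv.trace {items : Multiset (Item S)} (h : ConfigInv P₀ Init ν E items)
    {𝒳 𝒳' : Multiset (Proc S)} {tr : List (Action S)} {E' : Finset ℕ}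
    (ht : Trace S E 𝒳 tr E' 𝒳') (h𝒳 : items.map Item.proc = 𝒳) :
    ∃ ν' : ℕ → S.Pt, (∀ a ∈ E, ν' a = ν a) ∧ E ⊆ E' ∧ Set.InjOn ν' E' ∧
      (∀ a ∈ E', ∃ s l, ν' a = Pat.mkName s l) ∧ (∀ M, .event M ∈ tr → M.Ground E') ∧
      ∀ I : Fact S → Prop, IsModel (protocolClauses P₀.instr Init) I →
        (∀ it ∈ items, it.OK ν I) → (∀ M, .event M ∈ tr → I (.mevent (M.patOf ν'))) →
        ∀ M, .event M ∈ tr → I (.event (M.patOf ν')) := by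
  induction ht generalizing ν items with
  | refl E 𝒳 =>
    exact ⟨ν, fun _ _ => rfl, subset_rfl, h.inj, fun a ha => h.name_form ha, by simp, by simp⟩
  | step hs _ ih =>
    obtain ⟨ν₁, items₁, h𝒳₁, hinv, hE, hν, hgr, hsound⟩ := h.step hs h𝒳
    obtain ⟨ν₂, hν₂, hE₂, hinj, hform, hgr₂, hsound₂⟩ := ih hinv h𝒳₁
    -- Events are evaluated with the final patterns, while the step used those of its own moment;
    -- both agree on the names existing then.
    have hpat : ∀ M : S.Tm, M.Ground _ → M.patOf ν₂ = M.patOf ν := fun M hM =>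
      Term.patOf_congr fun a ha => (hν₂ a (hE (hM.names_subset a ha))).trans
        (hν a (hM.names_subset a ha))
    refine ⟨ν₂, fun a ha => (hν₂ a (hE ha)).trans (hν a ha), hE.trans hE₂, hinj, hform, ?_, ?_⟩
    · intro M hM
      rcases List.mem_cons.1 hM with hM | hM
      · exact (hgr M hM.symm).mono (hE.trans hE₂)
      · exact hgr₂ M hM
    · intro I hI hok hme
      obtain ⟨hok₁, hev⟩ := hsound I hI hok fun M hM => by
        rw [← hpat M (hgr M hM)]
        exact hme M (by simp [hM])
      intro M hM
      rcases List.mem_cons.1 hM with hM | hM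
      · rw [hpat M (hgr M hM.symm)]
        exact hev M hM.symm
      · exact hsound₂ I hI hok₁ (fun M hM => hme M (List.mem_cons_of_mem _ hM)) M hM

/-- The initial configuration. -/
theorem configInv_init (hP₀ : P₀.Closed) {Q : Proc S} (hQ : IsAdversary Init Q)
    (hE : P₀.fn ⊆ E) (hInit : Init ⊆ E) :
    ConfigInv P₀ Init (fun a => Pat.mkName (NameSym.free a) []) E
      {.prot ⟨P₀, [], [], [], [], [], 0, Pat.var, [], Set.univ⟩, .adv Q []} where
  wf it hit := by
    rcases Multiset.mem_cons.1 hit with rfl | hit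
    · exact ⟨hP₀, by simp, fun a ha => ⟨hE ha, rfl⟩, rfl, rfl, Set.subset_union_left,
        fun path => by simp, OwnsAll.owns (fun _ _ _ => Set.mem_univ _) P₀⟩
    · obtain rfl := Multiset.mem_singleton.1 hit
      exact ⟨hQ.closed, by simp, fun a ha => ⟨hInit (hQ.fn_subset ha), hQ.fn_subset ha, rfl⟩,
        hQ.eventFree, hQ.publicOnly⟩
  keys κ := by simp [Item.keys]
  names a _ := .inl rfl
  used a _ pos ts ss h := absurd h.symm boundName_ne_free
  inj a _ b _ h := by simpa using (Pat.mkName_injective h).1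

end Configurations

/-! ### Non-injective agreement -/

section Agreement

variable {S : Signature.{u, v}}

theorem clauses_concl_ne_mevent (P : IProc S) (ρ ς : List S.Pt) (H : Multiset (Fact S))
    {R : Clause S} (hR : R ∈ P.clauses ρ ς H) (p : S.Pt) : R.concl ≠ .mevent p := by
  induction P generalizing ρ ς H with
  | nil => exact absurd hR (Set.notMem_empty R)
  | par P Q ihP ihQ => exact hR.elim (ihP _ _ _) (ihQ _ _ _)
  | repl P ih => exact ih _ _ _ hR
  | res l P ih => exact ih _ _ _ hR
  | inp M P ih => exact ih _ _ _ hR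
  | out M N P ih =>
    rcases hR with hR | rfl
    · exact ih _ _ _ hR
    · simp
  | letd g M P Q ihP ihQ =>
    rcases hR with ⟨r, _, s, _, hR⟩ | hR
    · exact ihP _ _ _ hR
    · exact ihQ _ _ _ hR
  | cond M N P Q ihP ihQ =>
    rcases hR with ⟨s, _, hR⟩ | hR
    · exact ihP _ _ _ hR
    · exact ihQ _ _ _ hR
  | event M P ih =>
    rcases hR with hR | rfl
    · exact ih _ _ _ hR
    · simp

theorem protocolClauses_concl_ne_mevent {P : IProc S} {Init : Finset ℕ} {R : Clause S}
    (hR : R ∈ protocolClauses P Init) (p : S.Pt) : R.concl ≠ .mevent p := by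
  rcases hR with hR | hR
  · exact clauses_concl_ne_mevent P _ _ _ hR p
  · cases hR <;> simp

/-- Correctness of the solving algorithm: if a query fact is derivable in every model that
contains the given `m-event` facts, then so are the hypotheses of an instance of a clause that
the algorithm returns. -/
theorem solve_complete {π : SolverParams S} {P : IProc S} {Init : Finset ℕ} {F : Fact S}
    {T : Set (Clause S)} (hT : π.SolveReturns P Init F T) (B : Set S.Pt) (σ : ℕ → S.Pt)
    (hF : ∀ I : Fact S → Prop, IsModel (protocolClauses P Init) I → (∀ p ∈ B, I (.mevent p)) →
      I (F.subst σ)) :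
    ∃ D ∈ T, (∃ σ', D.concl = F.subst σ') ∧ ∃ τ : ℕ → S.Pt, D.concl.subst τ = F.subst σ ∧
      ∀ p, .mevent p ∈ D.hyps → p.subst τ ∈ B := by
  obtain ⟨ℛ₁, hsat', hnot, rfl⟩ := hT
  obtain ⟨ℛ, hsat, rfl⟩ := exists_isSaturated hsat' fun R hR =>
    protocolClauses_concl_ne_mevent hR
  have hatt : ∀ R, AttackerClause Init R → R ∈ protocolClauses P Init := fun R hR => .inr hR
  have hfree := notFree_of_derivable_eq_empty (B := B) hsat hatt hnot
  -- The model is derivability from the returned clauses and `B`; here soundness of the clauses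
  -- meets the solver.
  obtain ⟨m, hm⟩ := hF _ (isModel_der hsat hatt hfree) fun p hp => ⟨0, .base 0 p hp⟩
  obtain ⟨D, hD, τ, hc, hh⟩ := exists_derivable hsat hatt F σ m (fun k _ => hfree k) hm
  refine ⟨D, hD, derivable_concl hD, τ, hc, fun p hp => ?_⟩
  obtain ⟨k, hk⟩ := hh _ hp
  exact mem_of_der_mevent hsat hk

end Agreement

end HornCorr

theorem mainTheorem10 {S : HornCorr.Signature.{u, v}} (Init : Finset ℕ) (P₀ : HornCorr.Proc S)
    (hP₀ : P₀.Closed) (e e' : S.Con) (he : S.arity e' = S.arity e)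
    (π : HornCorr.SolverParams S) (T : Set (HornCorr.Clause S))
    (hT : π.SolveReturns P₀.instr Init
      (HornCorr.Fact.event (HornCorr.Pat.app e (fun i => HornCorr.Pat.var i))) T)
    (h : ∀ R ∈ T, ∀ p : Fin (S.arity e) → S.Pt,
      R.concl = HornCorr.Fact.event (HornCorr.Pat.app e p) →
      HornCorr.Fact.mevent (HornCorr.Pat.app e' (fun i => p (Fin.cast he i))) ∈ R.hyps) :
    HornCorr.NonInjAgreement Init P₀ e e' := by
  intro Q hQ E₀ hP₀E hInit _ _ σ tr E' 𝒳' htr hsat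
  obtain ⟨ν, -, -, hinj, hform, hgr, hsound⟩ :=
    (HornCorr.configInv_init hP₀ hQ hP₀E hInit).trace htr (by
      simp [HornCorr.Item.proc, HornCorr.Proc.close_nil])
  have hev : HornCorr.Action.event (HornCorr.Term.app e fun i => σ i) ∈ tr := hsat
  -- `B` consists of the patterns of all executed events, so every `m-event` hypothesis of the
  -- returned clause points to an executed event.
  obtain ⟨D, hD, ⟨σ', hσ'⟩, τ, hc, hh⟩ := HornCorr.solve_complete hT
    {p | ∃ M, HornCorr.Action.event M ∈ tr ∧ p = M.patOf ν} (fun k => (σ k).patOf ν) (by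
      intro I hI hB
      refine hsound I hI ?_ (fun M hM => hB _ ⟨M, hM, rfl⟩) _ hev
      intro it hit
      rcases Multiset.mem_cons.1 hit with rfl | hit
      · intro F hF
        simp at hF
      · obtain rfl := Multiset.mem_singleton.1 hit
        intro M hM
        simp at hM)
  simp only [HornCorr.Fact.subst, HornCorr.Pat.subst] at hσ' hc
  obtain ⟨M, hM, hpM⟩ := hh _ (h D hD _ hσ')
  rw [hσ'] at hc
  simp only [HornCorr.Pat.subst, HornCorr.Fact.event.injEq,
    HornCorr.Pat.app.injEq, heq_eq_eq, true_and] at hc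
  -- `σ` itself serves: the arguments of `e` and `e'` are the same variables.
  refine ⟨_, List.mem_singleton_self _, σ, rfl, ?_⟩
  intro N hN
  obtain rfl := List.mem_singleton.1 hN
  have hg := hgr _ hev
  -- The executed event `M` is known only by its pattern. Injectivity on closed terms over the names
  -- of the trace identifies it with the instance of `e'`, whose arguments are closed because they
  -- occur in the executed `e` event.
  have hM' : M = HornCorr.Term.app e' fun i => σ i := by
    refine HornCorr.Term.patOf_injective hinj hform (hgr M hM) ⟨?_, ?_⟩ ?_
    · refine Set.eq_empty_of_forall_notMem fun x hx => ?_
      obtain ⟨i, hi⟩ := Set.mem_iUnion.1 hx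
      have := (hg.arg (Fin.cast he i)).vars_eq
      simp only [Fin.val_cast] at this
      rw [this] at hi
      exact hi
    · intro a ha
      obtain ⟨i, hi⟩ := Set.mem_iUnion.1 ha
      exact (hg.arg (Fin.cast he i)).names_subset a hi
    · rw [← hpM]
      simp only [HornCorr.Pat.subst, HornCorr.Term.patOf]
      congr 1
      funext i
      exact congrFun hc (Fin.cast he i)
  rw [hM'] at hM
  exact hM
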